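/- **Proposition (wedge of iterated integrals).** *Forms.* Let $\mathbb{Z}\langle\vartheta,x_1,\dots,x_n\rangle$ be the divided power polynomial ring (free abelian group on the monomials $\vartheta^{[N_0]}x_1^{[N_1]}\cdots x_n^{[N_n]}$, with $x^{[a]}x^{[b]}=\binom{a+b}{a}x^{[a+b]}$), put $x_0=\vartheta$, and let $A^\bullet(\Delta^n)$ be the exterior algebra over it on $dx_1,\dots,dx_n$ (with $dx_0=d\vartheta=0$). An order-preserving $\alpha\colon[m]\to[n]$ induces a ring homomorphism $\alpha^*\colon A^\bullet(\Delta^n)\to A^\bullet(\Delta^m)$ by $x_i^{[N]}\mapsto x_{j}^{[N]}$, $dx_i\mapsto dx_j$ with $j=\min\{j\mid\alpha(j)\ge i\}$, and by $x_i^{[N]}\mapsto0$ ($N\geq 1$), $dx_i\mapsto 0$ if there is no such $j$. A differential form on a simplicial set $X$ is a simplicial map $X\to A^\bullet(\Delta^{-})$; wedge products are formed simplexwise. *Fiberwise integration.* For a maximal chain $\Gamma=(\Gamma_b,\Gamma_f)\colon[n+r]\hookrightarrow[n]\times[r]$ put $b(i)=\min\{j\mid\Gamma_b(j)=i\}$ and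 $f(i)=\min\{j\mid\Gamma_f(j)\ge i\}$. The map $\int_\Gamma\colon A^\bullet(\Delta^{n+r})\to A^\bullet(\Delta^n)$ is the additive map sending $g\,dx_{f(1)}\wedge\dots\wedge dx_{f(r)}\wedge\eta$, with $\eta$ a product of differentials $dx_{b(i)}$, to $b^*\big(\int_{x_{f(r)+1}}^{x_{u(r)}}\cdots\int_{x_{f(1)+1}}^{x_{u(1)}}g\,dx_{f(1)}\cdots dx_{f(r)}\big)\wedge b^*\eta$, and killing $g\,\eta'$ for every product $\eta'$ of coordinate differentials in which some $dx_{f(i)}$ is missing. Here $x_{n+r+1}=0$, the integral in $x_{f(1)}$ is taken first, $\int_{\alpha}^{\beta} x_k^{[N]}dx_k=\beta^{[N+1]}-\alpha^{[N+1]}$, and $u(i)=f(j_0)-1$ where $j_0=\min\{j\geq1\mid f(j)-j=f(i)-i\}$. Let $\Phi$ be a form on $X\times\Delta^r$ and $x\in X_n$. Write the form $(x\times\mathrm{id})^*\Phi$ on $\Delta^n\times\Delta^r$, viewed as an $n$-simplex of the function complex $A^\bullet(\Delta^-)^{\Delta^r}$, as $\sigma^*\tilde\Phi$ with $\sigma\colon[n]\to[m]$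 surjective and $\tilde\Phi$ a nondegenerate $m$-simplex (Eilenberg–Zilber). The fiberwise integral of $\Phi$ along $X\times\Delta^r\to X$ has at $x$ the value $\sigma^*\sum_{\Gamma\colon[m+r]\hookrightarrow[m]\times[r]}\int_\Gamma\Gamma^*\tilde\Phi$. *Iterated integrals.* For forms $\omega_1,\dots,\omega_r$ on $X$ ($r\ge0$), $\int\omega_1\cdots\omega_r$ is the fiberwise integral along $X^{\Delta^1}\times\Delta^r\to X^{\Delta^1}$ of $\phi_1^*\omega_1\wedge\dots\wedge\phi_r^*\omega_r$, where $\phi_i\colon X^{\Delta^1}\times\Delta^r\to X$ is the evaluation of paths at the map $\Delta^r\to\Delta^1$ given on vertices by $j\mapsto1$ if $j\ge i$ and $j\mapsto0$ if $j<i$. *Signs.* For integers $d_1,\dots,d_r$ and a permutation $\sigma$ let $\varepsilon(\sigma;d_1,\dots,d_r)=\prod_{i<j,\ \sigma(i)>\sigma(j)}(-1)^{d_{\sigma(i)}d_{\sigma(j)}}$ be the Koszul sign and let $s(d_1,\dots,d_r)=(-1)^{\sum_{i=1}^r(r-i)d_i}$. Let $\mathsf{Sh}(p,q)$ be the set of permutations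 $\sigma$ of $\{1,\dots,p+q\}$ with $\sigma^{-1}(1)<\dots<\sigma^{-1}(p)$ and $\sigma^{-1}(p+1)<\dots<\sigma^{-1}(p+q)$. *Claim.* Let $X$ be a simplicial set, $p,q\ge0$, and let $\omega_1,\dots,\omega_{p+q}$ be homogeneous differential forms on $X$; put $d_i=|\omega_i|-1$. Then $$\Big(\int\omega_1\cdots\omega_p\Big)\wedge\Big(\int\omega_{p+1}\cdots\omega_{p+q}\Big)=\sum_{\sigma\in\mathsf{Sh}(p,q)}\varepsilon(\sigma;d_1,\dots,d_{p+q})\,s(d_1,\dots,d_p)\,s(d_{p+1},\dots,d_{p+q})\,s(d_{\sigma(1)},\dots,d_{\sigma(p+q)})\int\omega_{\sigma(1)}\cdots\omega_{\sigma(p+q)}.$$ Equivalently, the normalized integrals $\mathbb{I}[\omega_1|\cdots|\omega_r]=s(d_1,\dots,d_r)\int\omega_1\cdots\omega_r$ satisfy $\mathbb{I}[\omega_1|\cdots|\omega_p]\wedge\mathbb{I}[\omega_{p+1}|\cdots|\omega_{p+q}]=\sum_{\sigma\in\mathsf{Sh}(p,q)}\varepsilon(\sigma;d_1,\dots,d_{p+q})\,\mathbb{I}[\omega_{\sigma(1)}|\cdots|\omega_{\sigma(p+q)}]$.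 -/

import Mathlib

open CategoryTheory MonoidalCategory TensorProduct

universe u

namespace SimplicialIteratedIntegral

/-! ### The divided power polynomial ring `ℤ⟨ϑ, x₁, …, xₙ⟩` -/

/-- The free abelian group on the symbols `x₀^[N₀] ⋯ xₙ^[Nₙ]`; the variable `x₀` is `ϑ`.
The product is the divided power product defined below. -/
def DP (n : ℕ) : Type := (Fin (n + 1) →₀ ℕ) →₀ ℤ

namespace DP

variable {n m l : ℕ}

noncomputable instance : AddCommGroup (DP n) :=
  inferInstanceAs (AddCommGroup ((Fin (n + 1) →₀ ℕ) →₀ ℤ))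

/-- The element `a • x₀^[N₀] ⋯ xₙ^[Nₙ]`. -/
noncomputable def mono (N : Fin (n + 1) →₀ ℕ) (a : ℤ) : DP n := Finsupp.single N a

/-- The additive map out of `DP n` with prescribed values on the basis monomials. -/
noncomputable def lift {M : Type*} [AddCommGroup M] (g : (Fin (n + 1) →₀ ℕ) → M) : DP n →+ M :=
  Finsupp.liftAddHom fun N => (zmultiplesHom M) (g N)

lemma lift_mono {M : Type*} [AddCommGroup M] (g : (Fin (n + 1) →₀ ℕ) → M)
    (N : Fin (n + 1) →₀ ℕ) (a : ℤ) : lift g (mono N a) = a • g N := by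
  exact (Finsupp.liftAddHom_apply_single _ N a).trans rfl

lemma hom_ext {M : Type*} [AddCommGroup M] {f g : DP n →+ M}
    (h : ∀ N, f (mono N 1) = g (mono N 1)) : f = g := by
  refine Finsupp.addHom_ext fun N a => ?_
  have : (Finsupp.single N a : (Fin (n + 1) →₀ ℕ) →₀ ℤ) = a • (mono N 1 : DP n) := by
    change _ = a • (Finsupp.single N 1 : (Fin (n + 1) →₀ ℕ) →₀ ℤ)
    simp
  rw [this]
  exact (map_zsmul f a _).trans ((congrArg (a • ·) (h N)).trans (map_zsmul g a _).symm)

/-- `(x^[N]) (x^[M]) = ∏ᵢ ((Nᵢ + Mᵢ)! / (Nᵢ! Mᵢ!)) x^[N + M]`, extended bilinearly. -/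
noncomputable def mulHom : DP n →+ DP n →+ DP n :=
  lift fun N => lift fun M => mono (N + M) (∏ i, ((N i + M i).choose (N i) : ℤ))

noncomputable instance : Mul (DP n) := ⟨fun f g => mulHom f g⟩
noncomputable instance : One (DP n) := ⟨mono 0 1⟩

/-- The canonical embedding into `ℚ[x₀, …, xₙ]`,
`x₀^[N₀] ⋯ xₙ^[Nₙ] ↦ x₀^N₀ ⋯ xₙ^Nₙ / (N₀! ⋯ Nₙ!)`. -/
noncomputable def toPolyHom (n : ℕ) : DP n →+ MvPolynomial (Fin (n + 1)) ℚ :=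
  lift fun N => MvPolynomial.monomial N (∏ i, ((N i).factorial : ℚ)⁻¹)

lemma toPolyHom_mono (N : Fin (n + 1) →₀ ℕ) :
    toPolyHom n (mono N 1) = MvPolynomial.monomial N (∏ i, ((N i).factorial : ℚ)⁻¹) := by
  simp [toPolyHom, lift_mono]

lemma toPolyHom_one : toPolyHom n 1 = 1 := by
  change toPolyHom n (mono 0 1) = 1
  simp [toPolyHom_mono]

lemma mono_eq_zsmul (N : Fin (n + 1) →₀ ℕ) (a : ℤ) : (mono N a : DP n) = a • mono N 1 := by
  change (Finsupp.single N a : (Fin (n + 1) →₀ ℕ) →₀ ℤ) =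
    a • (Finsupp.single N 1 : (Fin (n + 1) →₀ ℕ) →₀ ℤ)
  simp

lemma toPolyHom_mul (f g : DP n) : toPolyHom n (f * g) = toPolyHom n f * toPolyHom n g := by
  have h : (AddMonoidHom.compHom (toPolyHom n)).comp mulHom =
      ((AddMonoidHom.mul.comp (toPolyHom n)).compr₂ (AddMonoidHom.id _)).compl₂ (toPolyHom n) := by
    refine hom_ext fun N => hom_ext fun M => ?_
    change toPolyHom n (mulHom (mono N 1) (mono M 1)) =
      toPolyHom n (mono N 1) * toPolyHom n (mono M 1)
    rw [toPolyHom_mono, toPolyHom_mono, mulHom, lift_mono, one_smul, lift_mono, one_smul,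
      mono_eq_zsmul, map_zsmul, toPolyHom_mono, MvPolynomial.monomial_mul, ← map_zsmul]
    congr 1
    rw [zsmul_eq_mul, Int.cast_prod, ← Finset.prod_mul_distrib, ← Finset.prod_mul_distrib]
    refine Finset.prod_congr rfl fun i _ => ?_
    have h1 := Nat.add_choose_mul_factorial_mul_factorial (N i) (M i)
    have h2 : (((N i + M i).choose (N i) : ℕ) : ℚ) * (N i).factorial * (M i).factorial =
        (N i + M i).factorial := by exact_mod_cast (Nat.choose_symm_add (a := N i) (b := M i)) ▸ h1
    have a1 : ((N i).factorial : ℚ) ≠ 0 := by positivity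
    have a2 : ((M i).factorial : ℚ) ≠ 0 := by positivity
    have a3 : ((N i + M i).factorial : ℚ) ≠ 0 := by positivity
    rw [Finsupp.add_apply]
    field_simp
    rw [← h2]
    push_cast
    ring
  exact DFunLike.congr_fun (DFunLike.congr_fun h f) g

lemma coeff_toPolyHom (f : DP n) (N : Fin (n + 1) →₀ ℕ) :
    MvPolynomial.coeff N (toPolyHom n f) =
      ((show (Fin (n + 1) →₀ ℕ) →₀ ℤ from f) N : ℚ) * ∏ i, ((N i).factorial : ℚ)⁻¹ := by
  classical
  let A : DP n →+ ℚ :=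
    (MvPolynomial.coeffAddMonoidHom N).comp (toPolyHom n)
  let B : DP n →+ ℚ := (AddMonoidHom.mulRight (∏ i, ((N i).factorial : ℚ)⁻¹)).comp
    ((Int.castAddHom ℚ).comp (Finsupp.applyAddHom N : ((Fin (n + 1) →₀ ℕ) →₀ ℤ) →+ ℤ))
  have h : A = B := by
    refine hom_ext fun M => ?_
    change MvPolynomial.coeff N (toPolyHom n (mono M 1)) =
      (((Finsupp.single M (1 : ℤ)) N : ℤ) : ℚ) * _
    rw [toPolyHom_mono, MvPolynomial.coeff_monomial, Finsupp.single_apply]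
    split_ifs with hMN
    · subst hMN; simp
    · simp
  exact DFunLike.congr_fun h f

lemma toPolyHom_injective : Function.Injective (toPolyHom n) := by
  intro f g h
  refine Finsupp.ext fun N => ?_
  have h1 := coeff_toPolyHom f N
  rw [h, coeff_toPolyHom] at h1
  have h2 : (∏ i, ((N i).factorial : ℚ)⁻¹) ≠ 0 :=
    Finset.prod_ne_zero_iff.2 fun i _ => by positivity
  exact_mod_cast (mul_right_cancel₀ h2 h1).symm

noncomputable instance : CommRing (DP n) :=
  { (inferInstance : AddCommGroup (DP n)) with
    mul := (· * ·)
    one := 1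
    left_distrib := fun f g h => map_add (mulHom f) g h
    right_distrib := fun f g h => DFunLike.congr_fun (map_add mulHom f g) h
    zero_mul := fun f => DFunLike.congr_fun (map_zero mulHom) f
    mul_zero := fun f => map_zero (mulHom f)
    mul_assoc := fun f g h => toPolyHom_injective <| by simp only [toPolyHom_mul, mul_assoc]
    one_mul := fun f => toPolyHom_injective <| by rw [toPolyHom_mul, toPolyHom_one, one_mul]
    mul_one := fun f => toPolyHom_injective <| by rw [toPolyHom_mul, toPolyHom_one, mul_one]
    mul_comm := fun f g => toPolyHom_injective <| by rw [toPolyHom_mul, toPolyHom_mul, mul_comm] }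

/-- The canonical embedding as a ring homomorphism. -/
noncomputable def toPoly (n : ℕ) : DP n →+* MvPolynomial (Fin (n + 1)) ℚ :=
  { toPolyHom n with
    map_one' := toPolyHom_one
    map_mul' := toPolyHom_mul }

/-- The divided power `x_j^[k]`, for any index `j : ℕ`, with the conventions `x₀ = ϑ` and
`x_j = 0` for `j > n`. -/
noncomputable def xpow (n j k : ℕ) : DP n :=
  if h : j < n + 1 then mono (Finsupp.single ⟨j, h⟩ k) 1 else if k = 0 then 1 else 0

/-- The polynomial variable of index `j`, zero for `j > n`. -/
noncomputable def polyX (n j : ℕ) : MvPolynomial (Fin (n + 1)) ℚ :=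
  if h : j < n + 1 then MvPolynomial.X ⟨j, h⟩ else 0

lemma toPoly_xpow (n j k : ℕ) :
    toPoly n (xpow n j k) = MvPolynomial.C ((k.factorial : ℚ)⁻¹) * polyX n j ^ k := by
  classical
  unfold xpow polyX
  split_ifs with h hk
  · change toPolyHom n _ = _
    rw [toPolyHom_mono, MvPolynomial.X_pow_eq_monomial, MvPolynomial.C_mul_monomial, mul_one]
    congr 1
    rw [Finset.prod_eq_single ⟨j, h⟩]
    · simp
    · intro i _ hi
      rw [Finsupp.single_eq_of_ne hi]
      simp
    · simp
  · subst hk; simp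
  · simp [hk]

/-- The additive map `∏ᵢ xᵢ^[Nᵢ] ↦ ∏ᵢ x_{s i}^[Nᵢ]`. -/
noncomputable def substHom (m : ℕ) (s : Fin (n + 1) → ℕ) : DP n →+ DP m :=
  lift fun N => ∏ i, xpow m (s i) (N i)

lemma toPoly_substHom (s : Fin (n + 1) → ℕ) (f : DP n) :
    toPoly m (substHom m s f) = MvPolynomial.aeval (fun i => polyX m (s i)) (toPoly n f) := by
  have h : (toPoly m).toAddMonoidHom.comp (substHom m s) =
      (MvPolynomial.aeval (R := ℚ) fun i => polyX m (s i)).toRingHom.toAddMonoidHom.comp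
        (toPolyHom n) := by
    refine hom_ext fun N => ?_
    change toPoly m (substHom m s (mono N 1)) =
      MvPolynomial.aeval (fun i => polyX m (s i)) (toPolyHom n (mono N 1))
    rw [toPolyHom_mono, substHom, lift_mono, one_smul, map_prod, MvPolynomial.aeval_monomial,
      Finsupp.prod_fintype _ _ (fun i => by simp), map_prod, ← Finset.prod_mul_distrib]
    refine Finset.prod_congr rfl fun i _ => ?_
    rw [toPoly_xpow]
    rfl
  exact DFunLike.congr_fun h f

lemma toPoly_injective : Function.Injective (toPoly n) := toPolyHom_injective

/-- The ring homomorphism determined by `xᵢ^[k] ↦ x_{s i}^[k]`. -/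
noncomputable def subst (m : ℕ) (s : Fin (n + 1) → ℕ) : DP n →+* DP m :=
  { substHom m s with
    map_one' := toPoly_injective <| by
      change toPoly m (substHom m s 1) = _
      rw [toPoly_substHom, map_one, map_one, map_one]
    map_mul' := fun f g => toPoly_injective <| by
      change toPoly m (substHom m s (f * g)) = toPoly m (substHom m s f * substHom m s g)
      rw [RingHom.map_mul, toPoly_substHom, toPoly_substHom, toPoly_substHom, RingHom.map_mul,
        map_mul] }

lemma toPoly_subst (s : Fin (n + 1) → ℕ) (f : DP n) :
    toPoly m (subst m s f) = MvPolynomial.aeval (fun i => polyX m (s i)) (toPoly n f) :=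
  toPoly_substHom s f

/-- `∫_{x_lo}^{x_hi} f dxᵢ`: on monomials, the factor `xᵢ^[Nᵢ]` is replaced by
`x_hi^[Nᵢ + 1] - x_lo^[Nᵢ + 1]`, with `x₀ = ϑ` and `x_j = 0` for `j > n`. -/
noncomputable def integral (i : Fin (n + 1)) (lo hi : ℕ) : DP n →+ DP n :=
  lift fun N => mono (N.erase i) 1 * (xpow n hi (N i + 1) - xpow n lo (N i + 1))

end DP

/-! ### Divided power differential forms on the standard simplices -/

/-- For `α : [m] → [n]` and `i : ℕ`, the number `min {j ∈ [m] | α j ≥ i}`, which is `m + 1`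
if there is no such `j`. -/
noncomputable def firstGE {n m : ℕ} (α : Fin (m + 1) → Fin (n + 1)) (i : ℕ) : ℕ :=
  sInf {j : ℕ | ∀ h : j < m + 1, i ≤ α ⟨j, h⟩}

lemma firstGE_le_iff {n m : ℕ} {α : Fin (m + 1) → Fin (n + 1)} (hα : Monotone α) (i : ℕ) (j : ℕ) :
    firstGE α i ≤ j ↔ ∀ h : j < m + 1, i ≤ α ⟨j, h⟩ := by
  have hne : {j : ℕ | ∀ h : j < m + 1, i ≤ α ⟨j, h⟩}.Nonempty :=
    ⟨m + 1, fun h => absurd h (lt_irrefl _)⟩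
  constructor
  · intro h hj
    have h1 : firstGE α i < m + 1 := lt_of_le_of_lt h hj
    have h2 : ∀ h : firstGE α i < m + 1, i ≤ α ⟨firstGE α i, h⟩ := Nat.sInf_mem hne
    exact (h2 h1).trans (hα (show (⟨firstGE α i, h1⟩ : Fin (m + 1)) ≤ ⟨j, hj⟩ from h))
  · intro h
    exact Nat.sInf_le h

lemma firstGE_id {n : ℕ} (i : Fin (n + 1)) :
    firstGE (id : Fin (n + 1) → Fin (n + 1)) i = i := by
  refine eq_of_forall_ge_iff fun j => ?_
  rw [firstGE_le_iff monotone_id]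
  constructor
  · intro h
    by_cases hj : j < n + 1
    · exact h hj
    · omega
  · intro h _
    exact h

lemma firstGE_comp {n m l : ℕ} {α : Fin (l + 1) → Fin (m + 1)} {β : Fin (m + 1) → Fin (n + 1)}
    (hα : Monotone α) (hβ : Monotone β) (i : ℕ) :
    firstGE (β ∘ α) i = firstGE α (firstGE β i) := by
  refine eq_of_forall_ge_iff fun j => ?_
  rw [firstGE_le_iff (hβ.comp hα), firstGE_le_iff hα]
  refine forall_congr' fun h => ?_
  rw [firstGE_le_iff hβ]
  exact ⟨fun h' _ => h', fun h' => h' (α ⟨j, h⟩).2⟩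

/-- The vector `dx_j` in the free abelian group on `dx₁, …, dxₙ`, with the conventions
`dx₀ = dϑ = 0` and `dx_j = 0` for `j > n`. -/
def dx (n j : ℕ) : Fin n → ℤ := fun k => if (k : ℕ) + 1 = j then 1 else 0

/-- The coordinate function dual to `dx_j` (zero for `j = 0`). -/
def dxDual (n : ℕ) (j : Fin (n + 1)) : Module.Dual ℤ (Fin n → ℤ) :=
  Fin.cases (motive := fun _ => Module.Dual ℤ (Fin n → ℤ)) 0 (fun k => LinearMap.proj k) j

/-- The divided power differential forms on the standard `n`-simplex: the exterior algebra on
`dx₁, …, dxₙ` with coefficients in `ℤ⟨ϑ, x₁, …, xₙ⟩`. The wedge product is the product of this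
ring. -/
abbrev Forms (n : ℕ) : Type := DP n ⊗[ℤ] ExteriorAlgebra ℤ (Fin n → ℤ)

/-- The forms of degree `k`. -/
noncomputable def Forms.degreePart (n k : ℕ) : Submodule (DP n) (Forms n) :=
  (⋀[ℤ]^k (Fin n → ℤ)).baseChange (DP n)

/-- The map `dx_i ↦ dx_{min {j | α j ≥ i}}` of free abelian groups. -/
noncomputable def dxMap {n m : ℕ} (α : Fin (m + 1) → Fin (n + 1)) :
    (Fin n → ℤ) →ₗ[ℤ] (Fin m → ℤ) :=
  Fintype.linearCombination ℤ fun k : Fin n => dx m (firstGE α ((k : ℕ) + 1))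

/-- The pullback of divided power polynomials along `α : [m] → [n]`. -/
noncomputable def pullbackFun {n m : ℕ} (α : Fin (m + 1) → Fin (n + 1)) : DP n →+* DP m :=
  DP.subst m fun i => firstGE α i

/-- The pullback of differential forms along `α : [m] → [n]`. -/
noncomputable def pullback {n m : ℕ} (α : Fin (m + 1) → Fin (n + 1)) : Forms n →ₐ[ℤ] Forms m :=
  Algebra.TensorProduct.map (pullbackFun α).toIntAlgHom (ExteriorAlgebra.map (dxMap α))

lemma pullbackFun_id (n : ℕ) : pullbackFun (id : Fin (n + 1) → Fin (n + 1)) = RingHom.id _ := by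
  ext f
  apply DP.toPoly_injective
  rw [pullbackFun, DP.toPoly_subst]
  have : (fun i : Fin (n + 1) => DP.polyX n (firstGE (id : Fin (n + 1) → Fin (n + 1)) i)) =
      MvPolynomial.X := by
    funext i
    rw [firstGE_id, DP.polyX, dif_pos i.2]
  rw [this]
  simp

lemma pullbackFun_comp {n m l : ℕ} {α : Fin (l + 1) → Fin (m + 1)} {β : Fin (m + 1) → Fin (n + 1)}
    (hα : Monotone α) (hβ : Monotone β) :
    pullbackFun (β ∘ α) = (pullbackFun α).comp (pullbackFun β) := by
  ext f
  apply DP.toPoly_injective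
  rw [RingHom.comp_apply, pullbackFun, pullbackFun, pullbackFun, DP.toPoly_subst, DP.toPoly_subst,
    DP.toPoly_subst, ← AlgHom.comp_apply]
  congr 1
  refine MvPolynomial.algHom_ext fun i => ?_
  rw [AlgHom.comp_apply, MvPolynomial.aeval_X, MvPolynomial.aeval_X, firstGE_comp hα hβ]
  by_cases h : firstGE β i < m + 1
  · simp [DP.polyX, h]
  · have h' : ¬ firstGE α (firstGE β i) < l + 1 := by
      intro hlt
      have := (firstGE_le_iff hα (firstGE β i) _).1 le_rfl hlt
      omega
    simp [DP.polyX, h, h']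

lemma dxMap_dx {n m : ℕ} {α : Fin (m + 1) → Fin (n + 1)} (hα : Monotone α) (i : ℕ) :
    dxMap α (dx n i) = dx m (firstGE α i) := by
  rw [dxMap, Fintype.linearCombination_apply]
  by_cases h : ∃ k : Fin n, (k : ℕ) + 1 = i
  · obtain ⟨k, rfl⟩ := h
    rw [Finset.sum_eq_single k]
    · simp [dx]
    · intro k' _ hk'
      have : (k' : ℕ) ≠ k := fun h => hk' (Fin.ext h)
      simp [dx, this]
    · simp
  · rw [Finset.sum_eq_zero]
    · funext k
      have : ¬ (k : ℕ) + 1 = firstGE α i := by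
        intro hk
        have hk2 := k.2
        rcases Nat.eq_zero_or_pos i with rfl | hi
        · have : firstGE α 0 ≤ 0 := (firstGE_le_iff hα 0 0).2 fun _ => Nat.zero_le _
          omega
        · have hlt : firstGE α i < m + 1 := by omega
          have h1 := (firstGE_le_iff hα i _).1 le_rfl hlt
          have h2 := (α ⟨firstGE α i, hlt⟩).2
          exact h ⟨⟨i - 1, by omega⟩, by simp; omega⟩
      simp [dx, this]
    · intro k _
      have : ¬ (k : ℕ) + 1 = i := fun hk => h ⟨k, hk⟩
      simp [dx, this]

lemma dx_succ (n : ℕ) (k : Fin n) : dx n ((k : ℕ) + 1) = Pi.single k 1 := by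
  funext k'
  simp [dx, Pi.single_apply, Fin.ext_iff]

lemma dxMap_id (n : ℕ) : dxMap (id : Fin (n + 1) → Fin (n + 1)) = LinearMap.id := by
  refine LinearMap.pi_ext' fun k => LinearMap.ext_ring ?_
  change dxMap id (Pi.single k 1) = Pi.single k 1
  rw [← dx_succ, dxMap_dx monotone_id]
  congr 1
  simpa using firstGE_id (n := n) k.succ

lemma dxMap_comp {n m l : ℕ} {α : Fin (l + 1) → Fin (m + 1)} {β : Fin (m + 1) → Fin (n + 1)}
    (hα : Monotone α) (hβ : Monotone β) : dxMap (β ∘ α) = (dxMap α).comp (dxMap β) := by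
  refine LinearMap.pi_ext' fun k => LinearMap.ext_ring ?_
  change dxMap (β ∘ α) (Pi.single k 1) = dxMap α (dxMap β (Pi.single k 1))
  rw [← dx_succ, dxMap_dx hβ, dxMap_dx hα, dxMap_dx (hβ.comp hα), firstGE_comp hα hβ]

lemma pullback_id (n : ℕ) : pullback (id : Fin (n + 1) → Fin (n + 1)) = AlgHom.id ℤ _ := by
  refine Algebra.TensorProduct.ext' fun f w => ?_
  simp [pullback, pullbackFun_id, dxMap_id]

lemma pullback_comp {n m l : ℕ} {α : Fin (l + 1) → Fin (m + 1)} {β : Fin (m + 1) → Fin (n + 1)}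
    (hα : Monotone α) (hβ : Monotone β) :
    pullback (β ∘ α) = (pullback α).comp (pullback β) := by
  refine Algebra.TensorProduct.ext' fun f w => ?_
  simp [pullback, pullbackFun_comp hα hβ, dxMap_comp hα hβ, ← ExteriorAlgebra.map_comp_map]

/-- The simplicial set `[n] ↦ Forms n`. A differential form on a simplicial set `X` is a
simplicial map `X ⟶ deRham`. -/
noncomputable def deRham : SSet.{u} where
  obj n := ULift.{u} (Forms n.unop.len)
  map f := ↾fun w => ⟨pullback f.unop.toOrderHom w.down⟩
  map_id n := by
    ext w
    exact DFunLike.congr_fun (pullback_id n.unop.len) w.down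
  map_comp f g := by
    ext w
    exact DFunLike.congr_fun
      (pullback_comp g.unop.toOrderHom.monotone f.unop.toOrderHom.monotone) w.down

/-- The form `ω` on `X` is homogeneous of degree `k`. -/
def IsHomogeneous {X : SSet.{u}} (ω : X ⟶ deRham.{u}) (k : ℕ) : Prop :=
  ∀ (n : ℕ) (x : X.obj (.op (SimplexCategory.mk n))), (ω.app _ x).down ∈ Forms.degreePart n k

/-- The wedge product `η₁ ∧ ⋯ ∧ η_r`, in this order, of differential forms on `Y`. -/
noncomputable def wedge {Y : SSet.{u}} {r : ℕ} (η : Fin r → (Y ⟶ deRham.{u})) :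
    Y ⟶ deRham.{u} where
  app n := ↾fun y => ⟨(List.ofFn fun i => ((η i).app n y).down).prod⟩
  naturality n m f := by
    ext y
    have h : (List.ofFn fun i => ((η i).app m (Y.map f y)).down).prod =
        pullback f.unop.toOrderHom (List.ofFn fun i => ((η i).app n y).down).prod := by
      rw [map_list_prod, List.map_ofFn]
      exact congrArg (fun g => (List.ofFn g).prod)
        (funext fun i => congrArg ULift.down (NatTrans.naturality_apply (η i) f y))
    exact congrArg ULift.up h

/-! ### Fiberwise integration along `X × Δ[r] ⟶ X` -/

/-- The maximal chains `Γ : [n + r] ↪ [n] × [r]`. -/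
abbrev MaxChain (n r : ℕ) : Type := Fin (n + r + 1) ↪o Fin (n + 1) × Fin (r + 1)

namespace MaxChain

variable {n r : ℕ} (Γ : MaxChain n r)

/-- The first component `[n + r] ⟶ [n]`. -/
def base : SimplexCategory.mk (n + r) ⟶ SimplexCategory.mk n :=
  SimplexCategory.Hom.mk ⟨fun j => (Γ j).1, fun _ _ h => (Γ.monotone h).1⟩

/-- The second component `[n + r] ⟶ [r]`. -/
def fiber : SimplexCategory.mk (n + r) ⟶ SimplexCategory.mk r :=
  SimplexCategory.Hom.mk ⟨fun j => (Γ j).2, fun _ _ h => (Γ.monotone h).2⟩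

/-- The base directions: `i ↦ min {j | (Γ j).1 = i}`. -/
noncomputable def baseDir (i : Fin (n + 1)) : Fin (n + r + 1) := sInf {j | (Γ j).1 = i}

/-- The fiber directions: `i ↦ min {j | (Γ j).2 ≥ i}`, used for `0 ≤ i ≤ r`. -/
noncomputable def fiberDir (i : ℕ) : Fin (n + r + 1) := sInf {j | i ≤ ((Γ j).2 : ℕ)}

/-- The index of the variable which is the upper limit of the integral in the `i`-th fiber
direction: the last index before the block of consecutive fiber directions containing it. -/
noncomputable def upper (i : ℕ) : ℕ :=
  (Γ.fiberDir (sInf {j : ℕ | 1 ≤ j ∧ (Γ.fiberDir j : ℕ) + i = (Γ.fiberDir i : ℕ) + j}) : ℕ) - 1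

/-- The iterated integral of a function in the first `k` fiber directions, the first one being
integrated first; the `i`-th one runs from `x_{fiberDir i + 1}` to `x_{upper i}`. -/
noncomputable def integrateFun : ℕ → (DP (n + r) →+ DP (n + r))
  | 0 => AddMonoidHom.id _
  | k + 1 => (DP.integral (Γ.fiberDir (k + 1)) ((Γ.fiberDir (k + 1) : ℕ) + 1)
      (Γ.upper (k + 1))).comp (integrateFun k)

/-- Extraction of the coefficient of `dx_{fiberDir 1} ∧ ⋯ ∧ dx_{fiberDir k}`, written on the left:
contraction with the dual of `dx_{fiberDir 1}`, then of `dx_{fiberDir 2}`, and so on. -/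
noncomputable def contract : ℕ →
    (ExteriorAlgebra ℤ (Fin (n + r) → ℤ) →ₗ[ℤ] ExteriorAlgebra ℤ (Fin (n + r) → ℤ))
  | 0 => LinearMap.id
  | k + 1 => (CliffordAlgebra.contractLeft (dxDual (n + r) (Γ.fiberDir (k + 1)))).comp (contract k)

/-- The integral of a form on `Δ[n + r]` over the fibers of `Γ.base`: it sends
`(f dx_{fiberDir 1} ∧ ⋯ ∧ dx_{fiberDir r}) ∧ η`, where `η` is a wedge product of base differentials
`dx_{baseDir i}`, to `baseDir^* (∫ ⋯ ∫ f) ∧ baseDir^* η`, and it kills the forms `f η'` where `η'`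
is a wedge product of coordinate differentials which misses a fiber direction. -/
noncomputable def integrate (w : Forms (n + r)) : Forms n :=
  pullback Γ.baseDir (TensorProduct.map (Γ.integrateFun r).toIntLinearMap (Γ.contract r) w)

end MaxChain

open Simplicial

/-- The sum over all maximal chains `Γ : [m + r] ↪ [m] × [r]` of the fiber integrals of `Γ^* ω`,
for a form `ω` on `Δ[m] × Δ[r]` given as an `m`-simplex of the function complex
`deRham ^ Δ[r]`. -/
noncomputable def chainSum (r : ℕ) {m : ℕ} (z : ((ihom Δ[r]).obj deRham.{u}) _⦋m⦌) : Forms m :=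
  ∑ Γ : MaxChain m r, Γ.integrate
    (((ihom.ev Δ[r]).app deRham.{u}).app _
      (SSet.stdSimplex.objEquiv.symm Γ.fiber, ((ihom Δ[r]).obj deRham.{u}).map Γ.base.op z)).down

/-- The fiberwise integration of a form on `Δ[n] × Δ[r]` along the projection to `Δ[n]`, the form
being given as an `n`-simplex `z` of `deRham ^ Δ[r]`: one writes `z` as the degeneracy `σ^* z'` of a
nondegenerate simplex `z'` (Eilenberg-Zilber) and takes `σ^*` of the sum over the maximal chains
for `z'`. -/
noncomputable def prismIntegral (r : ℕ) {n : ℕ} (z : ((ihom Δ[r]).obj deRham.{u}) _⦋n⦌) :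
    Forms n :=
  let h := SSet.exists_nonDegenerate _ z
  pullback h.choose_spec.choose.toOrderHom
    (chainSum r h.choose_spec.choose_spec.choose_spec.choose.1)

/-- The fiberwise integration of a form `Φ` on `X × Δ[r]` along the projection to `X`, as a function
on the simplices of `X`. -/
noncomputable def fiberIntegral {X : SSet.{u}} {r : ℕ} (Φ : Δ[r] ⊗ X ⟶ deRham.{u}) (n : ℕ)
    (x : X _⦋n⦌) : Forms n :=
  prismIntegral r ((MonoidalClosed.curry Φ).app _ x)

/-! ### Iterated integrals -/

/-- The path simplicial set `X ^ Δ[1]`. -/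
noncomputable abbrev PathSpace (X : SSet.{u}) : SSet.{u} := (ihom Δ[1]).obj X

/-- The `i`-th component `[r] ⟶ [1]` (with `i = 0, …, r - 1`) of the map `[r] ⟶ [1]^r`,
`j ↦ (1, …, 1, 0, …, 0)` with `j` ones. -/
def stepMap {r : ℕ} (i : Fin r) : ⦋r⦌ ⟶ ⦋1⦌ :=
  SimplexCategory.Hom.mk ⟨fun j => if (i : ℕ) < (j : ℕ) then 1 else 0, fun a b h => by
    have h' : (a : ℕ) ≤ b := h
    dsimp only
    split_ifs
    · exact le_rfl
    · omega
    · exact Fin.zero_le _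
    · exact le_rfl⟩

/-- The `i`-th component `Δ[r] × X ^ Δ[1] ⟶ X` of the evaluation map to `X^r`. -/
noncomputable def evalAt (X : SSet.{u}) {r : ℕ} (i : Fin r) : Δ[r] ⊗ PathSpace X ⟶ X :=
  (SSet.stdSimplex.map (stepMap i) ▷ PathSpace X) ≫ (ihom.ev Δ[1]).app X

/-- The form `ω₁ × ⋯ × ω_r` on `Δ[r] × X ^ Δ[1]`, the wedge product in this order of the pullbacks
of the `ω_i` along `evalAt X i`. -/
noncomputable def crossForm {X : SSet.{u}} {r : ℕ} (ω : Fin r → (X ⟶ deRham.{u})) :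
    Δ[r] ⊗ PathSpace X ⟶ deRham.{u} :=
  wedge fun i => evalAt X i ≫ ω i

/-- The iterated integral `∫ ω₁ ⋯ ω_r`, a form on `X ^ Δ[1]`, as a function on its simplices. The
sum and the wedge product of such functions are the pointwise ones. -/
noncomputable def iteratedIntegral {X : SSet.{u}} {r : ℕ} (ω : Fin r → (X ⟶ deRham.{u})) :
    ∀ n : ℕ, (PathSpace X) _⦋n⦌ → Forms n :=
  fiberIntegral (crossForm ω)

/-! ### Shuffles and signs -/

open Classical in
/-- The `(p, q)`-shuffles: in the word `σ(1), …, σ(p + q)` the letters `1, …, p` occur in increasing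
order, and so do the letters `p + 1, …, p + q`. -/
noncomputable def shuffles (p q : ℕ) : Finset (Equiv.Perm (Fin (p + q))) :=
  {σ | StrictMono (fun i : Fin p => σ.symm (Fin.castAdd q i)) ∧
    StrictMono (fun j : Fin q => σ.symm (Fin.natAdd p j))}

/-- The Koszul sign `ε(σ; d₁, …, d_r)`: in a graded commutative algebra, homogeneous elements `aᵢ`
of degrees `dᵢ` satisfy `a₁ ⋯ a_r = ε a_{σ(1)} ⋯ a_{σ(r)}`. -/
def koszulSign {r : ℕ} (σ : Equiv.Perm (Fin r)) (d : Fin r → ℤ) : ℤˣ :=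
  ∏ i : Fin r, ∏ j : Fin r,
    if i < j ∧ σ j < σ i then (d (σ i) * d (σ j)).negOnePow else 1

/-- The sign `(-1)^{∑ᵢ (r - i) dᵢ}`, the sum being over `i = 1, …, r`. -/
def normSign {r : ℕ} (d : Fin r → ℤ) : ℤˣ :=
  (∑ i : Fin r, ((r : ℤ) - 1 - (i : ℕ)) * d i).negOnePow

end SimplicialIteratedIntegral

/-! Divided power polynomials embed into rational polynomials (`DP.toPoly`), so identities between
coefficients may be checked over ℚ. Read `ϑ = x₀ ≥ x₁ ≥ ⋯ ≥ xₙ ≥ x_{n+1} = 0` as a subdivision of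
the interval from `0` to `ϑ`. A maximal chain in `[n] × [1]` makes its fiber step in one column `κ`,
and its simplex is the part of the prism where the fiber coordinate `t` lies between `x_{κ+1}` and
`x_κ`. Thus a function on the prism is a piecewise polynomial in `t`. A maximal chain in `[n] × [r]`
amounts to a weakly increasing sequence of columns (`MaxChain.col_injective`, `MaxChain.col_ofCol`),
and its simplex is the part of `ϑ ≥ t₁ ≥ ⋯ ≥ t_r ≥ 0` where each `t_i` lies in the interval of its
column. So the sum over all chains is the iterated integral of piecewise polynomials `g₁(t₁) ⋯
g_r(t_r)` over `ϑ ≥ t₁ ≥ ⋯ ≥ t_r ≥ 0`; `MaxChain.integrateQ_partial` matches the limits of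
integration.

The operator sending `f` to the integral of `f` from `t` to `ϑ` is a Rota–Baxter operator, by
integration by parts (`upperInt_mul_upperInt`), and for every Rota–Baxter operator the product of
two iterated applications is the sum over the shuffles (`wordInt_mul_wordInt`). This is the theorem
for coefficients (`MaxChain.monoInt_mul_monoInt`).

For the differentials, write a form on a simplex of the prism as `a + dt ∧ b` with `a`, `b` from the
base. Contracting a product of factors `a_i + dt_i ∧ b_i` with `dt₁`, …, `dt_r` in turn leaves `b₁ ⋯
b_r`; the `j`-th contraction passes `b₁, …, b_{j-1}`, of degrees `d_i = |ω_i| - 1`, which gives the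
sign `s(d₁, …, d_r)` (`MaxChain.contract_prod`). The `b_i` commute up to sign, and reordering them
gives the Koszul sign (`prod_ofFn_eq_koszulSign_smul`). Each of the three integrals contributes its
own `s`.

Two reductions remain. The fiberwise integral is defined through a nondegenerate simplex, but the
sum over chains commutes with degeneracies (`chainSum_map`), so it may be taken at the given simplex
(`prismIntegral_eq_chainSum`). An iterated integral then depends only on the restrictions of the
forms to the simplices of the prism (`iteratedIntegral_eq_crossInt`), and it does so
multiadditively; hence pure tensors supported on one simplex each suffice (`eq_of_eq_on_closure`).
-/

namespace SimplicialIteratedIntegral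

/-! ### A Rota–Baxter operator on piecewise polynomials -/

section RotaBaxter

open Polynomial

variable {A : Type*} [CommRing A] [Algebra ℚ A]

/-- The antiderivative without constant term of a polynomial over a `ℚ`-algebra. -/
noncomputable def antideriv : A[X] →ₗ[A] A[X] :=
  Polynomial.lsum fun k => algebraMap ℚ A ((k + 1 : ℚ)⁻¹) • Polynomial.monomial (k + 1)

lemma antideriv_monomial (k : ℕ) (a : A) :
    antideriv (monomial k a) = monomial (k + 1) (algebraMap ℚ A ((k + 1 : ℚ)⁻¹) * a) := by
  rw [antideriv, Polynomial.lsum_apply, Polynomial.sum_monomial_index]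
  · rw [LinearMap.smul_apply, Polynomial.smul_monomial, smul_eq_mul]
  · exact map_zero _

lemma derivative_antideriv (f : A[X]) : derivative (antideriv f) = f := by
  induction f using Polynomial.induction_on' with
  | add p q hp hq => simp [hp, hq]
  | monomial k a =>
    rw [antideriv_monomial, derivative_monomial]
    congr 1
    have h : (algebraMap ℚ A ((k + 1 : ℚ)⁻¹)) * ((k + 1 : ℕ) : A) = 1 := by
      rw [← map_natCast (algebraMap ℚ A), ← map_mul, Nat.cast_succ,
        inv_mul_cancel₀ (by positivity), map_one]
    linear_combination a * h

/-- The piecewise polynomial `t ↦ ∫_t^{y₀} f`, where the `κ`-th piece of a piecewise polynomial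
lives on the interval from `y_{κ+1}` to `y_κ`. -/
noncomputable def upperInt (y : ℕ → A) : (ℕ → A[X]) →ₗ[A] (ℕ → A[X]) where
  toFun f κ := C ((antideriv (f κ)).eval (y κ)) - antideriv (f κ) +
    ∑ l ∈ Finset.range κ, C ((antideriv (f l)).eval (y l) - (antideriv (f l)).eval (y (l + 1)))
  map_add' f g := by
    funext κ
    simp only [Pi.add_apply, map_add, eval_add, map_sub, Finset.sum_sub_distrib,
      Finset.sum_add_distrib]
    ring
  map_smul' a f := by
    funext κ
    simp only [Pi.smul_apply, map_smul, eval_smul, smul_eq_mul, ← mul_sub, map_mul,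
      ← Finset.mul_sum, RingHom.id_apply]
    simp only [smul_eq_C_mul]
    ring

variable (y : ℕ → A) (f g : ℕ → A[X])

lemma upperInt_apply (κ : ℕ) : upperInt y f κ =
    C ((antideriv (f κ)).eval (y κ)) - antideriv (f κ) +
      ∑ l ∈ Finset.range κ,
        C ((antideriv (f l)).eval (y l) - (antideriv (f l)).eval (y (l + 1))) := rfl

lemma derivative_upperInt (κ : ℕ) : derivative (upperInt y f κ) = -f κ := by
  simp [upperInt_apply, derivative_antideriv]

lemma upperInt_continuous (κ : ℕ) :
    (upperInt y f κ).eval (y (κ + 1)) = (upperInt y f (κ + 1)).eval (y (κ + 1)) := by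
  rw [upperInt_apply, upperInt_apply, Finset.sum_range_succ]
  simp only [eval_add, eval_sub, eval_C]
  ring

lemma upperInt_zero : (upperInt y f 0).eval (y 0) = 0 := by
  simp [upperInt_apply]

/-- The derivative determines each piece up to a constant, and continuity at the break points forces
the constants one after another, starting from `y 0`. A vanishing derivative means a constant
because a domain over ℚ has characteristic zero. -/
lemma piecewise_ext [IsDomain A] {f g : ℕ → A[X]}
    (hd : ∀ κ, derivative (f κ) = derivative (g κ))
    (hf : ∀ κ, (f κ).eval (y (κ + 1)) = (f (κ + 1)).eval (y (κ + 1)))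
    (hg : ∀ κ, (g κ).eval (y (κ + 1)) = (g (κ + 1)).eval (y (κ + 1)))
    (h0 : (f 0).eval (y 0) = (g 0).eval (y 0)) : f = g := by
  have : CharZero A := algebraRat.charZero A
  have key : ∀ κ, (f κ).eval (y κ) = (g κ).eval (y κ) → f κ = g κ := by
    intro κ h
    have h1 : derivative (f κ - g κ) = 0 := by rw [derivative_sub, hd, sub_self]
    have h2 := eq_C_of_derivative_eq_zero h1
    have h3 : (f κ - g κ).eval (y κ) = 0 := by rw [eval_sub, h, sub_self]
    rw [h2, eval_C] at h3
    rw [h3, C_0] at h2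
    exact sub_eq_zero.1 h2
  funext κ
  induction κ with
  | zero => exact key 0 h0
  | succ κ ih => exact key _ (by rw [← hf, ← hg, ih])

/-- Integration by parts: with `J = upperInt y`, both sides are continuous, vanish at `y 0` and have
derivative `-(f * J g + J f * g)`. -/
lemma upperInt_mul_upperInt [IsDomain A] :
    upperInt y f * upperInt y g =
      upperInt y (upperInt y f * g) + upperInt y (f * upperInt y g) := by
  refine piecewise_ext y (fun κ => ?_) (fun κ => ?_) (fun κ => ?_) ?_
  · simp only [Pi.mul_apply, Pi.add_apply, derivative_mul, derivative_add, derivative_upperInt]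
    ring
  · simp only [Pi.mul_apply, eval_mul, upperInt_continuous]
  · simp only [Pi.add_apply, eval_add, upperInt_continuous]
  · simp [upperInt_zero]

/-- The pullback of piecewise polynomials along a map of index sets and a change of coefficients. -/
noncomputable def piecePull {A' : Type*} [CommRing A'] [Algebra ℚ A'] (φ : A →ₐ[ℚ] A')
    (s : ℕ → ℕ) (f : ℕ → A[X]) : ℕ → A'[X] :=
  fun κ => (f (s κ)).map (φ : A →+* A')

/-! ### Refinement of the subdivision and change of coefficients -/

section basechange

variable {A' : Type*} [CommRing A'] [Algebra ℚ A'] [IsDomain A'] {φ : A →ₐ[ℚ] A'} {y : ℕ → A}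
  {y' : ℕ → A'} {s : ℕ → ℕ}

/-- Where `s` repeats an index, the same polynomial stands on both sides of the new break point, so
continuity there is automatic; where `s` advances, the break points correspond. Then `piecewise_ext`
applies. -/
lemma upperInt_piecePull (h0 : s 0 = 0) (hy0 : y' 0 = φ (y 0))
    (hs : ∀ κ, s (κ + 1) = s κ ∨ (s (κ + 1) = s κ + 1 ∧ y' (κ + 1) = φ (y (s κ + 1))))
    (f : ℕ → A[X]) :
    upperInt y' (piecePull φ s f) = piecePull φ s (upperInt y f) := by
  refine piecewise_ext y' (fun κ => ?_) (fun κ => upperInt_continuous _ _ _) (fun κ => ?_) ?_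
  · rw [derivative_upperInt, piecePull, piecePull, derivative_map, derivative_upperInt,
      Polynomial.map_neg]
  · unfold piecePull
    rcases hs κ with h | ⟨h, h'⟩
    · rw [h]
    · rw [h, h']
      change Polynomial.eval ((φ : A →+* A') _) _ = Polynomial.eval ((φ : A →+* A') _) _
      rw [Polynomial.eval_map_apply, Polynomial.eval_map_apply, upperInt_continuous]
  · rw [upperInt_zero, piecePull, h0, hy0]
    change _ = Polynomial.eval ((φ : A →+* A') _) _
    rw [Polynomial.eval_map_apply, upperInt_zero, map_zero]

end basechange

/-! ### Iterated integrals of piecewise polynomials -/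

/-- The iterated integral `t ↦ ∫_{y₀ ≥ t₁ ≥ ⋯ ≥ t_r ≥ t} g₁(t₁) ⋯ g_r(t_r)` of piecewise
polynomials. -/
noncomputable def iterInt (y : ℕ → A) :
    (r : ℕ) → MultilinearMap A (fun _ : Fin r => ℕ → A[X]) (ℕ → A[X])
  | 0 => MultilinearMap.constOfIsEmpty A _ 1
  | r + 1 => MultilinearMap.uncurryRight
      (((LinearMap.mul A (ℕ → A[X])).compr₂ (upperInt y)).compMultilinearMap (iterInt y r))

lemma iterInt_zero (g : Fin 0 → ℕ → A[X]) : iterInt y 0 g = 1 := rfl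

lemma iterInt_succ (r : ℕ) (g : Fin (r + 1) → ℕ → A[X]) :
    iterInt y (r + 1) g =
      upperInt y (iterInt y r (fun i => g i.castSucc) * g (Fin.last r)) := rfl

lemma iterInt_piecePull {A' : Type*} [CommRing A'] [Algebra ℚ A'] [IsDomain A'] {φ : A →ₐ[ℚ] A'}
    {y : ℕ → A} {y' : ℕ → A'} {s : ℕ → ℕ} (h0 : s 0 = 0) (hy0 : y' 0 = φ (y 0))
    (hs : ∀ κ, s (κ + 1) = s κ ∨ (s (κ + 1) = s κ + 1 ∧ y' (κ + 1) = φ (y (s κ + 1))))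
    (r : ℕ) (g : Fin r → ℕ → A[X]) :
    iterInt y' r (fun i => piecePull φ s (g i)) = piecePull φ s (iterInt y r g) := by
  induction r with
  | zero =>
    funext κ
    simp [iterInt_zero, piecePull]
  | succ r ih =>
    rw [iterInt_succ, iterInt_succ, ih, ← upperInt_piecePull h0 hy0 hs]
    congr 1
    funext κ
    simp [piecePull]

/-- Piece `κ` of an integral starting at `y 0` only sees integrands on the pieces of index at most
`κ`, so the supports have to be met in increasing order and before `κ` is passed. -/
lemma iterInt_single_eq_zero (r : ℕ) (k : Fin r → ℕ) (g : Fin r → A[X]) (κ : ℕ)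
    (h : ¬ (Monotone k ∧ ∀ i, k i ≤ κ)) :
    iterInt y r (fun i => Pi.single (k i) (g i)) κ = 0 := by
  induction r generalizing κ with
  | zero => exact absurd ⟨fun i => i.elim0, fun i => i.elim0⟩ h
  | succ r ih =>
    rw [iterInt_succ]
    have hz : ∀ l ≤ κ, (iterInt y r (fun i => Pi.single (k i.castSucc) (g i.castSucc)) *
        Pi.single (k (Fin.last r)) (g (Fin.last r)) : ℕ → A[X]) l = 0 := by
      intro l hl
      rw [Pi.mul_apply]
      by_cases hk : l = k (Fin.last r)
      · rw [ih (fun i => k i.castSucc), zero_mul]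
        rintro ⟨hm, hle⟩
        refine h ⟨fun i j hij => ?_, fun i => ?_⟩
        · induction j using Fin.lastCases with
          | last =>
            induction i using Fin.lastCases with
            | last => exact le_rfl
            | cast i => exact (hle i).trans hk.le
          | cast j =>
            induction i using Fin.lastCases with
            | last => exact absurd (lt_of_lt_of_le (Fin.castSucc_lt_last j) hij) (lt_irrefl _)
            | cast i => exact hm (Fin.castSucc_le_castSucc_iff.1 hij)
        · induction i using Fin.lastCases with
          | last => omega
          | cast i => exact (hle i).trans hl
      · rw [Pi.single_eq_of_ne hk, mul_zero]
    rw [upperInt_apply, hz κ le_rfl, Finset.sum_eq_zero]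
    · simp
    · intro l hl
      rw [hz l (Finset.mem_range.1 hl).le]
      simp

lemma upperInt_single_self (κ : ℕ) (p : A[X]) :
    upperInt y (Pi.single κ p) κ = C ((antideriv p).eval (y κ)) - antideriv p := by
  rw [upperInt_apply, Pi.single_eq_same, Finset.sum_eq_zero, add_zero]
  intro l hl
  rw [Pi.single_eq_of_ne (Finset.mem_range.1 hl).ne]
  simp

/-- Beyond the interval that carries the integrand nothing more is added, and the integral keeps its
value at the lower end of that interval. -/
lemma upperInt_single_of_lt {κ l : ℕ} (h : κ < l) (p : A[X]) :
    upperInt y (Pi.single κ p) l = C ((upperInt y (Pi.single κ p) κ).eval (y (κ + 1))) := by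
  rw [upperInt_single_self, upperInt_apply, Pi.single_eq_of_ne h.ne',
    Finset.sum_eq_single κ]
  · simp
  · intro j _ hj
    rw [Pi.single_eq_of_ne hj]
    simp
  · intro hκ
    exact absurd (Finset.mem_range.2 h) hκ

lemma mul_single {R : Type*} [CommRing R] (f : ℕ → R[X]) (κ : ℕ) (p : R[X]) :
    f * Pi.single κ p = Pi.single κ (f κ * p) := by
  funext l
  by_cases h : l = κ
  · subst h; simp
  · simp [Pi.single_eq_of_ne h]

end RotaBaxter

/-! ### Shuffles of words -/

section Words

variable {α : Type*}

/-- The list of all shuffles of two words. -/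
def wordShuffles : List α → List α → List (List α)
  | [], v => [v]
  | a :: u, [] => [a :: u]
  | a :: u, b :: v =>
    (wordShuffles u (b :: v)).map (a :: ·) ++ (wordShuffles (a :: u) v).map (b :: ·)
  termination_by u v => u.length + v.length

lemma wordShuffles_nil_left (v : List α) : wordShuffles [] v = [v] := by
  rw [wordShuffles]

lemma wordShuffles_nil_right (u : List α) : wordShuffles u [] = [u] := by
  cases u <;> rw [wordShuffles]

lemma wordShuffles_cons_cons (a b : α) (u v : List α) : wordShuffles (a :: u) (b :: v) =
    (wordShuffles u (b :: v)).map (a :: ·) ++ (wordShuffles (a :: u) v).map (b :: ·) := by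
  rw [wordShuffles]

/-- The iterated application of an operator `J` along a word. -/
def wordInt {P : Type*} [CommRing P] (J : P →+ P) : List P → P
  | [] => 1
  | a :: l => J (wordInt J l * a)

/-- The head of a word belongs to the outermost application of `J`. The Rota–Baxter identity splits
the product according to which of the two heads is outermost, and this is the recursion of
`wordShuffles`. -/
lemma wordInt_mul_wordInt {P : Type*} [CommRing P] (J : P →+ P)
    (hJ : ∀ f g, J f * J g = J (J f * g) + J (f * J g)) (g : α → P) (u v : List α) :
    wordInt J (u.map g) * wordInt J (v.map g) =
      ((wordShuffles u v).map fun l => wordInt J (l.map g)).sum := by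
  induction u generalizing v with
  | nil => simp [wordShuffles_nil_left, wordInt]
  | cons a u ihu =>
    induction v with
    | nil => simp [wordShuffles_nil_right, wordInt]
    | cons b v ihv =>
      have hsum : ∀ (c : α) (L : List (List α)),
          ((L.map (c :: ·)).map fun l => wordInt J (l.map g)).sum =
            J ((L.map fun l => wordInt J (l.map g)).sum * g c) := by
        intro c L
        induction L with
        | nil => simp
        | cons l L ih =>
          simp only [List.map_cons, List.sum_cons, ih, add_mul, map_add]
          simp [wordInt]
      rw [wordShuffles_cons_cons, List.map_append, List.sum_append, hsum, hsum, ← ihu, ← ihv]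
      simp only [List.map_cons, wordInt]
      rw [hJ, add_comm]
      congr 2 <;> ring

/-- As the letters are distinct, the head of `l` tells from which word it was taken, so the
recursion can be run backwards. This turns the recursive list into an order condition comparable
with `shuffles`. -/
lemma mem_wordShuffles [DecidableEq α] {u v l : List α} (h : (u ++ v).Nodup) :
    l ∈ wordShuffles u v ↔ l.Perm (u ++ v) ∧ u.Sublist l ∧ v.Sublist l := by
  induction l generalizing u v with
  | nil =>
    cases u with
    | nil => cases v <;> simp [wordShuffles_nil_left]
    | cons a u =>
      cases v with
      | nil => simp [wordShuffles_nil_right]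
      | cons b v => simp [wordShuffles_cons_cons]
  | cons c l ih =>
    cases u with
    | nil =>
      rw [wordShuffles_nil_left, List.mem_singleton]
      constructor
      · rintro rfl; simp
      · rintro ⟨h1, -, h3⟩
        exact (h3.eq_of_length (by simpa using h1.length_eq.symm)).symm
    | cons a u =>
      cases v with
      | nil =>
        rw [wordShuffles_nil_right, List.mem_singleton]
        constructor
        · intro h; simp [h]
        · rintro ⟨h1, h2, -⟩
          exact (h2.eq_of_length (by simpa using h1.length_eq.symm)).symm
      | cons b v =>
        have hab : a ≠ b := by
          rintro rfl
          simp at h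
        have ih1 := ih (u := u) (v := b :: v) (by simpa using (List.nodup_cons.1 h).2)
        have hperm : ((a :: u) ++ (b :: v)).Perm (b :: ((a :: u) ++ v)) := List.perm_middle
        have ih2 := ih (u := a :: u) (v := v) (List.nodup_cons.1 (hperm.nodup_iff.1 h)).2
        rw [wordShuffles_cons_cons, List.mem_append, List.mem_map, List.mem_map]
        constructor
        · rintro (⟨l', hl', heq⟩ | ⟨l', hl', heq⟩)
          · obtain ⟨rfl, rfl⟩ := List.cons.inj heq
            obtain ⟨h1, h2, h3⟩ := ih1.1 hl'
            exact ⟨h1.cons _, h2.cons_cons _, h3.cons _⟩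
          · obtain ⟨rfl, rfl⟩ := List.cons.inj heq
            obtain ⟨h1, h2, h3⟩ := ih2.1 hl'
            exact ⟨(h1.cons _).trans hperm.symm, h2.cons _, h3.cons_cons _⟩
        · rintro ⟨h1, h2, h3⟩
          have hnd : (c :: l).Nodup := h1.nodup_iff.2 h
          by_cases hca : c = a
          · subst hca
            refine Or.inl ⟨l, ih1.2 ⟨?_, ?_, ?_⟩, rfl⟩
            · exact List.Perm.cons_inv (a := c) (by simpa using h1)
            · exact List.cons_sublist_cons.1 h2
            · cases h3 with
              | cons _ h => exact h
              | cons_cons _ h => exact absurd rfl hab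
          · have h2' : (a :: u).Sublist l := by
              cases h2 with
              | cons _ h => exact h
              | cons_cons _ h => exact absurd rfl hca
            by_cases hcb : c = b
            · subst hcb
              refine Or.inr ⟨l, ih2.2 ⟨?_, h2', List.cons_sublist_cons.1 h3⟩, rfl⟩
              exact List.Perm.cons_inv (h1.trans hperm)
            -- A head different from `a` and `b` leaves both words as subwords of the tail, so the
            -- head would occur in the tail once more.
            · exfalso
              have h3' : (b :: v).Sublist l := by
                cases h3 with
                | cons _ h => exact h
                | cons_cons _ h => exact absurd rfl hcb
              have hc : c ∈ (a :: u) ++ (b :: v) := h1.subset (List.mem_cons_self ..)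
              refine (List.nodup_cons.1 hnd).1 ?_
              rcases List.mem_append.1 hc with hc | hc
              · exact h2'.subset hc
              · exact h3'.subset hc

lemma nodup_wordShuffles [DecidableEq α] {u v : List α} (h : (u ++ v).Nodup) :
    (wordShuffles u v).Nodup := by
  induction u generalizing v with
  | nil => simp [wordShuffles_nil_left]
  | cons a u ihu =>
    induction v with
    | nil => simp [wordShuffles_nil_right]
    | cons b v ihv =>
      have hab : a ≠ b := by
        rintro rfl
        simp at h
      have hperm : ((a :: u) ++ (b :: v)).Perm (b :: ((a :: u) ++ v)) := List.perm_middle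
      rw [wordShuffles_cons_cons, List.nodup_append]
      refine ⟨(ihu (List.nodup_cons.1 h).2).map fun _ _ h => (List.cons.inj h).2,
        (ihv (List.nodup_cons.1 (hperm.nodup_iff.1 h)).2).map fun _ _ h => (List.cons.inj h).2, ?_⟩
      intro x hx y hy hxy
      obtain ⟨x', -, rfl⟩ := List.mem_map.1 hx
      obtain ⟨y', -, rfl⟩ := List.mem_map.1 hy
      exact hab (List.cons.inj hxy).1

end Words

/-! ### Shuffle permutations and words -/

section Shuffle

variable {p q : ℕ}

lemma mem_shuffles {σ : Equiv.Perm (Fin (p + q))} : σ ∈ shuffles p q ↔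
    StrictMono (fun i : Fin p => σ.symm (Fin.castAdd q i)) ∧
      StrictMono (fun j : Fin q => σ.symm (Fin.natAdd p j)) := by
  simp [shuffles]

/-- The letter `e i` stands at position `σ.symm (e i)` of the word of `σ`, so being a subword means
that these positions increase. -/
lemma ofFn_sublist_ofFn_perm {r s : ℕ} (e : Fin s → Fin r) (σ : Equiv.Perm (Fin r)) :
    (List.ofFn e).Sublist (List.ofFn σ) ↔ StrictMono (fun i => σ.symm (e i)) := by
  rw [List.sublist_iff_exists_fin_orderEmbedding_get_eq]
  constructor
  · rintro ⟨f, hf⟩ i j hij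
    have h : ∀ i : Fin s, ((σ.symm (e i) : Fin r) : ℕ) =
        f (Fin.cast (List.length_ofFn).symm i) := by
      intro i
      have := hf (Fin.cast (List.length_ofFn).symm i)
      rw [List.get_ofFn, List.get_ofFn] at this
      have h2 : e i = σ (Fin.cast List.length_ofFn (f (Fin.cast (List.length_ofFn).symm i))) := by
        simpa using this
      rw [h2, Equiv.symm_apply_apply]
      rfl
    change ((σ.symm (e i) : Fin r) : ℕ) < ((σ.symm (e j) : Fin r) : ℕ)
    rw [h, h]
    exact f.strictMono hij
  · intro h
    refine ⟨OrderEmbedding.ofStrictMono (fun i => Fin.cast (List.length_ofFn).symm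
      (σ.symm (e (Fin.cast List.length_ofFn i)))) fun i j hij => h hij, fun i => ?_⟩
    rw [List.get_ofFn, List.get_ofFn]
    exact (σ.apply_symm_apply _).symm

lemma nodup_castAdd_append_natAdd (p q : ℕ) :
    (List.ofFn (Fin.castAdd q : Fin p → Fin (p + q)) ++
      List.ofFn (Fin.natAdd p : Fin q → Fin (p + q))).Nodup := by
  rw [List.nodup_append]
  refine ⟨List.nodup_ofFn.2 (Fin.castAdd_injective p q), List.nodup_ofFn.2 (Fin.natAdd_injective q p),
    ?_⟩
  intro a ha b hb hab
  obtain ⟨i, rfl⟩ := (List.mem_ofFn' _ _).1 ha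
  obtain ⟨j, rfl⟩ := (List.mem_ofFn' _ _).1 hb
  have := congrArg Fin.val hab
  simp at this
  omega

lemma castAdd_append_natAdd (p q : ℕ) :
    (List.ofFn (Fin.castAdd q : Fin p → Fin (p + q)) ++
      List.ofFn (Fin.natAdd p : Fin q → Fin (p + q))) = List.ofFn (id : Fin (p + q) → _) := by
  rw [← List.ofFn_fin_append]
  congr 1
  funext i
  induction i using Fin.addCases <;> simp

/-- A word that uses every letter once is a permutation, and `ofFn_sublist_ofFn_perm` translates the
order conditions. The reversals prepare for `iterInt_eq_wordInt`. -/
lemma wordShuffles_toFinset (p q : ℕ) :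
    (wordShuffles (List.ofFn (Fin.castAdd q : Fin p → Fin (p + q))).reverse
      (List.ofFn (Fin.natAdd p : Fin q → Fin (p + q))).reverse).toFinset =
    (shuffles p q).image fun σ : Equiv.Perm (Fin (p + q)) => (List.ofFn σ).reverse := by
  have hperm : ((List.ofFn (Fin.castAdd q : Fin p → Fin (p + q))).reverse ++
      (List.ofFn (Fin.natAdd p : Fin q → Fin (p + q))).reverse).Perm
        (List.ofFn (id : Fin (p + q) → _)) := by
    rw [← castAdd_append_natAdd]
    exact (List.reverse_perm _).append (List.reverse_perm _)
  have hnd := hperm.nodup_iff.2 (List.nodup_ofFn.2 Function.injective_id)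
  ext l
  rw [List.mem_toFinset, mem_wordShuffles hnd, Finset.mem_image]
  constructor
  · rintro ⟨h1, h2, h3⟩
    have h4 : l.reverse.Perm (List.ofFn (id : Fin (p + q) → _)) :=
      (List.reverse_perm _).trans (h1.trans hperm)
    have hlen : l.reverse.length = p + q := by simpa using h4.length_eq
    have hnd' : l.reverse.Nodup := h4.nodup_iff.2 (List.nodup_ofFn.2 Function.injective_id)
    have hinj : Function.Injective fun i : Fin (p + q) => l.reverse.get (Fin.cast hlen.symm i) :=
      (List.nodup_iff_injective_get.1 hnd').comp (Fin.cast_injective _)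
    let σ : Equiv.Perm (Fin (p + q)) :=
      Equiv.ofBijective _ (Finite.injective_iff_bijective.1 hinj)
    have hσ : List.ofFn σ = l.reverse := by
      refine List.ext_get (by simp [hlen]) fun i hi hi' => ?_
      rw [List.get_ofFn]
      rfl
    refine ⟨σ, mem_shuffles.2 ⟨?_, ?_⟩, by rw [hσ, List.reverse_reverse]⟩
    · rw [← ofFn_sublist_ofFn_perm, hσ]
      simpa using h2.reverse
    · rw [← ofFn_sublist_ofFn_perm, hσ]
      simpa using h3.reverse
  · rintro ⟨σ, hσ, rfl⟩
    obtain ⟨h2, h3⟩ := mem_shuffles.1 hσ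
    refine ⟨?_, ((ofFn_sublist_ofFn_perm _ σ).2 h2).reverse,
      ((ofFn_sublist_ofFn_perm _ σ).2 h3).reverse⟩
    refine (List.reverse_perm _).trans (List.Perm.trans ?_ hperm.symm)
    rw [List.perm_ext_iff_of_nodup (List.nodup_ofFn.2 σ.injective)
      (List.nodup_ofFn.2 Function.injective_id)]
    intro a
    rw [List.mem_ofFn', List.mem_ofFn']
    exact ⟨fun _ => ⟨a, rfl⟩, fun _ => σ.surjective a⟩

lemma wordInt_mul_wordInt_ofFn {P : Type*} [CommRing P] (J : P →+ P)
    (hJ : ∀ f g, J f * J g = J (J f * g) + J (f * J g)) (g : Fin (p + q) → P) :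
    wordInt J (List.ofFn fun i : Fin p => g (Fin.castAdd q i)).reverse *
        wordInt J (List.ofFn fun j : Fin q => g (Fin.natAdd p j)).reverse =
      ∑ σ ∈ shuffles p q, wordInt J (List.ofFn fun i => g (σ i)).reverse := by
  have hperm : ((List.ofFn (Fin.castAdd q : Fin p → Fin (p + q))).reverse ++
      (List.ofFn (Fin.natAdd p : Fin q → Fin (p + q))).reverse).Perm
        (List.ofFn (Fin.castAdd q : Fin p → Fin (p + q)) ++
      List.ofFn (Fin.natAdd p : Fin q → Fin (p + q))) :=
    (List.reverse_perm _).append (List.reverse_perm _)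
  have hnd := hperm.nodup_iff.2 (nodup_castAdd_append_natAdd p q)
  have h := wordInt_mul_wordInt J hJ g
    (List.ofFn (Fin.castAdd q : Fin p → Fin (p + q))).reverse
    (List.ofFn (Fin.natAdd p : Fin q → Fin (p + q))).reverse
  rw [List.map_reverse, List.map_reverse, List.map_ofFn, List.map_ofFn,
    ← List.sum_toFinset _ (nodup_wordShuffles hnd), wordShuffles_toFinset,
    Finset.sum_image] at h
  · refine h.trans (Finset.sum_congr rfl fun σ _ => ?_)
    rw [List.map_reverse, List.map_ofFn]
    rfl
  · intro σ _ τ _ hστ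
    exact Equiv.ext fun i => congrFun (List.ofFn_injective (List.reverse_injective hστ)) i

/-- In `iterInt` the last argument is integrated outermost, in `wordInt` the head; hence the
reversal. -/
lemma iterInt_eq_wordInt {A : Type*} [CommRing A] [Algebra ℚ A] (y : ℕ → A) (r : ℕ)
    (g : Fin r → ℕ → Polynomial A) :
    iterInt y r g = wordInt (upperInt y).toAddMonoidHom (List.ofFn g).reverse := by
  induction r with
  | zero => simp [iterInt_zero, wordInt]
  | succ r ih =>
    rw [iterInt_succ, ih, List.ofFn_succ', List.concat_eq_append, List.reverse_append]
    rfl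

lemma iterInt_mul_iterInt {A : Type*} [CommRing A] [Algebra ℚ A] [IsDomain A] (y : ℕ → A)
    (g : Fin (p + q) → ℕ → Polynomial A) :
    iterInt y p (fun i => g (Fin.castAdd q i)) * iterInt y q (fun j => g (Fin.natAdd p j)) =
      ∑ σ ∈ shuffles p q, iterInt y (p + q) (fun i => g (σ i)) := by
  simp only [iterInt_eq_wordInt]
  refine wordInt_mul_wordInt_ofFn (upperInt y).toAddMonoidHom (fun f g => ?_) g
  simp only [LinearMap.toAddMonoidHom_coe]
  exact upperInt_mul_upperInt y f g

end Shuffle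

/-! ### Koszul signs -/

section Koszul

variable {R : Type*} [Ring R]

/-- On its way to the front, `a p` passes exactly the factors `a j` with `j < p`. -/
lemma prod_ofFn_eq_mul_succAbove {r : ℕ} (d : Fin (r + 1) → ℤ) (a : Fin (r + 1) → R)
    (h : ∀ i j, a i * a j = (d i * d j).negOnePow • (a j * a i)) (p : Fin (r + 1)) :
    (List.ofFn a).prod = (∏ j, if j < p then (d p * d j).negOnePow else 1) •
      (a p * (List.ofFn fun i => a (p.succAbove i)).prod) := by
  induction r with
  | zero =>
    obtain rfl : p = 0 := Fin.ext (by omega)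
    simp
  | succ r ih =>
    induction p using Fin.cases with
    | zero => simp
    | succ p =>
      rw [List.ofFn_succ, List.prod_cons, ih (fun i => d i.succ) (fun i => a i.succ)
        (fun i j => h _ _) p,
        Fin.prod_univ_succ (fun j => if j < p.succ then (d p.succ * d j).negOnePow else 1),
        List.ofFn_succ (f := fun i => a (p.succ.succAbove i)), List.prod_cons, mul_smul_comm,
        ← mul_assoc, h 0 p.succ, smul_mul_assoc, smul_smul, mul_assoc, Fin.succ_succAbove_zero,
        if_pos (Fin.succ_pos p), mul_comm (d 0), mul_comm (∏ _, _)]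
      simp only [Fin.succ_lt_succ_iff, Fin.succ_succAbove_succ]

/-- Bring `a (σ 0)` to the front and use induction for the rest. The inversions of `σ` are those
involving position `0`, one for each `j < σ 0`, and those of the permutation `τ` induced on the
remaining letters. -/
lemma prod_ofFn_eq_koszulSign_smul {r : ℕ} (d : Fin r → ℤ) (a : Fin r → R)
    (h : ∀ i j, a i * a j = (d i * d j).negOnePow • (a j * a i)) (σ : Equiv.Perm (Fin r)) :
    (List.ofFn a).prod = koszulSign σ d • (List.ofFn fun i => a (σ i)).prod := by
  induction r with
  | zero => simp [koszulSign]
  | succ r ih =>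
    have hne : ∀ i : Fin r, σ i.succ ≠ σ 0 := fun i h =>
      Fin.succ_ne_zero i (σ.injective h)
    choose f hf using fun i => Fin.exists_succAbove_eq (hne i)
    have hinj : Function.Injective f := fun i j hij => by
      have := congrArg (σ 0).succAbove hij
      rw [hf, hf] at this
      exact Fin.succ_injective _ (σ.injective this)
    let τ : Equiv.Perm (Fin r) := Equiv.ofBijective f (Finite.injective_iff_bijective.1 hinj)
    have hτ : ∀ i, (σ 0).succAbove (τ i) = σ i.succ := hf
    have hsign : koszulSign σ d = (∏ j, if j < σ 0 then (d (σ 0) * d j).negOnePow else 1) *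
        koszulSign τ (fun i => d ((σ 0).succAbove i)) := by
      rw [koszulSign, Fin.prod_univ_succ, koszulSign]
      congr 1
      · rw [Fin.prod_univ_succAbove (fun j => if j < σ 0 then (d (σ 0) * d j).negOnePow else 1)
            (σ 0), if_neg (lt_irrefl _), one_mul, Fin.prod_univ_succ,
          if_neg (by simp), one_mul, ← Equiv.prod_comp τ (fun v => if (σ 0).succAbove v < σ 0 then
              (d (σ 0) * d ((σ 0).succAbove v)).negOnePow else 1)]
        refine Finset.prod_congr rfl fun j _ => ?_
        rw [hτ]
        simp
      · refine Finset.prod_congr rfl fun i _ => ?_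
        rw [Fin.prod_univ_succ, if_neg (by simp), one_mul]
        refine Finset.prod_congr rfl fun j _ => ?_
        simp only [Fin.succ_lt_succ_iff, ← hτ, Fin.succAbove_lt_succAbove_iff]
    rw [prod_ofFn_eq_mul_succAbove d a h (σ 0), ih (fun i => d ((σ 0).succAbove i))
      (fun i => a ((σ 0).succAbove i)) (fun i j => h _ _) τ, hsign, mul_smul_comm, smul_smul,
      List.ofFn_succ, List.prod_cons]
    simp only [hτ]

end Koszul

/-! ### Combinatorics of maximal chains -/

namespace MaxChain

variable {n r : ℕ} (Γ : MaxChain n r)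

/-- The coordinate sum is a strictly increasing map from `Fin (n + r + 1)` to itself, hence the
identity. So every step of a maximal chain raises exactly one coordinate, by one. -/
lemma fst_add_snd (j : Fin (n + r + 1)) : ((Γ j).1 : ℕ) + (Γ j).2 = j := by
  have hb : ∀ j, ((Γ j).1 : ℕ) + (Γ j).2 < n + r + 1 := fun j => by
    have := (Γ j).1.2
    have := (Γ j).2.2
    omega
  let s : Fin (n + r + 1) → Fin (n + r + 1) := fun j => ⟨(Γ j).1 + (Γ j).2, hb j⟩
  have hs : StrictMono s := by
    intro i j hij
    have h := Γ.strictMono hij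
    change ((Γ i).1 : ℕ) + (Γ i).2 < (Γ j).1 + (Γ j).2
    rcases Prod.lt_iff.1 h with ⟨h1, h2⟩ | ⟨h1, h2⟩
    · exact add_lt_add_of_lt_of_le h1 h2
    · exact add_lt_add_of_le_of_lt h1 h2
  have hid : s = id := by
    rw [← StrictMono.range_inj hs strictMono_id,
      (Finite.injective_iff_surjective.1 hs.injective).range_eq, Set.range_id]
  exact congrArg Fin.val (congrFun hid j)

lemma fst_mono {i j : Fin (n + r + 1)} (h : i ≤ j) : ((Γ i).1 : ℕ) ≤ (Γ j).1 := (Γ.monotone h).1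

lemma snd_mono {i j : Fin (n + r + 1)} (h : i ≤ j) : ((Γ i).2 : ℕ) ≤ (Γ j).2 := (Γ.monotone h).2

/-- The position at which the base coordinate reaches `j`. -/
noncomputable def bIdx (j : ℕ) : ℕ := firstGE Γ.base.toOrderHom j

/-- The position at which the fiber coordinate reaches `i`. -/
noncomputable def fIdx (i : ℕ) : ℕ := firstGE Γ.fiber.toOrderHom i

lemma bIdx_le_iff (l j : ℕ) :
    Γ.bIdx l ≤ j ↔ ∀ h : j < n + r + 1, l ≤ (Γ ⟨j, h⟩).1 :=
  firstGE_le_iff Γ.base.toOrderHom.monotone l j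

lemma fIdx_le_iff (i j : ℕ) :
    Γ.fIdx i ≤ j ↔ ∀ h : j < n + r + 1, i ≤ (Γ ⟨j, h⟩).2 :=
  firstGE_le_iff Γ.fiber.toOrderHom.monotone i j

lemma last_eq : ((Γ (Fin.last (n + r))).1 : ℕ) = n ∧ ((Γ (Fin.last (n + r))).2 : ℕ) = r := by
  have h := Γ.fst_add_snd (Fin.last (n + r))
  have h1 := (Γ (Fin.last (n + r))).1.2
  have h2 := (Γ (Fin.last (n + r))).2.2
  rw [Fin.val_last] at h
  omega

lemma bIdx_lt {l : ℕ} (hl : l ≤ n) : Γ.bIdx l < n + r + 1 :=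
  Nat.lt_succ_of_le ((Γ.bIdx_le_iff l (n + r)).2 fun _ => hl.trans Γ.last_eq.1.ge)

lemma fIdx_lt {i : ℕ} (hi : i ≤ r) : Γ.fIdx i < n + r + 1 :=
  Nat.lt_succ_of_le ((Γ.fIdx_le_iff i (n + r)).2 fun _ => hi.trans Γ.last_eq.2.ge)

lemma fst_bIdx {l : ℕ} (hl : l ≤ n) : ((Γ ⟨Γ.bIdx l, Γ.bIdx_lt hl⟩).1 : ℕ) = l := by
  have h1 := (Γ.bIdx_le_iff l _).1 le_rfl (Γ.bIdx_lt hl)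
  refine le_antisymm ?_ h1
  by_contra! h
  rcases Nat.eq_zero_or_pos (Γ.bIdx l) with h0 | h0
  · have := Γ.fst_add_snd ⟨Γ.bIdx l, Γ.bIdx_lt hl⟩
    simp only at this
    omega
  · have hlt : Γ.bIdx l - 1 < n + r + 1 := by have := Γ.bIdx_lt hl; omega
    have h2 : Γ.bIdx l ≤ Γ.bIdx l - 1 := by
      refine (Γ.bIdx_le_iff l _).2 fun _ => ?_
      have h3 := Γ.fst_add_snd ⟨Γ.bIdx l, Γ.bIdx_lt hl⟩
      have h4 := Γ.fst_add_snd ⟨Γ.bIdx l - 1, hlt⟩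
      have h5 := Γ.snd_mono (i := ⟨Γ.bIdx l - 1, hlt⟩) (j := ⟨Γ.bIdx l, Γ.bIdx_lt hl⟩)
        (Nat.sub_le _ _)
      simp only at h3 h4
      omega
    omega

lemma snd_fIdx {i : ℕ} (hi : i ≤ r) : ((Γ ⟨Γ.fIdx i, Γ.fIdx_lt hi⟩).2 : ℕ) = i := by
  have h1 := (Γ.fIdx_le_iff i _).1 le_rfl (Γ.fIdx_lt hi)
  refine le_antisymm ?_ h1
  by_contra! h
  rcases Nat.eq_zero_or_pos (Γ.fIdx i) with h0 | h0
  · have := Γ.fst_add_snd ⟨Γ.fIdx i, Γ.fIdx_lt hi⟩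
    simp only at this
    omega
  · have hlt : Γ.fIdx i - 1 < n + r + 1 := by have := Γ.fIdx_lt hi; omega
    have h2 : Γ.fIdx i ≤ Γ.fIdx i - 1 := by
      refine (Γ.fIdx_le_iff i _).2 fun _ => ?_
      have h3 := Γ.fst_add_snd ⟨Γ.fIdx i, Γ.fIdx_lt hi⟩
      have h4 := Γ.fst_add_snd ⟨Γ.fIdx i - 1, hlt⟩
      have h5 := Γ.fst_mono (i := ⟨Γ.fIdx i - 1, hlt⟩) (j := ⟨Γ.fIdx i, Γ.fIdx_lt hi⟩)
        (Nat.sub_le _ _)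
      simp only at h3 h4
      omega
    omega

lemma bIdx_mono : Monotone Γ.bIdx := fun _ _ h =>
  (Γ.bIdx_le_iff _ _).2 fun hj => h.trans ((Γ.bIdx_le_iff _ _).1 le_rfl hj)

lemma fIdx_mono : Monotone Γ.fIdx := fun _ _ h =>
  (Γ.fIdx_le_iff _ _).2 fun hj => h.trans ((Γ.fIdx_le_iff _ _).1 le_rfl hj)

lemma bIdx_zero : Γ.bIdx 0 = 0 := Nat.le_zero.1 ((Γ.bIdx_le_iff _ _).2 fun _ => Nat.zero_le _)

lemma bIdx_of_lt {l : ℕ} (hl : n < l) : Γ.bIdx l = n + r + 1 := by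
  refine le_antisymm ((Γ.bIdx_le_iff _ _).2 fun h => absurd h (lt_irrefl _)) ?_
  by_contra! h
  have h1 := (Γ.bIdx_le_iff l _).1 le_rfl h
  have h2 := (Γ ⟨Γ.bIdx l, h⟩).1.2
  omega

lemma fIdx_of_lt {i : ℕ} (hi : r < i) : Γ.fIdx i = n + r + 1 := by
  refine le_antisymm ((Γ.fIdx_le_iff _ _).2 fun h => absurd h (lt_irrefl _)) ?_
  by_contra! h
  have h1 := (Γ.fIdx_le_iff i _).1 le_rfl h
  have h2 := (Γ ⟨Γ.fIdx i, h⟩).2.2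
  omega

/-- The value of the base coordinate when the fiber coordinate reaches `i`. -/
noncomputable def height (i : ℕ) : ℕ := Γ.fIdx i - i

lemma fst_fIdx {i : ℕ} (hi : i ≤ r) :
    ((Γ ⟨Γ.fIdx i, Γ.fIdx_lt hi⟩).1 : ℕ) = Γ.height i := by
  have h1 := Γ.fst_add_snd ⟨Γ.fIdx i, Γ.fIdx_lt hi⟩
  rw [Γ.snd_fIdx hi] at h1
  simp only at h1
  rw [height]
  omega

lemma fIdx_eq {i : ℕ} (hi : i ≤ r + 1) : Γ.fIdx i = Γ.height i + i := by
  rw [height]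
  rcases hi.lt_or_eq with hi | rfl
  · have h1 := Γ.fst_add_snd ⟨Γ.fIdx i, Γ.fIdx_lt (by omega)⟩
    rw [Γ.snd_fIdx (by omega)] at h1
    simp only at h1
    omega
  · rw [Γ.fIdx_of_lt (by omega)]
    omega

/-- The default value `fIdx (r + 1) = n + r + 1` makes the end of the chain look like one more fiber
step, in the last column. This keeps the induction in `integrateQ_partial` uniform. -/
lemma height_succ_self : Γ.height (r + 1) = n := by
  rw [height, Γ.fIdx_of_lt (by omega)]
  omega

lemma height_le {i : ℕ} (hi : i ≤ r + 1) : Γ.height i ≤ n := by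
  rcases hi.lt_or_eq with hi | rfl
  · rw [← Γ.fst_fIdx (by omega)]
    exact Nat.lt_succ_iff.1 (Γ _).1.2
  · exact Γ.height_succ_self.le

lemma height_mono {i j : ℕ} (hij : i ≤ j) (hj : j ≤ r + 1) : Γ.height i ≤ Γ.height j := by
  rcases hj.lt_or_eq with hj | rfl
  · rw [← Γ.fst_fIdx (by omega), ← Γ.fst_fIdx (by omega)]
    exact Γ.fst_mono (Γ.fIdx_mono hij)
  · rw [height_succ_self]
    exact Γ.height_le hij

lemma fst_fIdx_pred {i : ℕ} (h1 : 1 ≤ i) (hi : i ≤ r) (h : Γ.fIdx i - 1 < n + r + 1) :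
    ((Γ ⟨Γ.fIdx i - 1, h⟩).1 : ℕ) = Γ.height i := by
  have h2 := Γ.fst_mono (i := ⟨Γ.fIdx i - 1, h⟩) (j := ⟨Γ.fIdx i, Γ.fIdx_lt hi⟩) (Nat.sub_le _ _)
  rw [Γ.fst_fIdx hi] at h2
  have h3 := Γ.fst_add_snd ⟨Γ.fIdx i - 1, h⟩
  have h4 : ¬ Γ.fIdx i ≤ Γ.fIdx i - 1 := by have := Γ.fIdx_eq (i := i) (by omega); omega
  rw [fIdx_le_iff] at h4
  push Not at h4
  obtain ⟨h5, h6⟩ := h4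
  have := Γ.fIdx_eq (i := i) (by omega)
  simp only at h3
  omega

/-- The step into a fiber direction leaves the base coordinate unchanged, so no column is entered
there. The value `i = 0` has to be excluded, as `bIdx 0 = fIdx 0 = 0`. -/
lemma bIdx_ne_fIdx {l i : ℕ} (hl : l ≤ n) (h1 : 1 ≤ i) (hi : i ≤ r) : Γ.bIdx l ≠ Γ.fIdx i := by
  intro h
  have h0 := Γ.fIdx_eq (i := i) (by omega)
  have hlt : Γ.fIdx i - 1 < n + r + 1 := by have := Γ.fIdx_lt hi; omega
  have h2 := Γ.fst_bIdx hl
  have h3 : ((Γ ⟨Γ.bIdx l, Γ.bIdx_lt hl⟩).1 : ℕ) = Γ.height i := by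
    rw [← Γ.fst_fIdx hi]
    simp only [h]
  have h4 : Γ.bIdx l ≤ Γ.fIdx i - 1 := (Γ.bIdx_le_iff _ _).2 fun _ => by
    rw [Γ.fst_fIdx_pred h1 hi]
    omega
  omega

lemma fIdx_strictMono {i j : ℕ} (hij : i < j) (hj : j ≤ r + 1) : Γ.fIdx i < Γ.fIdx j := by
  have := Γ.height_mono hij.le hj
  rw [Γ.fIdx_eq hj, Γ.fIdx_eq (by omega)]
  omega

lemma exists_eq_bIdx_or_fIdx {j : ℕ} (hj : j < n + r + 1) :
    (∃ l ≤ n, j = Γ.bIdx l) ∨ ∃ i, 1 ≤ i ∧ i ≤ r ∧ j = Γ.fIdx i := by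
  rcases Nat.eq_zero_or_pos j with rfl | h0
  · exact Or.inl ⟨0, Nat.zero_le _, Γ.bIdx_zero.symm⟩
  have hlt : j - 1 < n + r + 1 := by omega
  have h1 := Γ.fst_add_snd ⟨j, hj⟩
  have h2 := Γ.fst_add_snd ⟨j - 1, hlt⟩
  have h3 := Γ.fst_mono (i := ⟨j - 1, hlt⟩) (j := ⟨j, hj⟩) (Nat.sub_le _ _)
  have h4 := Γ.snd_mono (i := ⟨j - 1, hlt⟩) (j := ⟨j, hj⟩) (Nat.sub_le _ _)
  have h5 := (Γ ⟨j, hj⟩).1.2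
  have h6 := (Γ ⟨j, hj⟩).2.2
  simp only at h1 h2
  by_cases h : ((Γ ⟨j - 1, hlt⟩).1 : ℕ) = (Γ ⟨j, hj⟩).1
  · refine Or.inr ⟨(Γ ⟨j, hj⟩).2, by omega, by omega, le_antisymm ?_ ?_⟩
    · by_contra! hc
      have : Γ.fIdx ((Γ ⟨j, hj⟩).2 : ℕ) ≤ j - 1 := by omega
      have := (Γ.fIdx_le_iff _ _).1 this hlt
      omega
    · exact (Γ.fIdx_le_iff _ _).2 fun _ => le_rfl
  · refine Or.inl ⟨(Γ ⟨j, hj⟩).1, by omega, le_antisymm ?_ ?_⟩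
    · by_contra! hc
      have : Γ.bIdx ((Γ ⟨j, hj⟩).1 : ℕ) ≤ j - 1 := by omega
      have := (Γ.bIdx_le_iff _ _).1 this hlt
      omega
    · exact (Γ.bIdx_le_iff _ _).2 fun _ => le_rfl

/-- This identifies the lower limit of an integral with a variable of the base, namely the next
break point, when the following fiber step lies in another column. -/
lemma fIdx_add_one {i : ℕ} (hi : i ≤ r) (h : Γ.height i < Γ.height (i + 1)) :
    Γ.fIdx i + 1 = Γ.bIdx (Γ.height i + 1) := by
  have h1 := Γ.fIdx_eq (i := i) (by omega)
  have h2 := Γ.fIdx_eq (i := i + 1) (by omega)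
  have h3 := Γ.height_le (i := i + 1) (by omega)
  have hlt : Γ.fIdx i + 1 < n + r + 1 := by omega
  have h4 := Γ.fst_add_snd ⟨Γ.fIdx i + 1, hlt⟩
  have h5 := Γ.snd_mono (i := ⟨Γ.fIdx i, Γ.fIdx_lt hi⟩) (j := ⟨Γ.fIdx i + 1, hlt⟩)
    (Nat.le_succ _)
  rw [Γ.snd_fIdx hi] at h5
  have h6 : ¬ Γ.fIdx (i + 1) ≤ Γ.fIdx i + 1 := by omega
  rw [fIdx_le_iff] at h6
  push Not at h6
  obtain ⟨_, h6⟩ := h6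
  simp only at h4
  refine le_antisymm ?_ ((Γ.bIdx_le_iff _ _).2 fun _ => by omega)
  by_contra! hc
  have h7 := (Γ.bIdx_le_iff (Γ.height i + 1) (Γ.fIdx i)).1 (by omega) (Γ.fIdx_lt hi)
  rw [Γ.fst_fIdx hi] at h7
  omega

lemma baseDir_eq (l : Fin (n + 1)) : (Γ.baseDir l : ℕ) = Γ.bIdx l := by
  have hl : (l : ℕ) ≤ n := Nat.lt_succ_iff.1 l.2
  have hmem : (⟨Γ.bIdx l, Γ.bIdx_lt hl⟩ : Fin (n + r + 1)) ∈ {j | (Γ j).1 = l} :=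
    Fin.ext (Γ.fst_bIdx hl)
  refine le_antisymm (show Γ.baseDir l ≤ ⟨Γ.bIdx l, Γ.bIdx_lt hl⟩ from sInf_le hmem) ?_
  have h : Γ.baseDir l ∈ {j | (Γ j).1 = l} := csInf_mem ⟨_, hmem⟩
  exact (Γ.bIdx_le_iff _ _).2 fun _ => (congrArg Fin.val h).ge

lemma fiberDir_eq {i : ℕ} (hi : i ≤ r) : (Γ.fiberDir i : ℕ) = Γ.fIdx i := by
  have hmem : (⟨Γ.fIdx i, Γ.fIdx_lt hi⟩ : Fin (n + r + 1)) ∈ {j | i ≤ ((Γ j).2 : ℕ)} :=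
    (Γ.snd_fIdx hi).ge
  refine le_antisymm (show Γ.fiberDir i ≤ ⟨Γ.fIdx i, Γ.fIdx_lt hi⟩ from sInf_le hmem) ?_
  have h : Γ.fiberDir i ∈ {j | i ≤ ((Γ j).2 : ℕ)} := csInf_mem ⟨_, hmem⟩
  exact (Γ.fIdx_le_iff _ _).2 fun _ => h

/-- Fiber directions with equal `fiberDir j - j` have equal height, that is, they lie in one column.
The position just before the first of them is where the column is entered, so the upper limit is the
break point `x_{height i}` of the base. -/
lemma upper_eq {i : ℕ} (h1 : 1 ≤ i) (hi : i ≤ r) : Γ.upper i = Γ.bIdx (Γ.height i) := by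
  have hmem : i ∈ {j : ℕ | 1 ≤ j ∧ (Γ.fiberDir j : ℕ) + i = (Γ.fiberDir i : ℕ) + j} := ⟨h1, rfl⟩
  have hj := Nat.sInf_mem ⟨i, hmem⟩
  have hji := Nat.sInf_le hmem
  rw [upper]
  set j := sInf {j : ℕ | 1 ≤ j ∧ (Γ.fiberDir j : ℕ) + i = (Γ.fiberDir i : ℕ) + j} with hjdef
  obtain ⟨hj1, hj2⟩ := hj
  rw [Γ.fiberDir_eq hi, Γ.fiberDir_eq (hji.trans hi)] at hj2
  rw [Γ.fiberDir_eq (hji.trans hi)]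
  have e1 := Γ.fIdx_eq (i := i) (by omega)
  have e2 := Γ.fIdx_eq (i := j) (by omega)
  have hk : Γ.height j = Γ.height i := by omega
  have hlt : Γ.fIdx j - 1 < n + r + 1 := by have := Γ.fIdx_lt (hji.trans hi); omega
  refine le_antisymm ?_ ((Γ.bIdx_le_iff _ _).2 fun _ => by
    rw [Γ.fst_fIdx_pred hj1 (hji.trans hi), hk])
  by_contra! hc
  have hkn := Γ.height_le (i := i) (by omega)
  have s1 := Γ.fst_add_snd ⟨_, Γ.bIdx_lt hkn⟩
  rw [Γ.fst_bIdx hkn] at s1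
  simp only at s1
  -- Here `c` is the fiber coordinate on entering the column. Were the column entered before
  -- position `fIdx j - 1`, fiber step `c + 1` would lie in the same block and come before `j`,
  -- against the minimality of `j`.
  obtain ⟨c, hcdef⟩ : ∃ c : ℕ, c = (Γ ⟨_, Γ.bIdx_lt hkn⟩).2 := ⟨_, rfl⟩
  rw [← hcdef] at s1
  have h3 : ¬ Γ.fIdx (c + 1) ≤ Γ.bIdx (Γ.height i) := fun h => by
    have := (Γ.fIdx_le_iff _ _).1 h (Γ.bIdx_lt hkn)
    omega
  have h4 := Γ.fIdx_eq (i := c + 1) (by omega)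
  have h5 := Γ.height_mono (i := c + 1) (j := j) (by omega) (by omega)
  have h6 : j ≤ c + 1 := Nat.sInf_le ⟨by omega, by
    rw [Γ.fiberDir_eq hi, Γ.fiberDir_eq (by omega)]
    omega⟩
  omega

lemma baseDir_monotone : Monotone Γ.baseDir := fun i j h => by
  change (Γ.baseDir i : ℕ) ≤ Γ.baseDir j
  rw [baseDir_eq, baseDir_eq]
  exact Γ.bIdx_mono h

lemma base_comp_baseDir : Γ.base.toOrderHom ∘ Γ.baseDir = id := by
  funext l
  have hl : (l : ℕ) ≤ n := Nat.lt_succ_iff.1 l.2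
  have h : Γ.baseDir l = ⟨Γ.bIdx l, Γ.bIdx_lt hl⟩ := Fin.ext (Γ.baseDir_eq l)
  change (Γ (Γ.baseDir l)).1 = l
  rw [h]
  exact Fin.ext (Γ.fst_bIdx hl)

/-! ### Maximal chains as weakly increasing sequences of columns -/

/-- The column, among the `n + 1` possible ones, in which the `i`-th fiber step takes place. -/
noncomputable def col (i : Fin r) : Fin (n + 1) := ⟨Γ.height (i + 1), Nat.lt_succ_iff.2
  (Γ.height_le (by omega))⟩

lemma col_monotone : Monotone Γ.col := fun i j h =>
  Γ.height_mono (Nat.succ_le_succ h) (by omega)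

/-- By this criterion maps into `[n] × [r]` are shown to factor through a chain, and the columns are
shown to determine the chain. -/
lemma mem_iff (a : Fin (n + 1)) (c : Fin (r + 1)) :
    (∃ j, Γ j = (a, c)) ↔
      ∀ i : Fin r, ((i : ℕ) < c → Γ.col i ≤ a) ∧ ((c : ℕ) ≤ i → a ≤ Γ.col i) := by
  constructor
  · rintro ⟨j, hj⟩ i
    have h1 : ((Γ j).1 : ℕ) = a := by rw [hj]
    have h2 : ((Γ j).2 : ℕ) = c := by rw [hj]
    refine ⟨fun h => ?_, fun h => ?_⟩
    · change Γ.height (i + 1) ≤ (a : ℕ)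
      rw [← Γ.fst_fIdx (by omega), ← h1]
      exact Γ.fst_mono ((Γ.fIdx_le_iff _ _).2 fun _ => by change (i : ℕ) + 1 ≤ (Γ j).2; omega)
    · change (a : ℕ) ≤ Γ.height (i + 1)
      rw [← Γ.fst_fIdx (by omega), ← h1]
      refine Γ.fst_mono ?_
      change (j : ℕ) ≤ Γ.fIdx (i + 1)
      by_contra! hc
      have : (i : ℕ) + 1 ≤ (Γ j).2 := (Γ.fIdx_le_iff _ _).1 hc.le j.2
      omega
  · intro h
    have ha := a.2
    have hc := c.2
    refine ⟨⟨a + c, by omega⟩, ?_⟩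
    have hs := Γ.fst_add_snd ⟨a + c, by omega⟩
    simp only at hs
    have key : ((Γ ⟨a + c, by omega⟩).2 : ℕ) = c := by
      refine le_antisymm ?_ ?_
      · by_contra! hlt
        have hcr : (c : ℕ) < r := by have := (Γ ⟨a + c, by omega⟩).2.2; omega
        have h1 : (a : ℕ) ≤ Γ.height (c + 1) := (h ⟨c, hcr⟩).2 le_rfl
        have h2 := Γ.fIdx_eq (i := c + 1) (by omega)
        have h3 : Γ.fIdx (c + 1) ≤ a + c := (Γ.fIdx_le_iff _ _).2 fun _ => hlt
        omega
      · rcases Nat.eq_zero_or_pos (c : ℕ) with h0 | h0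
        · omega
        · have h1 : Γ.height (c - 1 + 1) ≤ (a : ℕ) := (h ⟨c - 1, by omega⟩).1
            (by change (c : ℕ) - 1 < c; omega)
          rw [Nat.sub_add_cancel h0] at h1
          have h2 := Γ.fIdx_eq (i := c) (by omega)
          exact (Γ.fIdx_le_iff _ _).1 (by omega) (by omega)
    have key' : ((Γ ⟨a + c, by omega⟩).1 : ℕ) = a := by omega
    exact Prod.ext (Fin.ext key') (Fin.ext key)

lemma col_injective : Function.Injective (col : MaxChain n r → Fin r → Fin (n + 1)) := by
  intro Γ Γ' h
  refine DFunLike.ext _ _ fun j => ?_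
  obtain ⟨j', hj'⟩ := (Γ'.mem_iff (Γ j).1 (Γ j).2).2 (h ▸ (Γ.mem_iff (Γ j).1 (Γ j).2).1 ⟨j, rfl⟩)
  have h1 := Γ.fst_add_snd j
  have h2 := Γ'.fst_add_snd j'
  rw [hj'] at h2
  obtain rfl : j = j' := Fin.ext (by simpa only using h1.symm.trans h2)
  exact hj'.symm

section ofCol

variable (k : Fin r → Fin (n + 1))

/-- The number of fiber steps up to the position `j`, if the `i`-th one takes place in column
`k i`. -/
def stepCount (j : ℕ) : ℕ := (Finset.univ.filter fun i : Fin r => (k i : ℕ) + i + 1 ≤ j).card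

variable {k}

/-- The fiber steps end at the distinct positions `k i + i + 1`, so at most `j' - j` of them end
after `j` and up to `j'`. This makes the base coordinate `j - stepCount k j` monotone and its
subtraction exact. -/
lemma stepCount_le_add (hk : Monotone k) {j j' : ℕ} (h : j ≤ j') :
    stepCount k j' + j ≤ stepCount k j + j' := by
  have hsub : (Finset.univ.filter fun i : Fin r => (k i : ℕ) + i + 1 ≤ j') ⊆
      (Finset.univ.filter fun i : Fin r => (k i : ℕ) + i + 1 ≤ j) ∪
      (Finset.univ.filter fun i : Fin r => j < (k i : ℕ) + i + 1 ∧ (k i : ℕ) + i + 1 ≤ j') := by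
    intro i
    simp only [Finset.mem_filter, Finset.mem_univ, true_and, Finset.mem_union]
    omega
  have h1 := (Finset.card_le_card hsub).trans (Finset.card_union_le _ _)
  have h2 : (Finset.univ.filter fun i : Fin r =>
      j < (k i : ℕ) + i + 1 ∧ (k i : ℕ) + i + 1 ≤ j').card ≤ (Finset.Ioc j j').card := by
    refine Finset.card_le_card_of_injOn (fun i => (k i : ℕ) + i + 1) (fun i hi => ?_) ?_
    · simpa using hi
    · intro a _ b _ hab
      simp only at hab
      rcases lt_trichotomy a b with h | h | h
      · have : (k a : ℕ) ≤ k b := hk h.le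
        have : (a : ℕ) < b := h
        omega
      · exact h
      · have : (k b : ℕ) ≤ k a := hk h.le
        have : (b : ℕ) < a := h
        omega
  rw [Nat.card_Ioc] at h2
  simp only [stepCount]
  omega

lemma stepCount_eq (hk : Monotone k) (i : Fin r) :
    stepCount k (k i + i + 1) = i + 1 ∧ stepCount k (k i + i) = i := by
  have h : ∀ i' : Fin r, ((k i' : ℕ) + i' + 1 ≤ k i + i + 1 ↔ i' ≤ i) ∧
      ((k i' : ℕ) + i' + 1 ≤ k i + i ↔ i' < i) := by
    intro i'
    rcases lt_trichotomy i' i with h | rfl | h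
    · have : (k i' : ℕ) ≤ k i := hk h.le
      have h' : (i' : ℕ) < i := h
      simp only [h, h.le, iff_true]
      omega
    · simp
    · have : (k i : ℕ) ≤ k i' := hk h.le
      have h' : (i : ℕ) < i' := h
      simp only [h.not_gt, h.not_ge, iff_false]
      omega
  constructor
  · rw [stepCount, Finset.filter_congr fun i' _ => (h i').1]
    have := Fin.card_Iic i
    rwa [← Finset.filter_ge_eq_Iic] at this
  · rw [stepCount, Finset.filter_congr fun i' _ => (h i').2]
    have := Fin.card_Iio i
    rwa [← Finset.filter_gt_eq_Iio] at this

lemma stepCount_mono : Monotone (stepCount k) := fun _ _ h =>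
  Finset.card_le_card fun _ => by
    simp only [Finset.mem_filter, Finset.mem_univ, true_and]
    omega

lemma stepCount_le (j : ℕ) : stepCount k j ≤ r :=
  (Finset.card_le_univ _).trans (Fintype.card_fin r).le

lemma stepCount_zero : stepCount k 0 = 0 := by simp [stepCount]

lemma stepCount_last : stepCount k (n + r) = r := by
  rw [stepCount, Finset.filter_true_of_mem]
  · simp
  · intro i _
    have := (k i).2
    have := i.2
    omega

end ofCol

/-- The maximal chain whose `i`-th fiber step takes place in column `k i`. -/
def ofCol (k : Fin r → Fin (n + 1)) (hk : Monotone k) : MaxChain n r :=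
  OrderEmbedding.ofStrictMono
    (fun j => (⟨j - stepCount k j, by
        have h1 := stepCount_le_add hk (Nat.lt_succ_iff.1 j.2)
        rw [stepCount_last] at h1
        omega⟩, ⟨stepCount k j, Nat.lt_succ_iff.2 (stepCount_le _)⟩))
    (fun i j hij => by
      have h0 : (i : ℕ) < j := hij
      have h1 := stepCount_mono (k := k) h0.le
      have h2 := stepCount_le_add hk h0.le
      have h3 := stepCount_le_add hk (Nat.zero_le i)
      have h4 := stepCount_le_add hk (Nat.zero_le j)
      rw [stepCount_zero] at h3 h4
      refine lt_of_le_of_ne ⟨?_, h1⟩ fun h => ?_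
      · change (i : ℕ) - stepCount k i ≤ j - stepCount k j
        omega
      · obtain ⟨h5, h6⟩ := Prod.mk.inj h
        have h5 := congrArg Fin.val h5
        have h6 := congrArg Fin.val h6
        simp only at h5 h6
        omega)

lemma col_ofCol (k : Fin r → Fin (n + 1)) (hk : Monotone k) : (ofCol k hk).col = k := by
  funext i
  have h := stepCount_eq hk i
  have hb := (k i).2
  have h1 : (ofCol k hk).fIdx (i + 1) ≤ k i + i + 1 :=
    (fIdx_le_iff _ _ _).2 fun _ => h.1.ge
  have h2 : ¬ (ofCol k hk).fIdx (i + 1) ≤ k i + i := fun hc => by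
    have h3 : (i : ℕ) + 1 ≤ stepCount k (k i + i) := (fIdx_le_iff _ _ _).1 hc (by omega)
    omega
  refine Fin.ext ?_
  change (ofCol k hk).fIdx (i + 1) - (i + 1) = k i
  omega

/-! ### Factoring maps through a chain -/

/-- A map into `[n] × [r]` with values in the chain `Γ` factors through `Γ`. -/
def factor {N : ℕ} (u : SimplexCategory.mk N ⟶ SimplexCategory.mk n)
    (v : SimplexCategory.mk N ⟶ SimplexCategory.mk r) :
    SimplexCategory.mk N ⟶ SimplexCategory.mk (n + r) :=
  SimplexCategory.Hom.mk ⟨fun j => ⟨(u.toOrderHom j : ℕ) + v.toOrderHom j, by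
    have h1 : (u.toOrderHom j : ℕ) < n + 1 := (u.toOrderHom j).2
    have h2 : (v.toOrderHom j : ℕ) < r + 1 := (v.toOrderHom j).2
    change _ < n + r + 1
    omega⟩, fun _ _ h => Nat.add_le_add (u.toOrderHom.monotone h) (v.toOrderHom.monotone h)⟩

section factor

variable {N : ℕ} {u : SimplexCategory.mk N ⟶ SimplexCategory.mk n}
  {v : SimplexCategory.mk N ⟶ SimplexCategory.mk r}

lemma apply_factor {Γ : MaxChain n r}
    (h : ∀ j, ∃ l, Γ l = (u.toOrderHom j, v.toOrderHom j)) (j : Fin (N + 1)) :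
    Γ ((factor u v).toOrderHom j) = (u.toOrderHom j, v.toOrderHom j) := by
  obtain ⟨l, hl⟩ := h j
  have h1 := Γ.fst_add_snd l
  rw [hl] at h1
  rw [← hl]
  congr 1
  exact Fin.ext h1

lemma factor_comp_base {Γ : MaxChain n r}
    (h : ∀ j, ∃ l, Γ l = (u.toOrderHom j, v.toOrderHom j)) : factor u v ≫ Γ.base = u := by
  refine SimplexCategory.Hom.ext _ _ (OrderHom.ext _ _ (funext fun j => ?_))
  exact congrArg Prod.fst (apply_factor h j)

lemma factor_comp_fiber {Γ : MaxChain n r}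
    (h : ∀ j, ∃ l, Γ l = (u.toOrderHom j, v.toOrderHom j)) : factor u v ≫ Γ.fiber = v := by
  refine SimplexCategory.Hom.ext _ _ (OrderHom.ext _ _ (funext fun j => ?_))
  exact congrArg Prod.snd (apply_factor h j)

end factor

end MaxChain

/-! ### Rational polynomials: pullback and integration -/

section Rational

variable {n m l : ℕ}

/-- The pullback of rational polynomials along `α : [m] → [n]`. -/
noncomputable def pullbackQ (α : Fin (m + 1) → Fin (n + 1)) :
    MvPolynomial (Fin (n + 1)) ℚ →ₐ[ℚ] MvPolynomial (Fin (m + 1)) ℚ :=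
  MvPolynomial.aeval fun i => DP.polyX m (firstGE α i)

lemma toPoly_pullbackFun (α : Fin (m + 1) → Fin (n + 1)) (f : DP n) :
    DP.toPoly m (pullbackFun α f) = pullbackQ α (DP.toPoly n f) := DP.toPoly_subst _ _

lemma polyX_of_lt {j : ℕ} (h : n < j) : DP.polyX n j = 0 := dif_neg (by omega)

lemma polyX_val (i : Fin (n + 1)) : DP.polyX n i = MvPolynomial.X i := dif_pos i.2

lemma polyX_of_le {j : ℕ} (h : j < n + 1) : DP.polyX n j = MvPolynomial.X ⟨j, h⟩ := dif_pos h

lemma firstGE_of_lt {α : Fin (m + 1) → Fin (n + 1)} (hα : Monotone α) {j : ℕ} (hj : n < j) :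
    firstGE α j = m + 1 := by
  refine le_antisymm ((firstGE_le_iff hα _ _).2 fun h => absurd h (lt_irrefl _)) ?_
  by_contra! h
  have h1 := (firstGE_le_iff hα j _).1 le_rfl h
  have h2 := (α ⟨firstGE α j, h⟩).2
  omega

lemma pullbackQ_polyX {α : Fin (m + 1) → Fin (n + 1)} (hα : Monotone α) (j : ℕ) :
    pullbackQ α (DP.polyX n j) = DP.polyX m (firstGE α j) := by
  rcases Nat.lt_or_ge n j with h | h
  · rw [polyX_of_lt h, firstGE_of_lt hα h, polyX_of_lt (Nat.lt_succ_self m), map_zero]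
  · rw [polyX_of_le (Nat.lt_succ_of_le h), pullbackQ, MvPolynomial.aeval_X]

lemma pullbackQ_pullbackQ {α : Fin (l + 1) → Fin (m + 1)} {β : Fin (m + 1) → Fin (n + 1)}
    (hα : Monotone α) (hβ : Monotone β) (p : MvPolynomial (Fin (n + 1)) ℚ) :
    pullbackQ α (pullbackQ β p) = pullbackQ (β ∘ α) p := by
  rw [← AlgHom.comp_apply]
  congr 1
  refine MvPolynomial.algHom_ext fun i => ?_
  rw [AlgHom.comp_apply, ← polyX_val, pullbackQ_polyX hβ, pullbackQ_polyX hα,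
    pullbackQ_polyX (hβ.comp hα), firstGE_comp hα hβ]

lemma pullbackQ_id (p : MvPolynomial (Fin (n + 1)) ℚ) :
    pullbackQ (id : Fin (n + 1) → Fin (n + 1)) p = p := by
  have : pullbackQ (id : Fin (n + 1) → Fin (n + 1)) = AlgHom.id ℚ _ := by
    refine MvPolynomial.algHom_ext fun i => ?_
    rw [← polyX_val, pullbackQ_polyX monotone_id, firstGE_id]
    rfl
  rw [this]
  rfl

/-- The rational version of `DP.integral`. -/
noncomputable def integralQ (i : Fin (m + 1)) (lo hi : ℕ) :
    MvPolynomial (Fin (m + 1)) ℚ →ₗ[ℚ] MvPolynomial (Fin (m + 1)) ℚ :=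
  (MvPolynomial.basisMonomials (Fin (m + 1)) ℚ).constr ℚ fun N =>
    MvPolynomial.monomial (N.erase i) (((N i : ℚ) + 1)⁻¹) *
      (DP.polyX m hi ^ (N i + 1) - DP.polyX m lo ^ (N i + 1))

lemma integralQ_monomial (i : Fin (m + 1)) (lo hi : ℕ) (N : Fin (m + 1) →₀ ℕ) (a : ℚ) :
    integralQ i lo hi (MvPolynomial.monomial N a) =
      MvPolynomial.monomial (N.erase i) (a * ((N i : ℚ) + 1)⁻¹) *
        (DP.polyX m hi ^ (N i + 1) - DP.polyX m lo ^ (N i + 1)) := by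
  have h : MvPolynomial.monomial N a =
      a • (MvPolynomial.basisMonomials (Fin (m + 1)) ℚ) N := by
    rw [MvPolynomial.coe_basisMonomials, MvPolynomial.smul_monomial, smul_eq_mul, mul_one]
  rw [h, map_smul, integralQ, Module.Basis.constr_basis, ← smul_mul_assoc,
    MvPolynomial.smul_monomial, smul_eq_mul]

/-- The scalar `1 / (N i)!` of a divided power, times the `1 / (N i + 1)` of ordinary integration,
is the scalar `1 / (N i + 1)!` of the next divided power. -/
lemma toPoly_integral (i : Fin (m + 1)) (lo hi : ℕ) (f : DP m) :
    DP.toPoly m (DP.integral i lo hi f) = integralQ i lo hi (DP.toPoly m f) := by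
  classical
  have h : (DP.toPoly m).toAddMonoidHom.comp (DP.integral i lo hi) =
      (integralQ i lo hi).toAddMonoidHom.comp (DP.toPoly m).toAddMonoidHom := by
    refine DP.hom_ext fun N => ?_
    change DP.toPoly m (DP.integral i lo hi (DP.mono N 1)) =
      integralQ i lo hi (DP.toPolyHom m (DP.mono N 1))
    rw [DP.toPolyHom_mono, integralQ_monomial, DP.integral, DP.lift_mono, one_smul, map_mul,
      map_sub, DP.toPoly_xpow, DP.toPoly_xpow, ← mul_sub, ← mul_assoc]
    congr 1
    change DP.toPolyHom m (DP.mono (N.erase i) 1) * _ = _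
    rw [DP.toPolyHom_mono, mul_comm, MvPolynomial.C_mul_monomial]
    congr 1
    rw [← Finset.mul_prod_erase _ _ (Finset.mem_univ i),
      ← Finset.mul_prod_erase _ (fun j => ((N j).factorial : ℚ)⁻¹) (Finset.mem_univ i),
      Finsupp.erase_same,
      Finset.prod_congr rfl fun j hj => by rw [Finsupp.erase_ne (Finset.ne_of_mem_erase hj)],
      Nat.factorial_succ]
    push_cast
    rw [mul_inv, Nat.factorial_zero, Nat.cast_one, inv_one, one_mul]
    ring
  exact DFunLike.congr_fun h f

lemma integralQ_mul_X_pow (i : Fin (m + 1)) (lo hi : ℕ) {g : MvPolynomial (Fin (m + 1)) ℚ}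
    (hg : g ∈ MvPolynomial.supported ℚ ({i}ᶜ : Set (Fin (m + 1)))) (k : ℕ) :
    integralQ i lo hi (g * MvPolynomial.X i ^ k) =
      g * (MvPolynomial.C (((k : ℚ) + 1)⁻¹) *
        (DP.polyX m hi ^ (k + 1) - DP.polyX m lo ^ (k + 1))) := by
  classical
  have hN : ∀ N ∈ g.support, N i = 0 := by
    intro N hN
    by_contra h
    have h1 : i ∈ g.vars := (MvPolynomial.mem_vars_iff_mem_support i).2 ⟨N, hN, Finsupp.mem_support_iff.2 h⟩
    exact (MvPolynomial.mem_supported.1 hg) h1 rfl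
  rw [← MvPolynomial.support_sum_monomial_coeff g, Finset.sum_mul, map_sum, Finset.sum_mul]
  refine Finset.sum_congr rfl fun N hN' => ?_
  have h0 := hN N hN'
  have h1 : (N + Finsupp.single i k) i = k := by simp [h0]
  have h2 : (N + Finsupp.single i k).erase i = N := by
    ext j
    by_cases hj : j = i
    · subst hj; simp [h0]
    · simp [Finsupp.erase_ne hj]
  rw [MvPolynomial.X_pow_eq_monomial, MvPolynomial.monomial_mul, mul_one, integralQ_monomial,
    h1, h2, ← mul_assoc, mul_comm (MvPolynomial.monomial N _) (MvPolynomial.C _),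
    MvPolynomial.C_mul_monomial, mul_comm (((k : ℚ) + 1)⁻¹)]

-- This is the bridge from `DP.integral` to `upperInt`: a polynomial in `x_i` with coefficients free
-- of `x_i` is integrated by `antideriv`, and the factor `g`, free of `x_i` too, comes out of the
-- integral.
open Polynomial in
lemma integralQ_mul_eval₂ {A : Type*} [CommRing A] [Algebra ℚ A] (i : Fin (m + 1)) (lo hi : ℕ)
    (c : A →ₐ[ℚ] MvPolynomial (Fin (m + 1)) ℚ)
    (hc : ∀ a, c a ∈ MvPolynomial.supported ℚ ({i}ᶜ : Set (Fin (m + 1))))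
    {g : MvPolynomial (Fin (m + 1)) ℚ}
    (hg : g ∈ MvPolynomial.supported ℚ ({i}ᶜ : Set (Fin (m + 1)))) (p : A[X]) :
    integralQ i lo hi (g * p.eval₂ (c : A →+* _) (MvPolynomial.X i)) =
      g * ((antideriv p).eval₂ (c : A →+* _) (DP.polyX m hi) -
        (antideriv p).eval₂ (c : A →+* _) (DP.polyX m lo)) := by
  induction p using Polynomial.induction_on' with
  | add p q hp hq =>
    rw [eval₂_add, mul_add, map_add, hp, hq, map_add, eval₂_add, eval₂_add]
    ring
  | monomial k a =>
    rw [eval₂_monomial, RingHom.coe_coe, ← mul_assoc, integralQ_mul_X_pow i lo hi (mul_mem hg (hc a)),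
      antideriv_monomial, eval₂_monomial, eval₂_monomial]
    simp only [RingHom.coe_coe, map_mul, AlgHom.commutes]
    rw [MvPolynomial.algebraMap_eq]
    ring

lemma eval₂_mem_subalgebra {A B : Type*} [CommRing A] [CommRing B] [Algebra ℚ B]
    (S : Subalgebra ℚ B) (c : A →+* B) (hc : ∀ a, c a ∈ S) {x : B} (hx : x ∈ S)
    (p : Polynomial A) : p.eval₂ c x ∈ S := by
  rw [Polynomial.eval₂_eq_sum_range]
  exact sum_mem fun i _ => mul_mem (hc _) (pow_mem hx i)

end Rational

/-! ### Integration over the fibers of a chain, for functions -/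

namespace MaxChain

open Polynomial

variable {n r : ℕ} (Γ : MaxChain n r)

/-- Polynomials in the base coordinates as functions on the simplex of the chain. -/
noncomputable abbrev baseQ :
    MvPolynomial (Fin (n + 1)) ℚ →ₐ[ℚ] MvPolynomial (Fin (n + r + 1)) ℚ :=
  pullbackQ Γ.base.toOrderHom

lemma baseQ_polyX (j : ℕ) : Γ.baseQ (DP.polyX n j) = DP.polyX (n + r) (Γ.bIdx j) :=
  pullbackQ_polyX Γ.base.toOrderHom.monotone j

lemma baseQ_mem_supported {i : ℕ} (h1 : 1 ≤ i) (hi : i ≤ r) (a : MvPolynomial (Fin (n + 1)) ℚ) :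
    Γ.baseQ a ∈ MvPolynomial.supported ℚ ({Γ.fiberDir i}ᶜ : Set (Fin (n + r + 1))) := by
  induction a using MvPolynomial.induction_on with
  | C q => rw [← MvPolynomial.algebraMap_eq, AlgHom.commutes]; exact algebraMap_mem _ q
  | add p q hp hq => rw [map_add]; exact add_mem hp hq
  | mul_X p l hp =>
    have hl : (l : ℕ) ≤ n := Nat.lt_succ_iff.1 l.2
    rw [map_mul, ← polyX_val l, baseQ_polyX, polyX_of_le (Γ.bIdx_lt hl)]
    refine mul_mem hp (MvPolynomial.X_mem_supported.2 fun h => ?_)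
    have := congrArg Fin.val (Set.mem_singleton_iff.1 h)
    rw [Γ.fiberDir_eq hi] at this
    exact Γ.bIdx_ne_fIdx hl h1 hi this

/-- A polynomial in the base coordinates and in the `i`-th fiber coordinate, as a function on the
simplex of the chain. -/
noncomputable def fiberEval (i : ℕ) (p : (MvPolynomial (Fin (n + 1)) ℚ)[X]) :
    MvPolynomial (Fin (n + r + 1)) ℚ :=
  p.eval₂ (Γ.baseQ : _ →+* _) (DP.polyX (n + r) (Γ.fIdx i))

lemma polyX_fIdx {i : ℕ} (hi : i ≤ r) :
    DP.polyX (n + r) (Γ.fIdx i) = MvPolynomial.X (Γ.fiberDir i) := by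
  rw [← Γ.fiberDir_eq hi, polyX_val]

/-- The rational version of `integrateFun`. -/
noncomputable def integrateQ :
    ℕ → (MvPolynomial (Fin (n + r + 1)) ℚ →ₗ[ℚ] MvPolynomial (Fin (n + r + 1)) ℚ)
  | 0 => LinearMap.id
  | k + 1 => (integralQ (Γ.fiberDir (k + 1)) ((Γ.fiberDir (k + 1) : ℕ) + 1)
      (Γ.upper (k + 1))).comp (integrateQ k)

lemma toPoly_integrateFun (k : ℕ) (f : DP (n + r)) :
    DP.toPoly (n + r) (Γ.integrateFun k f) = Γ.integrateQ k (DP.toPoly (n + r) f) := by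
  induction k with
  | zero => rfl
  | succ k ih =>
    rw [integrateFun, AddMonoidHom.comp_apply, integrateQ, LinearMap.comp_apply, toPoly_integral,
      ih]

/-- The products of a function of the base coordinates and functions of the base coordinates and
one fiber coordinate each. -/
noncomputable def prodQ (a : MvPolynomial (Fin (n + 1)) ℚ)
    (g : Fin r → (MvPolynomial (Fin (n + 1)) ℚ)[X]) : MvPolynomial (Fin (n + r + 1)) ℚ :=
  Γ.baseQ a * ∏ i : Fin r, Γ.fiberEval ((i : ℕ) + 1) (g i)

lemma integrateQ_step {A : Type*} [CommRing A] [Algebra ℚ A] (y : ℕ → A) {j : ℕ} (κ : Fin (j + 1) → ℕ)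
    (g : Fin (j + 1) → A[X]) :
    iterInt y (j + 1) (fun i => Pi.single (κ i) (g i)) =
      upperInt y (Pi.single (κ (Fin.last j))
        (iterInt y j (fun i => Pi.single (κ i.castSucc) (g i.castSucc)) (κ (Fin.last j)) *
          g (Fin.last j))) := by
  rw [iterInt_succ, mul_single]

lemma eval₂_baseQ (p : (MvPolynomial (Fin (n + 1)) ℚ)[X]) (b : MvPolynomial (Fin (n + 1)) ℚ) :
    p.eval₂ (Γ.baseQ : _ →+* _) (Γ.baseQ b) = Γ.baseQ (p.eval b) :=
  Polynomial.eval₂_at_apply (Γ.baseQ : MvPolynomial (Fin (n + 1)) ℚ →+*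
    MvPolynomial (Fin (n + r + 1)) ℚ) b

/-- The fiber variables integrated so far survive only through a function of the next one. That
variable runs over the interval of column `height (j + 1)`, so the function is this piece of the
iterated integral. -/
lemma integrateQ_partial (a : MvPolynomial (Fin (n + 1)) ℚ)
    (g : Fin r → (MvPolynomial (Fin (n + 1)) ℚ)[X]) (j : ℕ) (hj : j ≤ r) :
    Γ.integrateQ j (Γ.prodQ a g) =
      (Γ.baseQ a * ∏ i ∈ Finset.univ.filter (fun i : Fin r => j ≤ i), Γ.fiberEval (i + 1) (g i)) *
        Γ.fiberEval (j + 1) (iterInt (DP.polyX n) j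
          (fun i => Pi.single (Γ.height (i + 1)) (g (i.castLE hj))) (Γ.height (j + 1))) := by
  induction j with
  | zero =>
    rw [iterInt_zero, Pi.one_apply, fiberEval, eval₂_one, mul_one, Finset.filter_true_of_mem]
    · rw [integrateQ, LinearMap.id_apply, prodQ]
    · intro i _; exact Nat.zero_le _
  | succ j ih =>
    have hjr : j + 1 ≤ r := hj
    have hfil : Finset.univ.filter (fun i : Fin r => j ≤ i) =
        insert ⟨j, hj⟩ (Finset.univ.filter (fun i : Fin r => j + 1 ≤ i)) := by
      ext i
      simp only [Finset.mem_filter, Finset.mem_univ, true_and, Finset.mem_insert, Fin.ext_iff]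
      omega
    have hmem : Γ.baseQ a * ∏ i ∈ Finset.univ.filter (fun i : Fin r => j + 1 ≤ i),
        Γ.fiberEval (i + 1) (g i) ∈
          MvPolynomial.supported ℚ ({Γ.fiberDir (j + 1)}ᶜ : Set (Fin (n + r + 1))) := by
      refine mul_mem (Γ.baseQ_mem_supported (by omega) hj a) (prod_mem fun i hi => ?_)
      refine eval₂_mem_subalgebra _ _ (Γ.baseQ_mem_supported (by omega) hj) ?_ _
      rw [Γ.polyX_fIdx (by omega)]
      refine MvPolynomial.X_mem_supported.2 fun h => ?_
      have h1 := congrArg Fin.val (Set.mem_singleton_iff.1 h)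
      rw [Γ.fiberDir_eq hj, Γ.fiberDir_eq (by omega)] at h1
      have h2 : j + 1 ≤ (i : ℕ) := (Finset.mem_filter.1 hi).2
      have := Γ.fIdx_strictMono (i := j + 1) (j := i + 1) (by omega) (by omega)
      omega
    rw [integrateQ, LinearMap.comp_apply, ih (by omega), hfil, Finset.prod_insert (by simp)]
    set W := iterInt (DP.polyX n) j
          (fun i => Pi.single (Γ.height (i + 1)) (g (i.castLE (Nat.le_of_succ_le hj))))
          (Γ.height (j + 1)) with hW
    set G := Γ.baseQ a * ∏ i ∈ Finset.univ.filter (fun i : Fin r => j + 1 ≤ i),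
        Γ.fiberEval (i + 1) (g i) with hG
    have e1 : Γ.baseQ a * (Γ.fiberEval ((⟨j, hj⟩ : Fin r) + 1) (g ⟨j, hj⟩) *
        ∏ i ∈ Finset.univ.filter (fun i : Fin r => j + 1 ≤ i), Γ.fiberEval (i + 1) (g i)) *
        Γ.fiberEval (j + 1) W =
        G * (W * g ⟨j, hj⟩).eval₂ (Γ.baseQ : _ →+* _) (MvPolynomial.X (Γ.fiberDir (j + 1))) := by
      rw [eval₂_mul, ← Γ.polyX_fIdx hj, hG]
      simp only [fiberEval]
      ring
    rw [e1, integralQ_mul_eval₂ _ _ _ _ (Γ.baseQ_mem_supported (by omega) hj) hmem,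
      Γ.upper_eq (by omega) hj, Γ.fiberDir_eq hj, ← Γ.baseQ_polyX]
    congr 1
    rw [integrateQ_step (DP.polyX n) (fun i : Fin (j + 1) => Γ.height (i + 1))
      (fun i => g (i.castLE hj))]
    change _ = Γ.fiberEval (j + 1 + 1)
      (upperInt (DP.polyX n) (Pi.single (Γ.height (j + 1)) (W * g ⟨j, hj⟩)) _)
    set p := W * g ⟨j, hj⟩
    have hself := upperInt_single_self (DP.polyX n) (Γ.height (j + 1)) p
    have hmid : (antideriv p).eval₂ (Γ.baseQ : _ →+* _) (Γ.baseQ (DP.polyX n (Γ.height (j + 1)))) -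
        (antideriv p).eval₂ (Γ.baseQ : _ →+* _) (DP.polyX (n + r) (Γ.fIdx (j + 1) + 1)) =
        (upperInt (DP.polyX n) (Pi.single (Γ.height (j + 1)) p) (Γ.height (j + 1))).eval₂
          (Γ.baseQ : _ →+* _) (DP.polyX (n + r) (Γ.fIdx (j + 1) + 1)) := by
      rw [hself, eval₂_sub, eval₂_C, eval₂_baseQ]
      rfl
    rw [hmid]
    -- The lower limit has index `fIdx (j + 1) + 1`. If the next fiber step lies in the same column,
    -- this is the next fiber variable; otherwise it is the break point closing the interval, and
    -- the integral is constant on all later pieces.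
    rcases (Γ.height_mono (i := j + 1) (j := j + 1 + 1) (by omega) (by omega)).eq_or_lt with h | h
    · have h1 := Γ.fIdx_eq (i := j + 1) (by omega)
      have h2 := Γ.fIdx_eq (i := j + 1 + 1) (by omega)
      rw [← h, fiberEval, show Γ.fIdx (j + 1 + 1) = Γ.fIdx (j + 1) + 1 by omega]
    · rw [upperInt_single_of_lt _ h, fiberEval, eval₂_C, Γ.fIdx_add_one hj h, ← Γ.baseQ_polyX, eval₂_baseQ]
      rfl

lemma pullbackQ_baseDir_baseQ (a : MvPolynomial (Fin (n + 1)) ℚ) :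
    pullbackQ Γ.baseDir (Γ.baseQ a) = a := by
  rw [baseQ, pullbackQ_pullbackQ Γ.baseDir_monotone Γ.base.toOrderHom.monotone,
    base_comp_baseDir, pullbackQ_id]

/-- The iterated integral over the standard simplex of functions supported in single columns. -/
noncomputable def colInt (κ : Fin r → ℕ) (g : Fin r → (MvPolynomial (Fin (n + 1)) ℚ)[X]) :
    MvPolynomial (Fin (n + 1)) ℚ :=
  (iterInt (DP.polyX n) r (fun i => Pi.single (κ i) (g i)) n).eval (DP.polyX n (n + 1))

/-- After the last integration the next fiber variable is `x_{n+r+1} = 0` and the next column is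
`n`, so the last piece is evaluated at the end `0`. The chain enters the result only through its
columns. -/
lemma integrateQ_prodQ (a : MvPolynomial (Fin (n + 1)) ℚ)
    (g : Fin r → (MvPolynomial (Fin (n + 1)) ℚ)[X]) :
    pullbackQ Γ.baseDir (Γ.integrateQ r (Γ.prodQ a g)) = a * colInt (fun i => Γ.col i) g := by
  have hx : DP.polyX (n + r) (Γ.fIdx (r + 1)) = Γ.baseQ (DP.polyX n (n + 1)) := by
    rw [baseQ_polyX, Γ.fIdx_of_lt (Nat.lt_succ_self r), Γ.bIdx_of_lt (Nat.lt_succ_self n)]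
  rw [Γ.integrateQ_partial a g r le_rfl, Finset.prod_eq_one, mul_one, fiberEval, hx,
    Γ.height_succ_self]
  · rw [eval₂_baseQ, ← map_mul, pullbackQ_baseDir_baseQ]
    rfl
  · intro i hi
    have := (Finset.mem_filter.1 hi).2
    omega

lemma colInt_eq_zero {κ : Fin r → ℕ} (h : ¬ Monotone κ)
    (g : Fin r → (MvPolynomial (Fin (n + 1)) ℚ)[X]) : colInt (n := n) κ g = 0 := by
  rw [colInt, iterInt_single_eq_zero _ _ _ _ _ fun h' => h h'.1, eval_zero]

/-- The columns identify chains with monotone sequences. Admitting all sequences, at no cost when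
the others contribute zero, gives the index set needed for multilinear expansion. -/
lemma sum_col {M : Type*} [AddCommMonoid M] (h : (Fin r → Fin (n + 1)) → M)
    (h0 : ∀ κ, ¬ Monotone κ → h κ = 0) : ∑ Γ : MaxChain n r, h Γ.col = ∑ κ, h κ := by
  refine Finset.sum_of_injOn col col_injective.injOn (by simp) (fun κ _ hκ => h0 κ fun hm => ?_)
    fun _ _ => rfl
  exact hκ ⟨ofCol κ hm, by simp, col_ofCol κ hm⟩

end MaxChain

/-! ### Functions on a chain pulled back from the prism `[n] × [1]` -/

lemma firstGE_comp_hom {a b c : ℕ} (f : SimplexCategory.mk a ⟶ SimplexCategory.mk b)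
    (g : SimplexCategory.mk b ⟶ SimplexCategory.mk c) (i : ℕ) :
    firstGE (f ≫ g).toOrderHom i = firstGE f.toOrderHom (firstGE g.toOrderHom i) :=
  firstGE_comp f.toOrderHom.monotone g.toOrderHom.monotone i

lemma pullbackQ_comp_hom {a b c : ℕ} (f : SimplexCategory.mk a ⟶ SimplexCategory.mk b)
    (g : SimplexCategory.mk b ⟶ SimplexCategory.mk c) (p : MvPolynomial (Fin (c + 1)) ℚ) :
    pullbackQ f.toOrderHom (pullbackQ g.toOrderHom p) = pullbackQ (f ≫ g).toOrderHom p :=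
  pullbackQ_pullbackQ f.toOrderHom.monotone g.toOrderHom.monotone p

namespace MaxChain

open Polynomial

variable {n m r : ℕ}

lemma pullbackQ_factor_fiberEval {Γ : MaxChain n r} {N : ℕ}
    {u : SimplexCategory.mk N ⟶ SimplexCategory.mk n}
    {v : SimplexCategory.mk N ⟶ SimplexCategory.mk r}
    (h : ∀ j, ∃ l, Γ l = (u.toOrderHom j, v.toOrderHom j)) (i : ℕ)
    (p : (MvPolynomial (Fin (n + 1)) ℚ)[X]) :
    pullbackQ (factor u v).toOrderHom (Γ.fiberEval i p) =
      p.eval₂ (pullbackQ u.toOrderHom : _ →+* _) (DP.polyX N (firstGE v.toOrderHom i)) := by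
  have h1 := Polynomial.hom_eval₂ p (Γ.baseQ : _ →+* _)
    ((pullbackQ (factor u v).toOrderHom).toRingHom :
      MvPolynomial (Fin (n + r + 1)) ℚ →+* MvPolynomial (Fin (N + 1)) ℚ)
    (DP.polyX (n + r) (Γ.fIdx i))
  refine h1.trans ?_
  have h2 : ((pullbackQ (factor u v).toOrderHom).toRingHom :
      MvPolynomial (Fin (n + r + 1)) ℚ →+* MvPolynomial (Fin (N + 1)) ℚ).comp
        (Γ.baseQ : MvPolynomial (Fin (n + 1)) ℚ →+* _) =
      (pullbackQ u.toOrderHom : MvPolynomial (Fin (n + 1)) ℚ →+* MvPolynomial (Fin (N + 1)) ℚ) := by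
    refine RingHom.ext fun q => ?_
    change pullbackQ _ (pullbackQ _ _) = pullbackQ _ _
    rw [pullbackQ_comp_hom, factor_comp_base h]
  rw [h2]
  congr 1
  change pullbackQ _ _ = _
  have h3 := pullbackQ_polyX (factor u v).toOrderHom.monotone (Γ.fIdx i)
  rw [fIdx, ← firstGE_comp_hom, factor_comp_fiber h] at h3
  exact h3

/-- The maximal chain in `[n] × [1]` with fiber step in column `κ`. -/
def colChain (κ : Fin (n + 1)) : MaxChain n 1 := ofCol (fun _ => κ) monotone_const

lemma col_colChain (κ : Fin (n + 1)) (i : Fin 1) : (colChain κ).col i = κ :=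
  congrFun (col_ofCol _ _) i

/-- The map from the simplex of the chain `Γ` to the simplex of the chain in `[n] × [1]` which
contains its image under the `i`-th step map. -/
def stepFactor (Γ : MaxChain n r) (i : Fin r) :
    SimplexCategory.mk (n + r) ⟶ SimplexCategory.mk (n + 1) :=
  factor Γ.base (Γ.fiber ≫ stepMap i)

/-- The step map turns the fiber coordinate from `0` to `1` at the fiber step with index `i`, which
`Γ` takes in column `Γ.col i`; so the image of `Γ` lies on the chain of that column. -/
lemma exists_colChain_eq (Γ : MaxChain n r) (i : Fin r) (j : Fin (n + r + 1)) :
    ∃ l, colChain (Γ.col i) l =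
      (Γ.base.toOrderHom j, (Γ.fiber ≫ stepMap i).toOrderHom j) := by
  rw [mem_iff]
  intro i'
  rw [col_colChain]
  have h := (Γ.mem_iff (Γ j).1 (Γ j).2).1 ⟨j, rfl⟩ i
  have hv : (((Γ.fiber ≫ stepMap i).toOrderHom j : Fin 2) : ℕ) =
      if (i : ℕ) < (Γ j).2 then 1 else 0 := by
    change ((if (i : ℕ) < ((Γ j).2 : ℕ) then 1 else 0 : Fin 2) : ℕ) = _
    split_ifs <;> rfl
  have hi' : (i' : ℕ) = 0 := by omega
  rw [hv, hi']
  change (_ → _ ≤ (Γ j).1) ∧ (_ → (Γ j).1 ≤ _)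
  split_ifs with hc
  · exact ⟨fun _ => h.1 hc, fun h0 => absurd h0 (by omega)⟩
  · exact ⟨fun h0 => absurd h0 (by omega), fun _ => h.2 (not_lt.1 hc)⟩

lemma firstGE_stepMap (Γ : MaxChain n r) (i : Fin r) :
    firstGE (Γ.fiber ≫ stepMap i).toOrderHom 1 = Γ.fIdx (i + 1) := by
  refine eq_of_forall_ge_iff fun j => ?_
  rw [firstGE_le_iff (Γ.fiber ≫ stepMap i).toOrderHom.monotone, fIdx_le_iff]
  refine forall_congr' fun h => ?_
  change 1 ≤ ((if (i : ℕ) < ((Γ ⟨j, h⟩).2 : ℕ) then 1 else 0 : Fin 2) : ℕ) ↔ _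
  split_ifs with hc
  · simpa using hc
  · simpa using hc

lemma pullbackQ_stepFactor (Γ : MaxChain n r) (i : Fin r)
    (p : (MvPolynomial (Fin (n + 1)) ℚ)[X]) :
    pullbackQ (Γ.stepFactor i).toOrderHom ((colChain (Γ.col i)).fiberEval 1 p) =
      Γ.fiberEval (i + 1) p := by
  rw [stepFactor, pullbackQ_factor_fiberEval (Γ.exists_colChain_eq i), firstGE_stepMap]
  rfl

/-- By `exists_eq_bIdx_or_fIdx` each variable is a base coordinate or the only fiber coordinate. -/
lemma exists_fiberEval_eq (Γ : MaxChain n 1) (F : MvPolynomial (Fin (n + 1 + 1)) ℚ) :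
    ∃ p, Γ.fiberEval 1 p = F := by
  induction F using MvPolynomial.induction_on with
  | C q =>
    refine ⟨C (MvPolynomial.C q), ?_⟩
    rw [fiberEval, eval₂_C]
    exact Γ.baseQ.commutes q
  | add p q hp hq =>
    obtain ⟨p', rfl⟩ := hp
    obtain ⟨q', rfl⟩ := hq
    exact ⟨p' + q', by rw [fiberEval, eval₂_add]; rfl⟩
  | mul_X p j hp =>
    obtain ⟨p', rfl⟩ := hp
    rw [← polyX_val]
    rcases Γ.exists_eq_bIdx_or_fIdx j.2 with ⟨l, hl, h⟩ | ⟨i, h1, hi, h⟩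
    · refine ⟨p' * C (DP.polyX n l), ?_⟩
      rw [fiberEval, eval₂_mul, eval₂_C, h, ← Γ.baseQ_polyX]
      rfl
    · obtain rfl : i = 1 := by omega
      refine ⟨p' * X, ?_⟩
      rw [fiberEval, eval₂_mul, eval₂_X, h]
      rfl

/-- A function on the simplex of the chain with fiber step in column `κ`, as a polynomial in the
fiber coordinate. -/
noncomputable def piece (κ : Fin (n + 1)) (f : DP (n + 1)) : (MvPolynomial (Fin (n + 1)) ℚ)[X] :=
  ((colChain κ).exists_fiberEval_eq (DP.toPoly (n + 1) f)).choose

lemma fiberEval_piece (κ : Fin (n + 1)) (f : DP (n + 1)) :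
    (colChain κ).fiberEval 1 (piece κ f) = DP.toPoly (n + 1) f :=
  ((colChain κ).exists_fiberEval_eq (DP.toPoly (n + 1) f)).choose_spec

/-- The iterated integral of functions `f i`, each supported in a column. -/
noncomputable def monoInt (κ : Fin r → Fin (n + 1)) (f : Fin r → DP (n + 1)) : DP n :=
  ∑ Γ : MaxChain n r, if Γ.col = κ then
    pullbackFun Γ.baseDir (Γ.integrateFun r (∏ i, pullbackFun (Γ.stepFactor i).toOrderHom (f i)))
    else 0

/-- The integrand is a product of functions of one fiber coordinate each, so `integrateQ_prodQ`
computes the term of the chain with columns `κ`. If `κ` is not monotone, there is no such chain and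
`colInt` vanishes as well. -/
lemma toPoly_monoInt (κ : Fin r → Fin (n + 1)) (f : Fin r → DP (n + 1)) :
    DP.toPoly n (monoInt κ f) = colInt (fun i => κ i) fun i => piece (κ i) (f i) := by
  have h : ∀ Γ : MaxChain n r, DP.toPoly n (if Γ.col = κ then
      pullbackFun Γ.baseDir (Γ.integrateFun r
        (∏ i, pullbackFun (Γ.stepFactor i).toOrderHom (f i))) else 0) =
      (fun κ' : Fin r → Fin (n + 1) => if κ' = κ then
        colInt (fun i => (κ i : ℕ)) fun i => piece (κ i) (f i) else 0) Γ.col := by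
    intro Γ
    dsimp only
    split_ifs with h
    · subst h
      rw [toPoly_pullbackFun, toPoly_integrateFun, map_prod]
      have hp : ∏ i, DP.toPoly (n + r) (pullbackFun (Γ.stepFactor i).toOrderHom (f i)) =
          Γ.prodQ 1 (fun i => piece (Γ.col i) (f i)) := by
        rw [prodQ, map_one, one_mul]
        refine Finset.prod_congr rfl fun i _ => ?_
        have h1 := toPoly_pullbackFun (Γ.stepFactor i).toOrderHom (f i)
        rw [← fiberEval_piece (Γ.col i), pullbackQ_stepFactor] at h1
        exact h1
      rw [hp, integrateQ_prodQ, one_mul]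
    · exact map_zero _
  rw [monoInt, map_sum, Finset.sum_congr rfl fun Γ _ => h Γ]
  refine (sum_col (fun κ' : Fin r → Fin (n + 1) => if κ' = κ then
    colInt (fun i => (κ i : ℕ)) fun i => piece (κ i) (f i) else 0) ?_).trans ?_
  rotate_left
  · rw [Finset.sum_ite_eq' Finset.univ κ, if_pos (Finset.mem_univ _)]
  · intro κ' hκ'
    split_ifs with h
    · subst h
      exact colInt_eq_zero (fun hm => hκ' hm) _
    · rfl

/-- The rational shuffle identity `iterInt_mul_iterInt`, read in the last piece at the end point
`x_{n+1} = 0`, descends to divided powers because `toPoly` is injective. -/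
lemma monoInt_mul_monoInt {p q : ℕ} (κ : Fin (p + q) → Fin (n + 1))
    (f : Fin (p + q) → DP (n + 1)) :
    monoInt (fun i => κ (Fin.castAdd q i)) (fun i => f (Fin.castAdd q i)) *
        monoInt (fun j => κ (Fin.natAdd p j)) (fun j => f (Fin.natAdd p j)) =
      ∑ σ ∈ shuffles p q, monoInt (fun i => κ (σ i)) (fun i => f (σ i)) := by
  apply DP.toPoly_injective
  rw [map_mul, map_sum]
  simp only [toPoly_monoInt, colInt]
  have h := congrArg (fun F : ℕ → (MvPolynomial (Fin (n + 1)) ℚ)[X] =>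
    (F n).eval (DP.polyX n (n + 1)))
    (iterInt_mul_iterInt (p := p) (q := q) (DP.polyX n) fun i => Pi.single (κ i : ℕ) (piece (κ i) (f i)))
  simp only [Pi.mul_apply, eval_mul, Finset.sum_apply, eval_finsetSum] at h
  exact h

/-! ### Integration over the fibers and degeneracies -/

/-- Every variable is a base coordinate or one of the fiber coordinates, so a monomial separates
into such factors. By additivity, integrals then only need to be computed on products `prodQ`. -/
lemma exists_prodQ_eq (Γ : MaxChain n r) (N : Fin (n + r + 1) →₀ ℕ) (q : ℚ) :
    ∃ a g, Γ.prodQ a g = MvPolynomial.monomial N q := by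
  refine MvPolynomial.induction_on_monomial (motive := fun F => ∃ a g, Γ.prodQ a g = F)
    (fun q => ?_) (fun F j hF => ?_) N q
  · refine ⟨MvPolynomial.C q, 1, ?_⟩
    rw [prodQ, Finset.prod_eq_one fun i _ => by rw [fiberEval, Pi.one_apply, eval₂_one], mul_one]
    exact Γ.baseQ.commutes q
  · obtain ⟨a, g, rfl⟩ := hF
    rw [← polyX_val]
    rcases Γ.exists_eq_bIdx_or_fIdx j.2 with ⟨l, hl, h⟩ | ⟨i, h1, hi, h⟩
    · refine ⟨a * DP.polyX n l, g, ?_⟩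
      rw [prodQ, prodQ, map_mul, baseQ_polyX, h]
      ring
    · refine ⟨a, Function.update g ⟨i - 1, by omega⟩ (g ⟨i - 1, by omega⟩ * X), ?_⟩
      rw [prodQ, prodQ, mul_assoc]
      congr 1
      rw [← Finset.mul_prod_erase _ _ (Finset.mem_univ (⟨i - 1, by omega⟩ : Fin r)),
        ← Finset.mul_prod_erase _ (fun i : Fin r => Γ.fiberEval ((i : ℕ) + 1) (g i))
          (Finset.mem_univ (⟨i - 1, by omega⟩ : Fin r)), Function.update_self,
        Finset.prod_congr rfl fun k hk => by
          rw [Function.update_of_ne (Finset.ne_of_mem_erase hk)]]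
      have hi1 : i - 1 + 1 = i := by omega
      simp only [fiberEval, eval₂_mul, eval₂_X, hi1, h]
      ring

section degeneracy

variable (σ : SimplexCategory.mk n ⟶ SimplexCategory.mk m)

/-- The image of a maximal chain under a degeneracy of the base. -/
noncomputable def push (Γ : MaxChain n r) : MaxChain m r :=
  ofCol (fun i => σ.toOrderHom (Γ.col i)) (σ.toOrderHom.monotone.comp Γ.col_monotone)

lemma col_push (Γ : MaxChain n r) : (Γ.push σ).col = fun i => σ.toOrderHom (Γ.col i) :=
  col_ofCol _ _

/-- The map between the simplices of a chain and of its image. -/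
def pushFactor (Γ : MaxChain n r) : SimplexCategory.mk (n + r) ⟶ SimplexCategory.mk (m + r) :=
  factor (Γ.base ≫ σ) Γ.fiber

lemma exists_push_eq (Γ : MaxChain n r) (j : Fin (n + r + 1)) :
    ∃ l, Γ.push σ l = ((Γ.base ≫ σ).toOrderHom j, Γ.fiber.toOrderHom j) := by
  rw [mem_iff, col_push]
  intro i
  have h := (Γ.mem_iff (Γ j).1 (Γ j).2).1 ⟨j, rfl⟩ i
  exact ⟨fun hi => σ.toOrderHom.monotone (h.1 hi), fun hi => σ.toOrderHom.monotone (h.2 hi)⟩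

/-- The map of indices of the pieces of piecewise polynomials underlying `σ`. -/
noncomputable def colMap (j : ℕ) : ℕ := if h : j < n + 1 then (σ.toOrderHom ⟨j, h⟩ : ℕ) else m + 1

variable {σ}

lemma apply_zero_of_surjective (hσ : Function.Surjective σ.toOrderHom) :
    (σ.toOrderHom 0 : ℕ) = 0 := by
  obtain ⟨t, ht⟩ := hσ 0
  have h : σ.toOrderHom 0 ≤ σ.toOrderHom t := σ.toOrderHom.monotone (Fin.zero_le t)
  rw [ht] at h
  exact Nat.le_zero.1 h

lemma apply_last_of_surjective (hσ : Function.Surjective σ.toOrderHom) :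
    (σ.toOrderHom (Fin.last n) : ℕ) = m := by
  obtain ⟨t, ht⟩ := hσ (Fin.last m)
  have h : σ.toOrderHom t ≤ σ.toOrderHom (Fin.last n) := σ.toOrderHom.monotone (Fin.le_last t)
  rw [ht] at h
  exact le_antisymm (Nat.lt_succ_iff.1 (σ.toOrderHom (Fin.last n)).2) h

lemma colMap_zero (hσ : Function.Surjective σ.toOrderHom) : colMap σ 0 = 0 := by
  rw [colMap, dif_pos (Nat.succ_pos n)]
  exact apply_zero_of_surjective hσ

lemma colMap_self (hσ : Function.Surjective σ.toOrderHom) : colMap σ n = m := by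
  rw [colMap, dif_pos (Nat.lt_succ_self n)]
  exact apply_last_of_surjective hσ

/-- A monotone surjection moves by zero or one at each step, and after a jump `κ + 1` is the first
index at which the new value is reached. This is the hypothesis on `s` in `upperInt_piecePull`. -/
lemma colMap_succ (hσ : Function.Surjective σ.toOrderHom) (κ : ℕ) :
    colMap σ (κ + 1) = colMap σ κ ∨ (colMap σ (κ + 1) = colMap σ κ + 1 ∧
      DP.polyX n (κ + 1) = pullbackQ σ.toOrderHom (DP.polyX m (colMap σ κ + 1))) := by
  rcases lt_trichotomy κ n with h | rfl | h
  · have hκ : κ < n + 1 := by omega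
    have hκ' : κ + 1 < n + 1 := by omega
    have e1 : colMap σ κ = σ.toOrderHom ⟨κ, hκ⟩ := dif_pos _
    have e2 : colMap σ (κ + 1) = σ.toOrderHom ⟨κ + 1, hκ'⟩ := dif_pos _
    have hle : (σ.toOrderHom ⟨κ, hκ⟩ : ℕ) ≤ σ.toOrderHom ⟨κ + 1, hκ'⟩ :=
      σ.toOrderHom.monotone (Nat.le_succ κ)
    rcases hle.eq_or_lt with heq | hlt
    · exact Or.inl (by rw [e1, e2, heq])
    · have hb : (σ.toOrderHom ⟨κ + 1, hκ'⟩ : ℕ) < m + 1 :=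
        (σ.toOrderHom ⟨κ + 1, hκ'⟩).2
      obtain ⟨t, ht⟩ := hσ ⟨(σ.toOrderHom ⟨κ, hκ⟩ : ℕ) + 1, by
        change _ < m + 1
        omega⟩
      have ht' := congrArg Fin.val ht
      simp only at ht'
      have ht1 : κ < t := by
        by_contra! hc
        have : (σ.toOrderHom t : ℕ) ≤ σ.toOrderHom ⟨κ, hκ⟩ := σ.toOrderHom.monotone hc
        omega
      have h3 : (σ.toOrderHom ⟨κ + 1, hκ'⟩ : ℕ) ≤ σ.toOrderHom t :=
        σ.toOrderHom.monotone ht1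
      refine Or.inr ⟨by omega, ?_⟩
      have h4 := pullbackQ_polyX σ.toOrderHom.monotone (colMap σ κ + 1)
      refine Eq.trans ?_ h4.symm
      congr 1
      refine (le_antisymm ?_ ?_).symm
      · exact (firstGE_le_iff σ.toOrderHom.monotone _ _).2 fun _ => by
          change colMap σ κ + 1 ≤ (σ.toOrderHom ⟨κ + 1, hκ'⟩ : ℕ)
          omega
      · by_contra! hc
        have h5 : colMap σ κ + 1 ≤ (σ.toOrderHom ⟨κ, hκ⟩ : ℕ) :=
          (firstGE_le_iff σ.toOrderHom.monotone _ κ).1 (Nat.lt_succ_iff.1 hc)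
            (show κ < n + 1 by omega)
        omega
  -- At `κ = n` the default value `m + 1` of `colMap` continues the pattern, and the two variables
  -- beyond the end are both zero.
  · refine Or.inr ⟨?_, ?_⟩
    · rw [colMap_self hσ]
      exact dif_neg (lt_irrefl _)
    · rw [colMap_self hσ, polyX_of_lt (Nat.lt_succ_self _), polyX_of_lt (Nat.lt_succ_self _),
        map_zero]
  · refine Or.inl ?_
    rw [colMap, colMap, dif_neg (by omega), dif_neg (by omega)]

lemma piecePull_single (k : Fin (m + 1)) (p : (MvPolynomial (Fin (m + 1)) ℚ)[X]) :
    piecePull (pullbackQ σ.toOrderHom) (colMap σ) (Pi.single (k : ℕ) p) =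
      ∑ k' ∈ Finset.univ.filter (fun k' : Fin (n + 1) => σ.toOrderHom k' = k),
        Pi.single (k' : ℕ) (p.map (pullbackQ σ.toOrderHom :
          MvPolynomial (Fin (m + 1)) ℚ →+* MvPolynomial (Fin (n + 1)) ℚ)) := by
  funext κ
  rw [piecePull, Finset.sum_apply]
  by_cases hκ : κ < n + 1
  · have e : colMap σ κ = σ.toOrderHom ⟨κ, hκ⟩ := dif_pos hκ
    by_cases hk : σ.toOrderHom ⟨κ, hκ⟩ = k
    · rw [Finset.sum_eq_single_of_mem (⟨κ, hκ⟩ : Fin (n + 1)) (by simpa using hk)]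
      · rw [e, hk]
        simp
      · intro k' _ hk'
        rw [Pi.single_eq_of_ne]
        intro h
        exact hk' (Fin.ext h.symm)
    · rw [Finset.sum_eq_zero, e, Pi.single_eq_of_ne, Polynomial.map_zero]
      · exact fun h => hk (Fin.ext h)
      · intro k' hk'
        rw [Pi.single_eq_of_ne]
        rintro rfl
        exact hk (by simpa using hk')
  · have e : colMap σ κ = m + 1 := dif_neg hκ
    rw [Finset.sum_eq_zero, e, Pi.single_eq_of_ne, Polynomial.map_zero]
    · have := k.2
      omega
    · intro k' _
      rw [Pi.single_eq_of_ne]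
      have := k'.2
      omega

/-- Refining the subdivision does not change the integral (`iterInt_piecePull`). A function carried
by column `k i` becomes a sum of functions carried by the columns above it, and multilinearity
expands the integral over all lifts of the column sequence. -/
lemma pullbackQ_colInt (hσ : Function.Surjective σ.toOrderHom) (k : Fin r → Fin (m + 1))
    (g : Fin r → (MvPolynomial (Fin (m + 1)) ℚ)[X]) :
    pullbackQ σ.toOrderHom (colInt (fun i => k i) g) =
      ∑ κ : Fin r → Fin (n + 1), if (fun i => σ.toOrderHom (κ i)) = k then
        colInt (fun i => κ i) (fun i => (g i).map (pullbackQ σ.toOrderHom :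
          MvPolynomial (Fin (m + 1)) ℚ →+* MvPolynomial (Fin (n + 1)) ℚ)) else 0 := by
  classical
  have h0 : DP.polyX n (n + 1) = pullbackQ σ.toOrderHom (DP.polyX m (m + 1)) := by
    rw [polyX_of_lt (Nat.lt_succ_self _), polyX_of_lt (Nat.lt_succ_self _), map_zero]
  have h1 : DP.polyX n 0 = pullbackQ σ.toOrderHom (DP.polyX m 0) := by
    refine Eq.trans ?_ (pullbackQ_polyX σ.toOrderHom.monotone 0).symm
    congr 1
    exact (Nat.le_zero.1 ((firstGE_le_iff σ.toOrderHom.monotone 0 0).2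
      fun _ => Nat.zero_le _)).symm
  have h2 : pullbackQ σ.toOrderHom (colInt (fun i => k i) g) =
      (piecePull (pullbackQ σ.toOrderHom) (colMap σ) (iterInt (DP.polyX m) r
        (fun i => Pi.single (k i : ℕ) (g i))) n).eval (DP.polyX n (n + 1)) := by
    rw [piecePull, colMap_self hσ, h0]
    exact (Polynomial.eval_map_apply (f := (pullbackQ σ.toOrderHom :
      MvPolynomial (Fin (m + 1)) ℚ →+* MvPolynomial (Fin (n + 1)) ℚ)) _).symm
  rw [h2, ← iterInt_piecePull (colMap_zero hσ) h1 (colMap_succ hσ)]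
  simp only [piecePull_single]
  rw [MultilinearMap.map_sum_finset, Finset.sum_apply, eval_finsetSum, ← Finset.sum_filter]
  refine Finset.sum_congr ?_ fun _ _ => rfl
  ext κ
  simp [Fintype.mem_piFinset, funext_iff]

lemma pullbackQ_pushFactor_prodQ (Γ : MaxChain n r) (a : MvPolynomial (Fin (m + 1)) ℚ)
    (g : Fin r → (MvPolynomial (Fin (m + 1)) ℚ)[X]) :
    pullbackQ (Γ.pushFactor σ).toOrderHom ((Γ.push σ).prodQ a g) =
      Γ.prodQ (pullbackQ σ.toOrderHom a) (fun i => (g i).map (pullbackQ σ.toOrderHom :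
          MvPolynomial (Fin (m + 1)) ℚ →+* MvPolynomial (Fin (n + 1)) ℚ)) := by
  rw [prodQ, map_mul, map_prod, prodQ, baseQ, baseQ, pullbackQ_comp_hom, pullbackQ_comp_hom,
    pushFactor, factor_comp_base (Γ.exists_push_eq σ)]
  congr 1
  refine Finset.prod_congr rfl fun i _ => ?_
  rw [pullbackQ_factor_fiberEval (Γ.exists_push_eq σ), fiberEval, eval₂_map]
  congr 1
  refine RingHom.ext fun b => ?_
  exact (pullbackQ_comp_hom Γ.base σ b).symm

/-- The chains over `Γ` are those whose columns map to the columns of `Γ`, so on a product `prodQ`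
this is `pullbackQ_colInt`; lifts that are not monotone contribute zero. -/
lemma sum_pullbackQ_integrateQ (hσ : Function.Surjective σ.toOrderHom) (Γ : MaxChain m r)
    (F : MvPolynomial (Fin (m + r + 1)) ℚ) :
    (∑ Γ' : MaxChain n r, if Γ'.push σ = Γ then
      pullbackQ Γ'.baseDir (Γ'.integrateQ r (pullbackQ (Γ'.pushFactor σ).toOrderHom F)) else 0) =
      pullbackQ σ.toOrderHom (pullbackQ Γ.baseDir (Γ.integrateQ r F)) := by
  induction F using MvPolynomial.induction_on' with
  | add p q hp hq =>
    simp only [map_add]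
    rw [← hp, ← hq, ← Finset.sum_add_distrib]
    refine Finset.sum_congr rfl fun Γ' _ => ?_
    split_ifs <;> simp
  | monomial N q =>
    obtain ⟨a, g, h⟩ := Γ.exists_prodQ_eq N q
    rw [← h, integrateQ_prodQ, map_mul, pullbackQ_colInt hσ, ← sum_col, Finset.mul_sum]
    · refine Finset.sum_congr rfl fun Γ' _ => ?_
      have hiff : Γ'.push σ = Γ ↔ (fun i => σ.toOrderHom (Γ'.col i)) = Γ.col := by
        rw [← col_injective.eq_iff, col_push]
      by_cases hΓ : Γ'.push σ = Γ
      · rw [if_pos hΓ, if_pos (hiff.1 hΓ)]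
        subst hΓ
        rw [pullbackQ_pushFactor_prodQ, integrateQ_prodQ]
      · rw [if_neg hΓ, if_neg (fun h => hΓ (hiff.2 h)), mul_zero]
    · intro κ hκ
      split_ifs
      · exact colInt_eq_zero (fun hm => hκ hm) _
      · rfl

lemma sum_pullbackFun_integrateFun (hσ : Function.Surjective σ.toOrderHom) (Γ : MaxChain m r)
    (F : DP (m + r)) :
    (∑ Γ' : MaxChain n r, if Γ'.push σ = Γ then
      pullbackFun Γ'.baseDir
        (Γ'.integrateFun r (pullbackFun (Γ'.pushFactor σ).toOrderHom F)) else 0) =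
      pullbackFun σ.toOrderHom (pullbackFun Γ.baseDir (Γ.integrateFun r F)) := by
  apply DP.toPoly_injective
  have h := sum_pullbackQ_integrateQ hσ Γ (DP.toPoly (m + r) F)
  rw [map_sum]
  refine Eq.trans (Finset.sum_congr rfl fun Γ' _ => ?_) (h.trans ?_)
  · split_ifs
    · rw [toPoly_pullbackFun, toPoly_integrateFun]
      congr 2
      exact toPoly_pullbackFun _ _
    · exact map_zero _
  · rw [← toPoly_integrateFun, ← toPoly_pullbackFun]
    exact (toPoly_pullbackFun _ _).symm

end degeneracy

end MaxChain

/-! ### Contraction in exterior algebras -/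

section Exterior

open ExteriorAlgebra

variable {M N : Type*} [AddCommGroup M] [AddCommGroup N]

/-- The grade involution of the exterior algebra. -/
abbrev gradeInv : ExteriorAlgebra ℤ M →ₐ[ℤ] ExteriorAlgebra ℤ M :=
  CliffordAlgebra.involute

/-- The left contraction in the exterior algebra. -/
abbrev contr (d : Module.Dual ℤ M) : ExteriorAlgebra ℤ M →ₗ[ℤ] ExteriorAlgebra ℤ M :=
  CliffordAlgebra.contractLeft d

lemma contr_ι_mul (d : Module.Dual ℤ M) (v : M) (x : ExteriorAlgebra ℤ M) :
    contr d (ι ℤ v * x) = d v • x - ι ℤ v * contr d x :=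
  CliffordAlgebra.contractLeft_ι_mul d v x

/-- Contraction is an odd derivation: passing `x` costs the grade involution. -/
lemma contr_mul (d : Module.Dual ℤ M) (x y : ExteriorAlgebra ℤ M) :
    contr d (x * y) = contr d x * y + gradeInv x * contr d y := by
  induction x using CliffordAlgebra.left_induction with
  | algebraMap r =>
    rw [CliffordAlgebra.contractLeft_algebraMap_mul, CliffordAlgebra.contractLeft_algebraMap,
      zero_mul, zero_add, AlgHom.commutes]
  | add a b ha hb =>
    rw [add_mul, map_add, ha, hb, map_add, map_add, add_mul, add_mul]
    abel
  | ι_mul a v ha =>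
    have h1 := contr_ι_mul d v (a * y)
    have h2 := contr_ι_mul d v a
    have h3 : gradeInv (ι ℤ v * a) = -(ι ℤ v * gradeInv a) := by
      rw [map_mul]
      erw [CliffordAlgebra.involute_ι]
      rw [neg_mul]
    rw [← mul_assoc] at h1
    change contr d (ι ℤ v * a * y) = contr d (ι ℤ v * a) * y + gradeInv (ι ℤ v * a) * contr d y
    rw [h1, h2, h3, ha, sub_mul, smul_mul_assoc]
    noncomm_ring

lemma contr_map (f : M →ₗ[ℤ] N) (d : Module.Dual ℤ N) (x : ExteriorAlgebra ℤ M) :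
    contr d (map f x) = map f (contr (d.comp f) x) := by
  induction x using CliffordAlgebra.left_induction with
  | algebraMap r =>
    rw [AlgHom.commutes, CliffordAlgebra.contractLeft_algebraMap,
      CliffordAlgebra.contractLeft_algebraMap, map_zero]
  | add a b ha hb => rw [map_add, map_add, ha, hb, map_add, map_add]
  | ι_mul a v ha =>
    change contr d (map f (ι ℤ v * a)) = map f (contr (d.comp f) (ι ℤ v * a))
    rw [map_mul, map_apply_ι, contr_ι_mul, contr_ι_mul, ha, map_sub, map_smul, map_mul,
      map_apply_ι, LinearMap.comp_apply]

lemma gradeInv_map (f : M →ₗ[ℤ] N) (x : ExteriorAlgebra ℤ M) :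
    gradeInv (map f x) = map f (gradeInv x) := by
  have h : (gradeInv.comp (map f) : ExteriorAlgebra ℤ M →ₐ[ℤ] ExteriorAlgebra ℤ N) =
      (map f).comp gradeInv := by
    refine ExteriorAlgebra.hom_ext (LinearMap.ext fun v => ?_)
    change gradeInv (map f (ι ℤ v)) = map f (gradeInv (ι ℤ v))
    have h1 : gradeInv (ι ℤ v) = -ι ℤ v := CliffordAlgebra.involute_ι v
    have h2 : gradeInv (ι ℤ (f v)) = -ι ℤ (f v) := CliffordAlgebra.involute_ι (f v)
    rw [h1, map_neg, map_apply_ι, h2]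
  exact DFunLike.congr_fun h x

lemma gradeInv_ι (v : M) : gradeInv (ι ℤ v) = -ι ℤ v := CliffordAlgebra.involute_ι v

lemma ι_mul_eq_gradeInv_mul (v : M) (x : ExteriorAlgebra ℤ M) :
    ι ℤ v * x = gradeInv x * ι ℤ v := by
  induction x using CliffordAlgebra.left_induction with
  | algebraMap r => rw [AlgHom.commutes, Algebra.commutes]
  | add a b ha hb => rw [mul_add, map_add, add_mul, ha, hb]
  | ι_mul a w ha =>
    change ι ℤ v * (ι ℤ w * a) = gradeInv (ι ℤ w * a) * ι ℤ v
    rw [map_mul, gradeInv_ι, mul_assoc, ← ha, ← mul_assoc, neg_mul, ← mul_assoc,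
      eq_neg_of_add_eq_zero_left (ι_add_mul_swap v w), neg_mul]

lemma gradeInv_of_mem {k : ℕ} {x : ExteriorAlgebra ℤ M} (hx : x ∈ ⋀[ℤ]^k M) :
    gradeInv x = (k : ℤ).negOnePow • x := by
  induction k generalizing x with
  | zero =>
    rw [exteriorPower, pow_zero] at hx
    obtain ⟨r, rfl⟩ := Submodule.mem_one.1 hx
    rw [AlgHom.commutes]
    simp
  | succ k ih =>
    rw [exteriorPower, pow_succ'] at hx
    induction hx using Submodule.mul_induction_on' with
    | mem_mul_mem a ha b hb =>
      obtain ⟨v, rfl⟩ := ha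
      rw [map_mul, gradeInv_ι, ih hb, Nat.cast_succ, Int.negOnePow_succ, mul_smul_comm, neg_mul,
        smul_neg, Units.neg_smul]
    | add a _ b _ ha hb => rw [map_add, ha, hb, smul_add]

lemma mul_eq_negOnePow_smul_mul {k l : ℕ} {x y : ExteriorAlgebra ℤ M} (hx : x ∈ ⋀[ℤ]^k M)
    (hy : y ∈ ⋀[ℤ]^l M) : x * y = ((k : ℤ) * l).negOnePow • (y * x) := by
  induction k generalizing x with
  | zero =>
    rw [exteriorPower, pow_zero] at hx
    obtain ⟨r, rfl⟩ := Submodule.mem_one.1 hx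
    rw [Algebra.commutes]
    simp
  | succ k ih =>
    rw [exteriorPower, pow_succ'] at hx
    induction hx using Submodule.mul_induction_on' with
    | mem_mul_mem a ha b hb =>
      obtain ⟨v, rfl⟩ := ha
      rw [mul_assoc, ih hb, mul_smul_comm, ← mul_assoc, ι_mul_eq_gradeInv_mul, gradeInv_of_mem hy,
        smul_mul_assoc, smul_mul_assoc, smul_smul, ← Int.negOnePow_add, mul_assoc]
      congr 2
      push_cast
      ring
    | add a _ b _ ha hb => rw [add_mul, ha, hb, mul_add, smul_add]

lemma contr_mem {k : ℕ} (d : Module.Dual ℤ M) {x : ExteriorAlgebra ℤ M}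
    (hx : x ∈ ⋀[ℤ]^(k + 1) M) : contr d x ∈ ⋀[ℤ]^k M := by
  induction k generalizing x with
  | zero =>
    rw [exteriorPower, zero_add, pow_one] at hx
    obtain ⟨v, rfl⟩ := hx
    have h : contr d (ι ℤ v) = algebraMap ℤ _ (d v) := CliffordAlgebra.contractLeft_ι _ d v
    rw [h, exteriorPower, pow_zero]
    exact Submodule.algebraMap_mem _
  | succ k ih =>
    rw [exteriorPower, pow_succ'] at hx
    induction hx using Submodule.mul_induction_on' with
    | mem_mul_mem a ha b hb =>
      obtain ⟨v, rfl⟩ := ha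
      rw [contr_ι_mul]
      refine sub_mem (Submodule.smul_mem _ _ hb) ?_
      rw [exteriorPower, pow_succ']
      exact Submodule.mul_mem_mul ⟨v, rfl⟩ (ih hb)
    | add a _ b _ ha hb => rw [map_add]; exact add_mem ha hb

lemma contr_of_mem_zero (d : Module.Dual ℤ M) {x : ExteriorAlgebra ℤ M}
    (hx : x ∈ ⋀[ℤ]^0 M) : contr d x = 0 := by
  rw [exteriorPower, pow_zero] at hx
  obtain ⟨r, rfl⟩ := Submodule.mem_one.1 hx
  exact CliffordAlgebra.contractLeft_algebraMap _ d r

lemma map_mem_exteriorPower {k : ℕ} (f : M →ₗ[ℤ] N) {x : ExteriorAlgebra ℤ M}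
    (hx : x ∈ ⋀[ℤ]^k M) : map f x ∈ ⋀[ℤ]^k N := by
  have h : (⋀[ℤ]^k M).map (map f).toLinearMap ≤ ⋀[ℤ]^k N := by
    rw [exteriorPower, Submodule.map_pow, exteriorPower]
    gcongr
    rintro _ ⟨_, ⟨v, rfl⟩, rfl⟩
    exact ⟨f v, (map_apply_ι f v).symm⟩
  exact h ⟨x, hx, rfl⟩

lemma contr_eq_zero_of_mem_adjoin {G : Set M} {d : Module.Dual ℤ M} (hd : ∀ g ∈ G, d g = 0)
    {x : ExteriorAlgebra ℤ M} (hx : x ∈ Algebra.adjoin ℤ (ι ℤ '' G)) : contr d x = 0 := by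
  induction hx using Algebra.adjoin_induction with
  | mem x hx =>
    obtain ⟨g, hg, rfl⟩ := hx
    have h : contr d (ι ℤ g) = algebraMap ℤ _ (d g) := CliffordAlgebra.contractLeft_ι _ d g
    rw [h, hd g hg, map_zero]
  | algebraMap r => exact CliffordAlgebra.contractLeft_algebraMap _ d r
  | add x y _ _ hx hy => rw [map_add, hx, hy, add_zero]
  | mul x y _ _ hx hy => rw [contr_mul, hx, hy, zero_mul, mul_zero, add_zero]

lemma gradeInv_mem_adjoin {G : Set M} {x : ExteriorAlgebra ℤ M}
    (hx : x ∈ Algebra.adjoin ℤ (ι ℤ '' G)) : gradeInv x ∈ Algebra.adjoin ℤ (ι ℤ '' G) := by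
  induction hx using Algebra.adjoin_induction with
  | mem x hx =>
    obtain ⟨g, hg, rfl⟩ := hx
    rw [gradeInv_ι]
    exact neg_mem (Algebra.subset_adjoin ⟨g, hg, rfl⟩)
  | algebraMap r => rw [AlgHom.commutes]; exact algebraMap_mem _ r
  | add x y _ _ hx hy => rw [map_add]; exact add_mem hx hy
  | mul x y _ _ hx hy => rw [map_mul]; exact mul_mem hx hy

/-- A vector passes any element up to the grade involution and has square zero, so `v` can be
collected at the front and occurs there at most once. -/
lemma exists_add_ι_mul_of_mem_adjoin_insert {G : Set M} (v : M) {x : ExteriorAlgebra ℤ M}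
    (hx : x ∈ Algebra.adjoin ℤ (ι ℤ '' (insert v G))) :
    ∃ a ∈ Algebra.adjoin ℤ (ι ℤ '' G), ∃ b ∈ Algebra.adjoin ℤ (ι ℤ '' G),
      x = a + ι ℤ v * b := by
  induction hx using Algebra.adjoin_induction with
  | mem x hx =>
    obtain ⟨g, rfl | hg, rfl⟩ := hx
    · exact ⟨0, zero_mem _, 1, one_mem _, by simp⟩
    · exact ⟨_, Algebra.subset_adjoin ⟨g, hg, rfl⟩, 0, zero_mem _, by simp⟩
  | algebraMap r => exact ⟨_, algebraMap_mem _ r, 0, zero_mem _, by simp⟩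
  | add x y _ _ hx hy =>
    obtain ⟨a, ha, b, hb, rfl⟩ := hx
    obtain ⟨a', ha', b', hb', rfl⟩ := hy
    exact ⟨_, add_mem ha ha', _, add_mem hb hb', by rw [mul_add]; abel⟩
  | mul x y _ _ hx hy =>
    obtain ⟨a, ha, b, hb, rfl⟩ := hx
    obtain ⟨a', ha', b', hb', rfl⟩ := hy
    refine ⟨_, mul_mem ha ha', _, add_mem (mul_mem hb ha') (mul_mem (gradeInv_mem_adjoin ha) hb'),
      ?_⟩
    have h1 : a * ι ℤ v = ι ℤ v * gradeInv a := by
      have := ι_mul_eq_gradeInv_mul v (gradeInv a)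
      rwa [CliffordAlgebra.involute_involute, eq_comm] at this
    have h2 : ι ℤ v * b * (ι ℤ v * b') = 0 := by
      rw [mul_assoc, ← mul_assoc b]
      have := ι_mul_eq_gradeInv_mul v (gradeInv b)
      rw [CliffordAlgebra.involute_involute] at this
      rw [← this, mul_assoc, ← mul_assoc, ι_sq_zero, zero_mul]
    have h3 : a * (ι ℤ v * b') = ι ℤ v * (gradeInv a * b') := by
      rw [← mul_assoc, h1, mul_assoc]
    rw [add_mul, mul_add, mul_add, h2, h3, add_zero, mul_add, mul_assoc (ι ℤ v) b a']
    abel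

lemma contr_add_ι_mul {G : Set M} {v : M} {d : Module.Dual ℤ M} (hd : ∀ g ∈ G, d g = 0)
    (hv : d v = 1) {a b : ExteriorAlgebra ℤ M} (ha : a ∈ Algebra.adjoin ℤ (ι ℤ '' G))
    (hb : b ∈ Algebra.adjoin ℤ (ι ℤ '' G)) : contr d (a + ι ℤ v * b) = b := by
  rw [map_add, contr_eq_zero_of_mem_adjoin hd ha, contr_ι_mul, hv, one_smul,
    contr_eq_zero_of_mem_adjoin hd hb, mul_zero, sub_zero, zero_add]

lemma contr_prod_ofFn_eq_zero (d : Module.Dual ℤ M) {r : ℕ} (w : Fin r → ExteriorAlgebra ℤ M)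
    (hw : ∀ i, contr d (w i) = 0) : contr d (List.ofFn w).prod = 0 := by
  induction r with
  | zero => simp
  | succ r ih =>
    rw [List.ofFn_succ, List.prod_cons, contr_mul, hw, ih _ fun i => hw _, zero_mul, mul_zero,
      add_zero]

/-- By the graded Leibniz rule only the term in which `d` meets the factor `w p` survives; the sign
comes from the factors before it. -/
lemma contr_prod_ofFn (d : Module.Dual ℤ M) {r : ℕ} (w : Fin r → ExteriorAlgebra ℤ M) (p : Fin r)
    (hw : ∀ i, i ≠ p → contr d (w i) = 0) (e : Fin r → ℤ)
    (he : ∀ i, i < p → gradeInv (w i) = (e i).negOnePow • w i) :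
    contr d (List.ofFn w).prod =
      (∑ i ∈ Finset.univ.filter (· < p), e i).negOnePow •
        (List.ofFn (Function.update w p (contr d (w p)))).prod := by
  induction r with
  | zero => exact p.elim0
  | succ r ih =>
    rw [List.ofFn_succ, List.prod_cons, contr_mul]
    induction p using Fin.cases with
    | zero =>
      rw [contr_prod_ofFn_eq_zero d (fun i => w i.succ) (fun i => hw _ (Fin.succ_ne_zero i)),
        mul_zero, add_zero, Finset.filter_false_of_mem (by simp), Finset.sum_empty,
        Int.negOnePow_zero, one_smul, List.ofFn_succ, List.prod_cons, Function.update_self]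
      rfl
    | succ p =>
      rw [hw 0 (Fin.succ_ne_zero p).symm, zero_mul, zero_add, he 0 (Fin.succ_pos p),
        ih (fun i => w i.succ) p (fun i hi => hw _ (fun h => hi (Fin.succ_injective _ h)))
          (fun i => e i.succ) (fun i hi => he _ (Fin.succ_lt_succ_iff.2 hi)),
        smul_mul_assoc, mul_smul_comm, smul_smul, ← Int.negOnePow_add, List.ofFn_succ,
        List.prod_cons, Function.update_of_ne (Fin.succ_ne_zero p).symm]
      congr 2
      · rw [Finset.sum_filter, Finset.sum_filter, Fin.sum_univ_succ (n := r), if_pos (Fin.succ_pos p)]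
        simp only [Fin.succ_lt_succ_iff]
      · congr 2
        funext i
        by_cases h : i = p
        · subst h; simp
        · rw [Function.update_of_ne h, Function.update_of_ne fun h' => h (Fin.succ_injective _ h')]

end Exterior

/-! ### Contraction along the fiber directions of a chain -/

lemma dxDual_dx {N : ℕ} (j : Fin (N + 1)) (hj : 1 ≤ (j : ℕ)) (l : ℕ) :
    dxDual N j (dx N l) = if l = j then 1 else 0 := by
  induction j using Fin.cases with
  | zero => exact absurd hj (by simp)
  | succ k =>
    change (if (k : ℕ) + 1 = l then (1 : ℤ) else 0) = if l = (k.succ : ℕ) then 1 else 0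
    simp only [Fin.val_succ, eq_comm]

lemma dual_ext_dx {N : ℕ} {d d' : Module.Dual ℤ (Fin N → ℤ)}
    (h : ∀ l, 1 ≤ l → l ≤ N → d (dx N l) = d' (dx N l)) : d = d' := by
  refine LinearMap.pi_ext' fun k => LinearMap.ext_ring ?_
  change d (Pi.single k 1) = d' (Pi.single k 1)
  rw [← dx_succ]
  exact h _ (by omega) (by omega)

lemma map_units_smul {A B F : Type*} [AddCommGroup A] [AddCommGroup B] [FunLike F A B]
    [AddMonoidHomClass F A B] (f : F) (e : ℤˣ) (x : A) : f (e • x) = e • f x := by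
  rw [Units.smul_def, Units.smul_def, map_zsmul]

namespace MaxChain

open ExteriorAlgebra

variable {n m r : ℕ} (Γ : MaxChain n r)

/-- The pullback of constant forms from the base to the simplex of the chain. -/
noncomputable abbrev baseE :
    ExteriorAlgebra ℤ (Fin n → ℤ) →ₐ[ℤ] ExteriorAlgebra ℤ (Fin (n + r) → ℤ) :=
  ExteriorAlgebra.map (dxMap Γ.base.toOrderHom)

lemma dxMap_base_dx (l : ℕ) : dxMap Γ.base.toOrderHom (dx n l) = dx (n + r) (Γ.bIdx l) :=
  dxMap_dx Γ.base.toOrderHom.monotone l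

lemma one_le_fiberDir {i : ℕ} (h1 : 1 ≤ i) (hi : i ≤ r) : 1 ≤ (Γ.fiberDir i : ℕ) := by
  rw [Γ.fiberDir_eq hi, Γ.fIdx_eq (by omega)]
  omega

lemma dxDual_comp_dxMap_base {i : ℕ} (h1 : 1 ≤ i) (hi : i ≤ r) :
    (dxDual (n + r) (Γ.fiberDir i)).comp (dxMap Γ.base.toOrderHom) = 0 := by
  refine dual_ext_dx fun l _ hl => ?_
  rw [LinearMap.comp_apply, dxMap_base_dx, dxDual_dx _ (Γ.one_le_fiberDir h1 hi),
    Γ.fiberDir_eq hi, if_neg (Γ.bIdx_ne_fIdx hl h1 hi), LinearMap.zero_apply]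

lemma contr_baseE {i : ℕ} (h1 : 1 ≤ i) (hi : i ≤ r) (x : ExteriorAlgebra ℤ (Fin n → ℤ)) :
    contr (dxDual (n + r) (Γ.fiberDir i)) (Γ.baseE x) = 0 := by
  rw [contr_map, Γ.dxDual_comp_dxMap_base h1 hi]
  simp

/-- The coordinate differentials other than the first `j` fiber differentials. -/
def gens (j : ℕ) : Set (Fin (n + r) → ℤ) :=
  {v | ∃ l, 1 ≤ l ∧ l ≤ n + r ∧ (∀ i, 1 ≤ i → i ≤ j → l ≠ Γ.fIdx i) ∧ v = dx (n + r) l}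

lemma adjoin_gens_zero : Algebra.adjoin ℤ (ι ℤ '' Γ.gens 0) = ⊤ := by
  refine top_le_iff.1 ?_
  have h : Algebra.adjoin ℤ (Set.range (ι ℤ : (Fin (n + r) → ℤ) → _)) = ⊤ :=
    CliffordAlgebra.adjoin_range_ι
  rw [← h]
  refine Algebra.adjoin_le ?_
  rintro _ ⟨v, rfl⟩
  have hv : v = ∑ k, v k • dx (n + r) ((k : ℕ) + 1) := by
    conv_lhs => rw [pi_eq_sum_univ' v]
    simp only [dx_succ]
  rw [hv, map_sum]
  refine sum_mem fun k _ => ?_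
  rw [map_smul]
  have hk : dx (n + r) ((k : ℕ) + 1) ∈ Γ.gens 0 :=
    ⟨(k : ℕ) + 1, by omega, by omega, fun i h1 h2 => by omega, rfl⟩
  exact Subalgebra.smul_mem _ (Algebra.subset_adjoin (Set.mem_image_of_mem _ hk)) _

lemma gens_subset (j : ℕ) :
    Γ.gens j ⊆ insert (dx (n + r) (Γ.fIdx (j + 1))) (Γ.gens (j + 1)) := by
  rintro _ ⟨l, h1, h2, h3, rfl⟩
  by_cases h : l = Γ.fIdx (j + 1)
  · exact Or.inl (by rw [h])
  · refine Or.inr ⟨l, h1, h2, fun i hi1 hi2 => ?_, rfl⟩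
    rcases hi2.lt_or_eq with hi2 | rfl
    · exact h3 i hi1 (by omega)
    · exact h

lemma dxDual_gens {i j : ℕ} (h1 : 1 ≤ i) (hij : i ≤ j) (hi : i ≤ r) :
    ∀ g ∈ Γ.gens j, dxDual (n + r) (Γ.fiberDir i) g = 0 := by
  rintro _ ⟨l, -, -, h3, rfl⟩
  rw [dxDual_dx _ (Γ.one_le_fiberDir h1 hi), Γ.fiberDir_eq hi, if_neg (h3 i h1 hij)]

lemma dxDual_fiberDir_self {i : ℕ} (h1 : 1 ≤ i) (hi : i ≤ r) :
    dxDual (n + r) (Γ.fiberDir i) (dx (n + r) (Γ.fIdx i)) = 1 := by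
  rw [dxDual_dx _ (Γ.one_le_fiberDir h1 hi), Γ.fiberDir_eq hi, if_pos rfl]

lemma exists_baseE_of_mem_adjoin {x : ExteriorAlgebra ℤ (Fin (n + r) → ℤ)}
    (hx : x ∈ Algebra.adjoin ℤ (ι ℤ '' Γ.gens r)) : ∃ y, Γ.baseE y = x := by
  have h : Algebra.adjoin ℤ (ι ℤ '' Γ.gens r) ≤ Γ.baseE.range := by
    refine Algebra.adjoin_le ?_
    rintro _ ⟨_, ⟨l, h1, h2, h3, rfl⟩, rfl⟩
    rcases Γ.exists_eq_bIdx_or_fIdx (j := l) (by omega) with ⟨t, -, rfl⟩ | ⟨i, hi1, hi2, rfl⟩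
    · exact ⟨ι ℤ (dx n t), by
        change Γ.baseE _ = _
        rw [map_apply_ι, dxMap_base_dx]⟩
    · exact absurd rfl (h3 i hi1 hi2)
  exact h hx

lemma contract_succ (k : ℕ) (x : ExteriorAlgebra ℤ (Fin (n + r) → ℤ)) :
    Γ.contract (k + 1) x = contr (dxDual (n + r) (Γ.fiberDir (k + 1))) (Γ.contract k x) := rfl

/-- Each contraction is applied to some `a + v * b`, with `v` the fiber differential and `a`, `b`
free of it, and returns `b`. After `r` contractions only base differentials are left. -/
lemma contract_mem_adjoin (x : ExteriorAlgebra ℤ (Fin (n + r) → ℤ)) (k : ℕ) (hk : k ≤ r) :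
    Γ.contract k x ∈ Algebra.adjoin ℤ (ι ℤ '' Γ.gens k) := by
  induction k with
  | zero => rw [adjoin_gens_zero]; exact Algebra.mem_top
  | succ k ih =>
    obtain ⟨a, ha, b, hb, h⟩ := exists_add_ι_mul_of_mem_adjoin_insert
      (dx (n + r) (Γ.fIdx (k + 1)))
      (Algebra.adjoin_mono (Set.image_mono (Γ.gens_subset k)) (ih (by omega)))
    rw [contract_succ, h, contr_add_ι_mul (Γ.dxDual_gens (by omega) le_rfl hk)
      (Γ.dxDual_fiberDir_self (by omega) hk) ha hb]
    exact hb

lemma exists_baseE_eq_contract (x : ExteriorAlgebra ℤ (Fin (n + r) → ℤ)) :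
    ∃ y, Γ.baseE y = Γ.contract r x :=
  Γ.exists_baseE_of_mem_adjoin (Γ.contract_mem_adjoin x r le_rfl)

lemma exists_baseE_add (Γ : MaxChain n 1) (x : ExteriorAlgebra ℤ (Fin (n + 1) → ℤ)) :
    ∃ a b, x = Γ.baseE a + ι ℤ (dx (n + 1) (Γ.fIdx 1)) * Γ.baseE b := by
  have hx : x ∈ Algebra.adjoin ℤ (ι ℤ '' Γ.gens 0) := by
    rw [adjoin_gens_zero]; exact Algebra.mem_top
  obtain ⟨a, ha, b, hb, h⟩ := exists_add_ι_mul_of_mem_adjoin_insert _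
    (Algebra.adjoin_mono (Set.image_mono (Γ.gens_subset 0)) hx)
  obtain ⟨a', rfl⟩ := Γ.exists_baseE_of_mem_adjoin ha
  obtain ⟨b', rfl⟩ := Γ.exists_baseE_of_mem_adjoin hb
  exact ⟨a', b', h⟩

/-- The pullback of constant forms along the base directions. -/
noncomputable abbrev baseDirE :
    ExteriorAlgebra ℤ (Fin (n + r) → ℤ) →ₐ[ℤ] ExteriorAlgebra ℤ (Fin n → ℤ) :=
  ExteriorAlgebra.map (dxMap Γ.baseDir)

lemma map_map_dxMap {a b c : ℕ} {α : Fin (a + 1) → Fin (b + 1)} {β : Fin (b + 1) → Fin (c + 1)}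
    (hα : Monotone α) (hβ : Monotone β) (x : ExteriorAlgebra ℤ (Fin c → ℤ)) :
    ExteriorAlgebra.map (dxMap α) (ExteriorAlgebra.map (dxMap β) x) =
      ExteriorAlgebra.map (dxMap (β ∘ α)) x := by
  rw [dxMap_comp hα hβ, ← ExteriorAlgebra.map_comp_map]
  rfl

lemma map_map_dxMap_hom {a b c : ℕ} (f : SimplexCategory.mk a ⟶ SimplexCategory.mk b)
    (g : SimplexCategory.mk b ⟶ SimplexCategory.mk c) (x : ExteriorAlgebra ℤ (Fin c → ℤ)) :
    ExteriorAlgebra.map (dxMap f.toOrderHom) (ExteriorAlgebra.map (dxMap g.toOrderHom) x) =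
      ExteriorAlgebra.map (dxMap (f ≫ g).toOrderHom) x :=
  map_map_dxMap f.toOrderHom.monotone g.toOrderHom.monotone x

lemma baseDirE_baseE (x : ExteriorAlgebra ℤ (Fin n → ℤ)) : Γ.baseDirE (Γ.baseE x) = x := by
  have h := map_map_dxMap Γ.baseDir_monotone Γ.base.toOrderHom.monotone x
  rw [base_comp_baseDir, dxMap_id, ExteriorAlgebra.map_id] at h
  exact h

/-- The next fiber differential occurs only in the factor of index `k`, behind `k` factors already
reduced to their `b i`. Passing these costs the sum of `e i` over `i < k`. -/
lemma contract_prod_partial (a b : Fin r → ExteriorAlgebra ℤ (Fin n → ℤ)) (e : Fin r → ℤ)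
    (he : ∀ i, gradeInv (b i) = (e i).negOnePow • b i) (k : ℕ) (hk : k ≤ r) :
    Γ.contract k (List.ofFn fun i : Fin r =>
      Γ.baseE (a i) + ι ℤ (dx (n + r) (Γ.fIdx (i + 1))) * Γ.baseE (b i)).prod =
    (∑ l ∈ Finset.range k, ∑ i ∈ Finset.univ.filter (fun i : Fin r => (i : ℕ) < l), e i).negOnePow •
      (List.ofFn fun i : Fin r => if (i : ℕ) < k then Γ.baseE (b i) else
        Γ.baseE (a i) + ι ℤ (dx (n + r) (Γ.fIdx (i + 1))) * Γ.baseE (b i)).prod := by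
  induction k with
  | zero => simp [contract]
  | succ k ih =>
    have hcontr : ∀ i : Fin r, contr (dxDual (n + r) (Γ.fiberDir (k + 1)))
        (Γ.baseE (a i) + ι ℤ (dx (n + r) (Γ.fIdx (i + 1))) * Γ.baseE (b i)) =
        if (i : ℕ) = k then Γ.baseE (b i) else 0 := by
      intro i
      rw [map_add, contr_ι_mul, Γ.contr_baseE (by omega) hk, Γ.contr_baseE (by omega) hk,
        dxDual_dx _ (Γ.one_le_fiberDir (by omega) hk), Γ.fiberDir_eq hk, mul_zero, sub_zero,
        zero_add]
      by_cases h : (i : ℕ) = k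
      · rw [if_pos h, h, if_pos rfl, one_smul]
      · rw [if_neg h, if_neg, zero_smul]
        intro h'
        rcases Nat.lt_or_gt_of_ne h with h1 | h1
        · have := Γ.fIdx_strictMono (i := i + 1) (j := k + 1) (by omega) (by omega)
          omega
        · have := Γ.fIdx_strictMono (i := k + 1) (j := i + 1) (by omega) (by omega)
          omega
    rw [contract_succ, ih (by omega), map_units_smul, contr_prod_ofFn _ _ ⟨k, hk⟩ _ e,
      smul_smul, ← Int.negOnePow_add, Finset.sum_range_succ]
    · congr 2
      congr 1
      funext i
      by_cases h : i = ⟨k, hk⟩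
      · subst h
        rw [Function.update_self, if_neg (lt_irrefl _), hcontr, if_pos rfl,
          if_pos (Nat.lt_succ_self _)]
      · have h' : (i : ℕ) ≠ k := fun h' => h (Fin.ext h')
        rw [Function.update_of_ne h]
        by_cases h1 : (i : ℕ) < k
        · rw [if_pos h1, if_pos (by omega)]
        · rw [if_neg h1, if_neg (by omega)]
    · intro i hi
      rw [if_pos (show (i : ℕ) < k from hi), gradeInv_map, he]
      exact map_units_smul _ _ _
    · intro i hi
      have h' : (i : ℕ) ≠ k := fun h' => hi (Fin.ext h')
      split_ifs
      · exact Γ.contr_baseE (by omega) hk _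
      · rw [hcontr, if_neg h']

/-- In the double sum, `e i` occurs once for every `l` with `i < l < r`. -/
lemma sum_sum_lt_eq (e : Fin r → ℤ) :
    ∑ l ∈ Finset.range r, ∑ i ∈ Finset.univ.filter (fun i : Fin r => (i : ℕ) < l), e i =
      ∑ i : Fin r, ((r : ℤ) - 1 - (i : ℕ)) * e i := by
  simp only [Finset.sum_filter]
  rw [Finset.sum_comm]
  refine Finset.sum_congr rfl fun i _ => ?_
  rw [← Finset.sum_filter, Finset.sum_const, nsmul_eq_mul]
  congr 1
  have h : (Finset.range r).filter (fun l => (i : ℕ) < l) = Finset.Ioo (i : ℕ) r := by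
    ext l
    simp [and_comm]
  rw [h, Nat.card_Ioo]
  have := i.2
  omega

lemma contract_prod (a b : Fin r → ExteriorAlgebra ℤ (Fin n → ℤ)) (e : Fin r → ℤ)
    (he : ∀ i, gradeInv (b i) = (e i).negOnePow • b i) :
    Γ.contract r (List.ofFn fun i : Fin r =>
      Γ.baseE (a i) + ι ℤ (dx (n + r) (Γ.fIdx (i + 1))) * Γ.baseE (b i)).prod =
    normSign e • (List.ofFn fun i : Fin r => Γ.baseE (b i)).prod := by
  rw [Γ.contract_prod_partial a b e he r le_rfl, sum_sum_lt_eq, normSign]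
  congr 3
  funext i
  rw [if_pos i.2]

/-! ### The fiber part of a form on the prism -/

/-- The fiber part of a constant form on the simplex of the chain with fiber step in column
`κ`. -/
noncomputable def fiberPart (κ : Fin (n + 1)) (x : ExteriorAlgebra ℤ (Fin (n + 1) → ℤ)) :
    ExteriorAlgebra ℤ (Fin n → ℤ) :=
  (colChain κ).baseDirE ((colChain κ).contract 1 x)

lemma fiberPart_baseE_add (κ : Fin (n + 1)) (a b : ExteriorAlgebra ℤ (Fin n → ℤ)) :
    fiberPart κ ((colChain κ).baseE a +
      ι ℤ (dx (n + 1) ((colChain κ).fIdx 1)) * (colChain κ).baseE b) = b := by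
  have h : (colChain κ).contract 1 ((colChain κ).baseE a +
      ι ℤ (dx (n + 1) ((colChain κ).fIdx 1)) * (colChain κ).baseE b) = (colChain κ).baseE b := by
    change contr _ _ = _
    rw [map_add, contr_ι_mul, contr_baseE _ le_rfl le_rfl, contr_baseE _ le_rfl le_rfl,
      dxDual_fiberDir_self _ le_rfl le_rfl, one_smul, mul_zero, sub_zero, zero_add]
  rw [fiberPart, h, baseDirE_baseE]

lemma fiberPart_mem (κ : Fin (n + 1)) {k : ℕ} {x : ExteriorAlgebra ℤ (Fin (n + 1) → ℤ)}
    (hx : x ∈ ⋀[ℤ]^(k + 1) (Fin (n + 1) → ℤ)) : fiberPart κ x ∈ ⋀[ℤ]^k (Fin n → ℤ) :=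
  map_mem_exteriorPower _ (contr_mem _ hx)

lemma fiberPart_of_mem_zero (κ : Fin (n + 1)) {x : ExteriorAlgebra ℤ (Fin (n + 1) → ℤ)}
    (hx : x ∈ ⋀[ℤ]^0 (Fin (n + 1) → ℤ)) : fiberPart κ x = 0 := by
  have h : (colChain κ).contract 1 x = 0 := contr_of_mem_zero _ hx
  rw [fiberPart, h, map_zero]

lemma map_stepFactor (i : Fin r) (a b : ExteriorAlgebra ℤ (Fin n → ℤ)) :
    ExteriorAlgebra.map (dxMap (Γ.stepFactor i).toOrderHom)
      ((colChain (Γ.col i)).baseE a +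
        ι ℤ (dx (n + 1) ((colChain (Γ.col i)).fIdx 1)) * (colChain (Γ.col i)).baseE b) =
      Γ.baseE a + ι ℤ (dx (n + r) (Γ.fIdx (i + 1))) * Γ.baseE b := by
  have hb : ∀ c, ExteriorAlgebra.map (dxMap (Γ.stepFactor i).toOrderHom)
      ((colChain (Γ.col i)).baseE c) = Γ.baseE c := by
    intro c
    have h := map_map_dxMap_hom (Γ.stepFactor i) (colChain (Γ.col i)).base c
    rw [stepFactor, factor_comp_base (Γ.exists_colChain_eq i)] at h
    exact h
  have hf : dxMap (Γ.stepFactor i).toOrderHom (dx (n + 1) ((colChain (Γ.col i)).fIdx 1)) =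
      dx (n + r) (Γ.fIdx (i + 1)) := by
    refine (dxMap_dx (Γ.stepFactor i).toOrderHom.monotone _).trans ?_
    congr 1
    rw [fIdx, ← firstGE_comp_hom, stepFactor, factor_comp_fiber (Γ.exists_colChain_eq i),
      firstGE_stepMap]
  rw [map_add, map_mul, hb, hb, map_apply_ι, hf]

/-- Pullback along `stepFactor i` carries base forms to base forms and the fiber differential of the
prism to the matching one of `Γ`, so `contract_prod` applies and only the fiber parts survive. -/
lemma baseDirE_contract_prod (x : Fin r → ExteriorAlgebra ℤ (Fin (n + 1) → ℤ)) (e : Fin r → ℤ)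
    (he : ∀ i, gradeInv (fiberPart (Γ.col i) (x i)) =
      (e i).negOnePow • fiberPart (Γ.col i) (x i)) :
    Γ.baseDirE (Γ.contract r (List.ofFn fun i : Fin r =>
      ExteriorAlgebra.map (dxMap (Γ.stepFactor i).toOrderHom) (x i)).prod) =
    normSign e • (List.ofFn fun i : Fin r => fiberPart (Γ.col i) (x i)).prod := by
  choose a b hab using fun i => (colChain (Γ.col i)).exists_baseE_add (x i)
  have hb : ∀ i, fiberPart (Γ.col i) (x i) = b i := fun i => by
    rw [hab, fiberPart_baseE_add]
  simp only [hb] at he ⊢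
  have hx : ∀ i, ExteriorAlgebra.map (dxMap (Γ.stepFactor i).toOrderHom) (x i) =
      Γ.baseE (a i) + ι ℤ (dx (n + r) (Γ.fIdx (i + 1))) * Γ.baseE (b i) := fun i => by
    rw [hab, map_stepFactor]
  have h1 : (List.ofFn fun i : Fin r =>
      ExteriorAlgebra.map (dxMap (Γ.stepFactor i).toOrderHom) (x i)) =
      List.ofFn fun i => Γ.baseE (a i) + ι ℤ (dx (n + r) (Γ.fIdx (i + 1))) * Γ.baseE (b i) :=
    congrArg List.ofFn (funext hx)
  rw [h1, Γ.contract_prod a b e he, map_units_smul, map_list_prod, List.map_ofFn]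
  congr 3
  funext i
  exact Γ.baseDirE_baseE (b i)

section degeneracy

variable {σ : SimplexCategory.mk n ⟶ SimplexCategory.mk m} (Γ : MaxChain n r)

/-- The map `pushFactor` does not change the fiber coordinate, so corresponding fiber directions are
matched, and no base direction is pulled back to a fiber direction. -/
lemma dxDual_comp_dxMap_pushFactor {i : ℕ} (h1 : 1 ≤ i) (hi : i ≤ r) :
    (dxDual (n + r) (Γ.fiberDir i)).comp (dxMap (Γ.pushFactor σ).toOrderHom) =
      dxDual (m + r) ((Γ.push σ).fiberDir i) := by
  refine dual_ext_dx fun l _ hl => ?_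
  rw [LinearMap.comp_apply]
  have h := dxMap_dx (Γ.pushFactor σ).toOrderHom.monotone l
  refine (congrArg (dxDual (n + r) (Γ.fiberDir i)) h).trans ?_
  rw [dxDual_dx _ (Γ.one_le_fiberDir h1 hi), dxDual_dx _ ((Γ.push σ).one_le_fiberDir h1 hi),
    Γ.fiberDir_eq hi, (Γ.push σ).fiberDir_eq hi]
  rcases (Γ.push σ).exists_eq_bIdx_or_fIdx (j := l)
    (Nat.lt_succ_of_le hl) with ⟨t, ht, rfl⟩ | ⟨k, hk1, hk2, rfl⟩
  · rw [if_neg ((Γ.push σ).bIdx_ne_fIdx ht h1 hi), if_neg]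
    rw [bIdx, ← firstGE_comp_hom, pushFactor, factor_comp_base (Γ.exists_push_eq σ),
      firstGE_comp_hom]
    change Γ.bIdx _ ≠ _
    -- Surjectivity of `σ` is not assumed: if `σ` never reaches `t`, the position takes the default
    -- value `n + r + 1`, which is no fiber direction.
    rcases Nat.lt_or_ge n (firstGE σ.toOrderHom t) with h' | h'
    · rw [Γ.bIdx_of_lt h']
      exact (Γ.fIdx_lt hi).ne'
    · exact Γ.bIdx_ne_fIdx h' h1 hi
  · have e1 : firstGE (Γ.pushFactor σ).toOrderHom ((Γ.push σ).fIdx k) = Γ.fIdx k := by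
      rw [fIdx, ← firstGE_comp_hom, pushFactor, factor_comp_fiber (Γ.exists_push_eq σ)]
      rfl
    have hinj : ∀ {a : ℕ} (Γ' : MaxChain a r), Γ'.fIdx k = Γ'.fIdx i ↔ k = i := by
      intro a Γ'
      refine ⟨fun h => ?_, fun h => by rw [h]⟩
      rcases lt_trichotomy k i with h' | h' | h'
      · have := Γ'.fIdx_strictMono h' (by omega)
        omega
      · exact h'
      · have := Γ'.fIdx_strictMono h' (by omega)
        omega
    rw [e1]
    simp only [hinj]

lemma contract_map_pushFactor (x : ExteriorAlgebra ℤ (Fin (m + r) → ℤ)) (k : ℕ) (hk : k ≤ r) :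
    Γ.contract k (ExteriorAlgebra.map (dxMap (Γ.pushFactor σ).toOrderHom) x) =
      ExteriorAlgebra.map (dxMap (Γ.pushFactor σ).toOrderHom) ((Γ.push σ).contract k x) := by
  induction k with
  | zero => rfl
  | succ k ih =>
    rw [contract_succ, contract_succ, ih (by omega)]
    refine (contr_map _ _ _).trans ?_
    rw [Γ.dxDual_comp_dxMap_pushFactor (by omega) hk]

/-- A full contraction comes from the base (`exists_baseE_eq_contract`), and on such forms
`baseDirE` inverts `baseE`; what remains is the pullback along `σ`. -/
lemma baseDirE_contract_pushFactor (x : ExteriorAlgebra ℤ (Fin (m + r) → ℤ)) :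
    Γ.baseDirE (Γ.contract r (ExteriorAlgebra.map (dxMap (Γ.pushFactor σ).toOrderHom) x)) =
      ExteriorAlgebra.map (dxMap σ.toOrderHom)
        ((Γ.push σ).baseDirE ((Γ.push σ).contract r x)) := by
  obtain ⟨y, hy⟩ := (Γ.push σ).exists_baseE_eq_contract x
  rw [Γ.contract_map_pushFactor x r le_rfl, ← hy, baseDirE_baseE]
  have h1 := map_map_dxMap_hom (Γ.pushFactor σ) (Γ.push σ).base y
  rw [pushFactor, factor_comp_base (Γ.exists_push_eq σ), ← map_map_dxMap_hom] at h1
  refine (congrArg Γ.baseDirE h1).trans ?_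
  exact Γ.baseDirE_baseE _

end degeneracy

end MaxChain

/-! ### Fiber integration of pure tensors and naturality of evaluation -/

open Simplicial

namespace MaxChain

variable {n m r : ℕ} (Γ : MaxChain n r)

lemma integrate_tmul (f : DP (n + r)) (x : ExteriorAlgebra ℤ (Fin (n + r) → ℤ)) :
    Γ.integrate (f ⊗ₜ x) =
      pullbackFun Γ.baseDir (Γ.integrateFun r f) ⊗ₜ Γ.baseDirE (Γ.contract r x) := by
  rw [integrate, TensorProduct.map_tmul]
  rfl

lemma integrate_add (w w' : Forms (n + r)) :
    Γ.integrate (w + w') = Γ.integrate w + Γ.integrate w' := by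
  rw [integrate, map_add, map_add]
  rfl

lemma integrate_zero : Γ.integrate 0 = 0 := by
  rw [integrate, map_zero, map_zero]

end MaxChain

lemma pullback_tmul {n m : ℕ} (α : Fin (m + 1) → Fin (n + 1)) (f : DP n)
    (x : ExteriorAlgebra ℤ (Fin n → ℤ)) :
    pullback α (f ⊗ₜ x) = pullbackFun α f ⊗ₜ ExteriorAlgebra.map (dxMap α) x := rfl

/-- Naturality of a simplicial map out of `Δ[r] ⊗ F` on pairs of simplices pulled back from a
simplex of the factors. -/
lemma app_comp {F G : SSet.{u}} {N K r n : ℕ} (e : Δ[r] ⊗ F ⟶ G) (f : ⦋N⦌ ⟶ ⦋K⦌)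
    (v : ⦋K⦌ ⟶ ⦋r⦌) (w : ⦋K⦌ ⟶ ⦋n⦌) (z : F _⦋n⦌) :
    e.app (.op ⦋N⦌) (SSet.stdSimplex.objEquiv.symm (f ≫ v), F.map (f ≫ w).op z) =
      G.map f.op (e.app (.op ⦋K⦌) (SSet.stdSimplex.objEquiv.symm v, F.map w.op z)) := by
  let t : (Δ[r] ⊗ F : SSet.{u}) _⦋K⦌ := (SSet.stdSimplex.objEquiv.symm v, F.map w.op z)
  have h : e.app (.op ⦋N⦌) ((Δ[r] ⊗ F : SSet.{u}).map f.op t) = G.map f.op (e.app (.op ⦋K⦌) t) :=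
    NatTrans.naturality_apply e f.op t
  refine Eq.trans ?_ h
  congr 1
  refine Prod.ext rfl ?_
  change _ = F.map f.op (F.map w.op z)
  rw [op_comp, Functor.map_comp_apply]

lemma ev_curry {F : SSet.{u}} {r n N : ℕ} (Φ : Δ[r] ⊗ F ⟶ deRham.{u}) (x : F _⦋n⦌)
    (v : ⦋N⦌ ⟶ ⦋r⦌) (w : ⦋N⦌ ⟶ ⦋n⦌) :
    ((ihom.ev Δ[r]).app deRham.{u}).app _ (SSet.stdSimplex.objEquiv.symm v,
      ((ihom Δ[r]).obj deRham.{u}).map w.op ((MonoidalClosed.curry Φ).app _ x)) =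
      Φ.app _ (SSet.stdSimplex.objEquiv.symm v, F.map w.op x) := by
  have h : Δ[r] ◁ MonoidalClosed.curry Φ ≫ (ihom.ev Δ[r]).app deRham = Φ := by
    rw [← MonoidalClosed.uncurry_eq, MonoidalClosed.uncurry_curry]
  conv_rhs => rw [← h]
  rw [← NatTrans.naturality_apply]
  rfl

/-! ### Fiberwise integration and degeneracies -/

namespace MaxChain

variable {n m r : ℕ} {σ : SimplexCategory.mk n ⟶ SimplexCategory.mk m}

/-- The exterior part is the same for all chains `Γ'` over `Γ`, so only the coefficients are summed,
by `sum_pullbackFun_integrateFun`. -/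
lemma sum_integrate_pullback (hσ : Function.Surjective σ.toOrderHom) (Γ : MaxChain m r)
    (w : Forms (m + r)) :
    (∑ Γ' : MaxChain n r, if Γ'.push σ = Γ then
      Γ'.integrate (pullback (Γ'.pushFactor σ).toOrderHom w) else 0) =
      pullback σ.toOrderHom (Γ.integrate w) := by
  induction w using TensorProduct.induction_on with
  | zero =>
    rw [integrate_zero, map_zero]
    refine Finset.sum_eq_zero fun Γ' _ => ?_
    split_ifs
    · exact (congrArg Γ'.integrate (map_zero _)).trans Γ'.integrate_zero
    · rfl
  | add w w' hw hw' =>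
    rw [integrate_add, map_add, ← hw, ← hw', ← Finset.sum_add_distrib]
    refine Finset.sum_congr rfl fun Γ' _ => ?_
    split_ifs
    · exact (congrArg Γ'.integrate (map_add _ _ _)).trans (Γ'.integrate_add _ _)
    · rw [add_zero]
  | tmul f x =>
    rw [integrate_tmul]
    refine Eq.trans ?_ (pullback_tmul σ.toOrderHom _ _).symm
    have h := sum_pullbackFun_integrateFun hσ Γ f
    refine Eq.trans ?_ (congrArg (fun g : DP n => (g ⊗ₜ[ℤ] ExteriorAlgebra.map
      (dxMap σ.toOrderHom) (Γ.baseDirE (Γ.contract r x)) : Forms n)) h)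
    dsimp only
    rw [TensorProduct.sum_tmul]
    refine Finset.sum_congr rfl fun Γ' _ => ?_
    split_ifs with hΓ
    · subst hΓ
      rw [← baseDirE_contract_pushFactor]
      exact Γ'.integrate_tmul _ _
    · rw [TensorProduct.zero_tmul]

end MaxChain

/-- Group the chains `Γ'` by their images under `push`. By naturality the form on the simplex of
`Γ'` is pulled back along `pushFactor` from the simplex of the image. -/
lemma chainSum_map {n m r : ℕ} {σ : ⦋n⦌ ⟶ ⦋m⦌} (hσ : Function.Surjective σ.toOrderHom)
    (z : ((ihom Δ[r]).obj deRham.{u}) _⦋m⦌) :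
    chainSum r (((ihom Δ[r]).obj deRham.{u}).map σ.op z) =
      pullback σ.toOrderHom (chainSum r z) := by
  let w : MaxChain m r → Forms (m + r) := fun Γ =>
    (((ihom.ev Δ[r]).app deRham.{u}).app _
      (SSet.stdSimplex.objEquiv.symm Γ.fiber, ((ihom Δ[r]).obj deRham.{u}).map Γ.base.op z)).down
  have hw : ∀ Γ' : MaxChain n r, (((ihom.ev Δ[r]).app deRham.{u}).app _
      (SSet.stdSimplex.objEquiv.symm Γ'.fiber, ((ihom Δ[r]).obj deRham.{u}).map Γ'.base.op
        (((ihom Δ[r]).obj deRham.{u}).map σ.op z))).down =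
      pullback (Γ'.pushFactor σ).toOrderHom (w (Γ'.push σ)) := by
    intro Γ'
    have h := app_comp ((ihom.ev Δ[r]).app deRham.{u}) (Γ'.pushFactor σ) (Γ'.push σ).fiber
      (Γ'.push σ).base z
    rw [MaxChain.pushFactor, MaxChain.factor_comp_base (Γ'.exists_push_eq σ),
      MaxChain.factor_comp_fiber (Γ'.exists_push_eq σ), op_comp, Functor.map_comp_apply] at h
    exact congrArg ULift.down h
  have h1 : chainSum r (((ihom Δ[r]).obj deRham.{u}).map σ.op z) =
      ∑ Γ' : MaxChain n r, Γ'.integrate (pullback (Γ'.pushFactor σ).toOrderHom (w (Γ'.push σ))) :=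
    Finset.sum_congr rfl fun Γ' _ => congrArg Γ'.integrate (hw Γ')
  have h2 : pullback σ.toOrderHom (chainSum r z) =
      ∑ Γ : MaxChain m r, pullback σ.toOrderHom (Γ.integrate (w Γ)) :=
    map_sum (pullback σ.toOrderHom) _ _
  rw [h1, h2, Finset.sum_congr rfl fun Γ _ => (MaxChain.sum_integrate_pullback hσ Γ (w Γ)).symm,
    Finset.sum_comm]
  refine Finset.sum_congr rfl fun Γ' _ => ?_
  rw [Finset.sum_ite_eq Finset.univ (Γ'.push σ), if_pos (Finset.mem_univ _)]

/-- The chosen degeneracy can be absorbed into the sum by `chainSum_map`, so the Eilenberg–Zilber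
decomposition disappears from the rest of the argument. -/
lemma prismIntegral_eq_chainSum (r : ℕ) {n : ℕ} (z : ((ihom Δ[r]).obj deRham.{u}) _⦋n⦌) :
    prismIntegral r z = chainSum r z := by
  have h := SSet.exists_nonDegenerate _ z
  have hepi := h.choose_spec.choose_spec.choose
  have hz := h.choose_spec.choose_spec.choose_spec.choose_spec
  have hc := chainSum_map (SimplexCategory.epi_iff_surjective.1 hepi)
    h.choose_spec.choose_spec.choose_spec.choose.1
  rw [← hz] at hc
  exact hc.symm

/-! ### Iterated integrals as multiadditive functions -/

section CrossInt

variable {n r : ℕ}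

/-- The sum over all maximal chains of the integrals of the products of forms given on the
simplices of the prism over `Δ[n]`. -/
noncomputable def crossInt (B : Fin r → Fin (n + 1) → Forms (n + 1)) : Forms n :=
  ∑ Γ : MaxChain n r, Γ.integrate
    (List.ofFn fun i => pullback (Γ.stepFactor i).toOrderHom (B i (Γ.col i))).prod

/-- The restriction of a form on `X`, pulled back along the evaluation map, to the simplices of the
prism over a simplex of the path space. -/
noncomputable def prismForm {X : SSet.{u}} (ω : X ⟶ deRham.{u}) (x : (PathSpace X) _⦋n⦌)
    (κ : Fin (n + 1)) : Forms (n + 1) :=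
  (ω.app (.op ⦋n + 1⦌) (((ihom.ev Δ[1]).app X).app (.op ⦋n + 1⦌)
    (SSet.stdSimplex.objEquiv.symm (MaxChain.colChain κ).fiber,
      (PathSpace X).map (MaxChain.colChain κ).base.op x))).down

/-- On the simplex of `Γ` the evaluation map with index `i` factors through the simplex of the prism
`[n] × [1]` in column `Γ.col i`. Each form therefore enters only through `prismForm`, which does not
depend on its place in the product. -/
lemma iteratedIntegral_eq_crossInt {X : SSet.{u}} (ω : Fin r → (X ⟶ deRham.{u}))
    (x : (PathSpace X) _⦋n⦌) :
    iteratedIntegral ω n x = crossInt fun i => prismForm (ω i) x := by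
  rw [iteratedIntegral, fiberIntegral, prismIntegral_eq_chainSum, chainSum, crossInt]
  refine Finset.sum_congr rfl fun Γ _ => ?_
  rw [ev_curry]
  refine congrArg Γ.integrate ?_
  refine congrArg List.prod (congrArg List.ofFn (funext fun i => ?_))
  have h := app_comp ((ihom.ev Δ[1]).app X) (Γ.stepFactor i)
    (MaxChain.colChain (Γ.col i)).fiber (MaxChain.colChain (Γ.col i)).base x
  rw [MaxChain.stepFactor, MaxChain.factor_comp_base (Γ.exists_colChain_eq i),
    MaxChain.factor_comp_fiber (Γ.exists_colChain_eq i)] at h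
  have h2 := (congrArg (fun t => ((ω i).app (.op ⦋n + r⦌) t)) h).trans
    (NatTrans.naturality_apply (ω i) (Γ.stepFactor i).op _)
  exact congrArg ULift.down h2

/-! ### Multiadditivity and reduction to pure tensors -/

lemma prod_ofFn_update {R : Type*} [Ring R] (w : Fin r → R) (p : Fin r) :
    ∃ a b : R, ∀ c, (List.ofFn (Function.update w p c)).prod = a * c * b := by
  induction r with
  | zero => exact p.elim0
  | succ r ih =>
    induction p using Fin.cases with
    | zero =>
      refine ⟨1, (List.ofFn fun i => w i.succ).prod, fun c => ?_⟩
      rw [List.ofFn_succ, List.prod_cons, Function.update_self, one_mul]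
      rfl
    | succ p =>
      obtain ⟨a, b, h⟩ := ih (fun i => w i.succ) p
      refine ⟨w 0 * a, b, fun c => ?_⟩
      rw [List.ofFn_succ, List.prod_cons, Function.update_of_ne (Fin.succ_ne_zero p).symm,
        mul_assoc (w 0), mul_assoc (w 0), ← h c]
      congr 3
      funext i
      by_cases hi : i = p
      · subst hi; simp
      · rw [Function.update_of_ne hi, Function.update_of_ne fun h' => hi (Fin.succ_injective _ h')]

lemma crossInt_update_add (B : Fin r → Fin (n + 1) → Forms (n + 1)) (p : Fin r)
    (b b' : Fin (n + 1) → Forms (n + 1)) :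
    crossInt (Function.update B p (b + b')) =
      crossInt (Function.update B p b) + crossInt (Function.update B p b') := by
  rw [crossInt, crossInt, crossInt, ← Finset.sum_add_distrib]
  refine Finset.sum_congr rfl fun Γ _ => ?_
  rw [← MaxChain.integrate_add]
  congr 1
  obtain ⟨a, c, h⟩ := prod_ofFn_update
    (fun i => pullback (Γ.stepFactor i).toOrderHom (B i (Γ.col i))) p
  have h' : ∀ b, (List.ofFn fun i => pullback (Γ.stepFactor i).toOrderHom
      (Function.update B p b i (Γ.col i))).prod =
      a * pullback (Γ.stepFactor p).toOrderHom (b (Γ.col p)) * c := by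
    intro b
    rw [← h]
    congr 2
    funext i
    by_cases hi : i = p
    · subst hi; simp
    · rw [Function.update_of_ne hi, Function.update_of_ne hi]
  rw [h', h', h', ← add_mul, ← mul_add, ← map_add]
  rfl

/-- Enlarge, one slot at a time, the set of slots whose argument may range over the generated
subgroup; in a single slot, additive maps that agree on generators agree on the subgroup. -/
lemma eq_of_eq_on_closure {ι V W : Type*} [Fintype ι] [DecidableEq ι] [AddCommGroup V]
    [AddCommGroup W] {G G' : (ι → V) → W}
    (hG : ∀ B i x y, G (Function.update B i (x + y)) =
      G (Function.update B i x) + G (Function.update B i y))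
    (hG' : ∀ B i x y, G' (Function.update B i (x + y)) =
      G' (Function.update B i x) + G' (Function.update B i y))
    (S : ι → Set V) (h : ∀ B, (∀ i, B i ∈ S i) → G B = G' B) (B : ι → V)
    (hB : ∀ i, B i ∈ AddSubgroup.closure (S i)) : G B = G' B := by
  have key : ∀ s : Finset ι, ∀ B : ι → V, (∀ i ∈ s, B i ∈ AddSubgroup.closure (S i)) →
      (∀ i ∉ s, B i ∈ S i) → G B = G' B := by
    intro s
    induction s using Finset.induction_on with
    | empty => exact fun B _ hB => h B fun i => hB i (Finset.notMem_empty i)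
    | insert j s hj ih =>
      intro B h1 h2
      let φ : V →+ W := AddMonoidHom.mk' (fun x => G (Function.update B j x)) (hG B j)
      let φ' : V →+ W := AddMonoidHom.mk' (fun x => G' (Function.update B j x)) (hG' B j)
      have hφ : Set.EqOn φ φ' (AddSubgroup.closure (S j)) := by
        refine AddMonoidHom.eqOn_closure fun x hx => ih _ (fun i hi => ?_) fun i hi => ?_
        · rw [Function.update_of_ne (ne_of_mem_of_not_mem hi hj)]
          exact h1 i (Finset.mem_insert_of_mem hi)
        · by_cases hij : i = j
          · subst hij
            rwa [Function.update_self]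
          · rw [Function.update_of_ne hij]
            exact h2 i (by simp [hij, hi])
      have h3 := hφ (h1 j (Finset.mem_insert_self j s))
      change G (Function.update B j (B j)) = G' (Function.update B j (B j)) at h3
      rwa [Function.update_eq_self] at h3
  exact key Finset.univ B (fun i _ => hB i) fun i hi => absurd (Finset.mem_univ i) hi

/-- The families of forms on the simplices of the prism over `Δ[n]` which are a pure tensor of
degree `k` on one simplex and vanish on the others. -/
def pureForms (n k : ℕ) : Set (Fin (n + 1) → Forms (n + 1)) :=
  {b | ∃ (κ : Fin (n + 1)) (f : DP (n + 1)), ∃ x ∈ ⋀[ℤ]^k (Fin (n + 1) → ℤ),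
    b = Pi.single κ (f ⊗ₜ[ℤ] x : Forms (n + 1))}

lemma mem_closure_pureForms {k : ℕ} {b : Fin (n + 1) → Forms (n + 1)}
    (hb : ∀ κ, b κ ∈ Forms.degreePart (n + 1) k) : b ∈ AddSubgroup.closure (pureForms n k) := by
  have key : ∀ κ, ∀ w ∈ Forms.degreePart (n + 1) k, (Pi.single κ w : Fin (n + 1) → Forms (n + 1)) ∈
      AddSubgroup.closure (pureForms n k) := by
    rintro κ _ ⟨t, rfl⟩
    induction t using TensorProduct.induction_on with
    | zero =>
      rw [map_zero, Pi.single_zero]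
      exact zero_mem _
    | add t t' ht ht' =>
      rw [map_add, Pi.single_add]
      exact add_mem ht ht'
    | tmul f x => exact AddSubgroup.subset_closure ⟨κ, f, x, x.2, rfl⟩
  rw [← Finset.univ_sum_single b]
  exact sum_mem fun κ _ => key κ _ (hb κ)

lemma prod_ofFn_tmul {N : ℕ} (f : Fin r → DP N) (x : Fin r → ExteriorAlgebra ℤ (Fin N → ℤ)) :
    (List.ofFn fun i => (f i ⊗ₜ x i : Forms N)).prod = (∏ i, f i) ⊗ₜ (List.ofFn x).prod := by
  induction r with
  | zero => simp [Algebra.TensorProduct.one_def]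
  | succ r ih =>
    rw [List.ofFn_succ, List.prod_cons, ih, Algebra.TensorProduct.tmul_mul_tmul,
      Fin.prod_univ_succ, List.ofFn_succ, List.prod_cons]

-- A chain whose columns differ from `κ` meets a factor that vanishes there. For the chain with
-- columns `κ`, if there is one, coefficients and differentials are integrated independently of each
-- other.
open MaxChain in
lemma crossInt_single (κ : Fin r → Fin (n + 1)) (f : Fin r → DP (n + 1))
    (x : Fin r → ExteriorAlgebra ℤ (Fin (n + 1) → ℤ)) (e : Fin r → ℤ)
    (he : ∀ i, gradeInv (fiberPart (κ i) (x i)) = (e i).negOnePow • fiberPart (κ i) (x i)) :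
    crossInt (fun i => Pi.single (κ i) (f i ⊗ₜ x i)) =
      monoInt κ f ⊗ₜ (normSign e • (List.ofFn fun i => fiberPart (κ i) (x i)).prod) := by
  rw [crossInt, monoInt, TensorProduct.sum_tmul]
  refine Finset.sum_congr rfl fun Γ _ => ?_
  split_ifs with h
  · subst h
    rw [← Γ.baseDirE_contract_prod x e he]
    refine Eq.trans ?_ (Γ.integrate_tmul _ _)
    refine congrArg Γ.integrate ?_
    refine Eq.trans ?_ (prod_ofFn_tmul _ _)
    congr 2
    funext i
    rw [Pi.single_eq_same]
    exact pullback_tmul _ _ _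
  · rw [TensorProduct.zero_tmul]
    obtain ⟨i, hi⟩ : ∃ i, Γ.col i ≠ κ i := by
      by_contra! hc
      exact h (funext hc)
    refine (congrArg Γ.integrate ?_).trans Γ.integrate_zero
    refine List.prod_eq_zero ((List.mem_ofFn' _ _).2 ⟨i, ?_⟩)
    dsimp only
    rw [Pi.single_eq_of_ne hi]
    exact map_zero _

end CrossInt

open Simplicial

/-! ### The product of two iterated integrals -/

section

variable {n p q : ℕ}

/-- The sign of a shuffle in the product of two iterated integrals of forms of degrees
`d i + 1`. -/
noncomputable def shuffleSign (p q : ℕ) (d : Fin (p + q) → ℤ) (σ : Equiv.Perm (Fin (p + q))) : ℤˣ :=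
  koszulSign σ d * normSign (fun i => d (Fin.castAdd q i)) *
    normSign (fun j => d (Fin.natAdd p j)) * normSign fun i => d (σ i)

/-- Taking the fiber part lowers the degree by one and kills degree zero, so the sign formally
attached to degree `-1` does no harm. -/
lemma fiberPart_commute {r : ℕ} (deg : Fin r → ℕ) (κ : Fin r → Fin (n + 1))
    {x : Fin r → ExteriorAlgebra ℤ (Fin (n + 1) → ℤ)}
    (hx : ∀ i, x i ∈ ⋀[ℤ]^(deg i) (Fin (n + 1) → ℤ)) (i j : Fin r) :
    MaxChain.fiberPart (κ i) (x i) * MaxChain.fiberPart (κ j) (x j) =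
      (((deg i : ℤ) - 1) * ((deg j : ℤ) - 1)).negOnePow •
        (MaxChain.fiberPart (κ j) (x j) * MaxChain.fiberPart (κ i) (x i)) := by
  have hi := hx i
  have hj := hx j
  cases hk : deg i with
  | zero =>
    rw [hk] at hi
    rw [MaxChain.fiberPart_of_mem_zero _ hi, zero_mul, mul_zero, smul_zero]
  | succ k =>
    cases hl : deg j with
    | zero =>
      rw [hl] at hj
      rw [MaxChain.fiberPart_of_mem_zero _ hj, zero_mul, mul_zero, smul_zero]
    | succ l =>
      rw [hk] at hi
      rw [hl] at hj
      rw [mul_eq_negOnePow_smul_mul (MaxChain.fiberPart_mem _ hi) (MaxChain.fiberPart_mem _ hj)]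
      congr 2
      push_cast
      ring

lemma gradeInv_fiberPart (k : ℕ) (κ : Fin (n + 1)) {x : ExteriorAlgebra ℤ (Fin (n + 1) → ℤ)}
    (hx : x ∈ ⋀[ℤ]^k (Fin (n + 1) → ℤ)) :
    gradeInv (MaxChain.fiberPart κ x) = ((k : ℤ) - 1).negOnePow • MaxChain.fiberPart κ x := by
  cases k with
  | zero => rw [MaxChain.fiberPart_of_mem_zero _ hx, map_zero, smul_zero]
  | succ k =>
    rw [gradeInv_of_mem (MaxChain.fiberPart_mem _ hx)]
    congr 2
    push_cast
    ring

/-- On pure tensors the two sources of the formula separate: the coefficients give the sum over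
shuffles, and graded commutativity of the fiber parts gives the Koszul sign. -/
lemma crossInt_mul_of_mem_pureForms (deg : Fin (p + q) → ℕ)
    (B : Fin (p + q) → Fin (n + 1) → Forms (n + 1)) (hB : ∀ i, B i ∈ pureForms n (deg i)) :
    crossInt (fun i => B (Fin.castAdd q i)) * crossInt (fun j => B (Fin.natAdd p j)) =
      ∑ σ ∈ shuffles p q, (shuffleSign p q (fun i => (deg i : ℤ) - 1) σ : ℤ) •
        crossInt fun i => B (σ i) := by
  choose κ f x hx hB' using hB
  obtain rfl := funext hB'
  have hg := fun i => gradeInv_fiberPart (deg i) (κ i) (hx i)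
  have hprod : (List.ofFn fun i : Fin p => MaxChain.fiberPart (κ (Fin.castAdd q i))
      (x (Fin.castAdd q i))).prod * (List.ofFn fun j : Fin q =>
        MaxChain.fiberPart (κ (Fin.natAdd p j)) (x (Fin.natAdd p j))).prod =
      (List.ofFn fun i => MaxChain.fiberPart (κ i) (x i)).prod := by
    have h := congrArg (List.map fun i => MaxChain.fiberPart (κ i) (x i))
      (castAdd_append_natAdd p q)
    rw [List.map_append, List.map_ofFn, List.map_ofFn, List.map_ofFn] at h
    rw [← List.prod_append]
    exact congrArg List.prod h
  rw [crossInt_single _ _ _ _ fun i => hg (Fin.castAdd q i),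
    crossInt_single _ _ _ _ fun j => hg (Fin.natAdd p j), Algebra.TensorProduct.tmul_mul_tmul,
    MaxChain.monoInt_mul_monoInt, smul_mul_smul_comm, hprod, TensorProduct.sum_tmul]
  refine Finset.sum_congr rfl fun σ _ => ?_
  rw [crossInt_single _ _ _ _ fun i => hg (σ i),
    prod_ofFn_eq_koszulSign_smul _ _ (fiberPart_commute deg κ hx) σ, ← TensorProduct.tmul_smul,
    ← Units.smul_def, smul_smul, smul_smul, shuffleSign]
  congr 2
  -- The `normSign` of the shuffled degrees occurs twice, in `shuffleSign` and from the integral of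
  -- the shuffled forms, and squares to one.
  rw [mul_assoc _ (normSign _) (normSign _), Int.units_mul_self, mul_one]
  ac_rfl

/-- Both sides are additive in each `B i`, and homogeneous families are sums of pure ones
(`mem_closure_pureForms`). -/
lemma crossInt_mul (deg : Fin (p + q) → ℕ) (B : Fin (p + q) → Fin (n + 1) → Forms (n + 1))
    (hB : ∀ i κ, B i κ ∈ Forms.degreePart (n + 1) (deg i)) :
    crossInt (fun i => B (Fin.castAdd q i)) * crossInt (fun j => B (Fin.natAdd p j)) =
      ∑ σ ∈ shuffles p q, (shuffleSign p q (fun i => (deg i : ℤ) - 1) σ : ℤ) •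
        crossInt fun i => B (σ i) := by
  refine eq_of_eq_on_closure
    (G := fun B => crossInt (fun i => B (Fin.castAdd q i)) * crossInt (fun j => B (Fin.natAdd p j)))
    (G' := fun B => ∑ σ ∈ shuffles p q, (shuffleSign p q (fun i => (deg i : ℤ) - 1) σ : ℤ) •
      crossInt fun i => B (σ i))
    (fun B i b b' => ?_) (fun B i b b' => ?_) (fun i => pureForms n (deg i))
    (crossInt_mul_of_mem_pureForms deg) B fun i => mem_closure_pureForms (hB i)
  · induction i using Fin.addCases with
    | left i =>
      have h1 : ∀ b, (fun k => Function.update B (Fin.castAdd q i) b (Fin.castAdd q k)) =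
          Function.update (fun k => B (Fin.castAdd q k)) i b := fun b =>
        Function.update_comp_eq_of_injective B (Fin.castAdd_injective p q) i b
      have h2 : ∀ b, (fun k => Function.update B (Fin.castAdd q i) b (Fin.natAdd p k)) =
          fun k => B (Fin.natAdd p k) := fun b =>
        funext fun k => Function.update_of_ne (by simp [Fin.ext_iff]; omega) _ _
      simp only [h1, h2, crossInt_update_add, add_mul]
    | right j =>
      have h1 : ∀ b, (fun k => Function.update B (Fin.natAdd p j) b (Fin.natAdd p k)) =
          Function.update (fun k => B (Fin.natAdd p k)) j b := fun b =>
        Function.update_comp_eq_of_injective B (Fin.natAdd_injective q p) j b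
      have h2 : ∀ b, (fun k => Function.update B (Fin.natAdd p j) b (Fin.castAdd q k)) =
          fun k => B (Fin.castAdd q k) := fun b =>
        funext fun k => Function.update_of_ne (by simp [Fin.ext_iff]; omega) _ _
      simp only [h1, h2, crossInt_update_add, mul_add]
  -- Changing slot `i` of `B` changes slot `σ.symm i` of the permuted family, so each summand is
  -- additive there.
  · have h : ∀ (σ : Equiv.Perm (Fin (p + q))) b, (fun k => Function.update B i b (σ k)) =
        Function.update (fun k => B (σ k)) (σ.symm i) b := fun σ b => by
      have h := Function.update_comp_eq_of_injective B σ.injective (σ.symm i) b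
      rwa [Equiv.apply_symm_apply] at h
    simp only [h, crossInt_update_add, smul_add, Finset.sum_add_distrib]

end

end SimplicialIteratedIntegral

theorem mainTheorem6 (X : SSet.{u}) (p q : ℕ)
    (ω : Fin (p + q) → (X ⟶ SimplicialIteratedIntegral.deRham.{u}))
    (deg : Fin (p + q) → ℕ)
    (hω : ∀ i, SimplicialIteratedIntegral.IsHomogeneous (ω i) (deg i)) :
    SimplicialIteratedIntegral.iteratedIntegral (fun i : Fin p => ω (Fin.castAdd q i)) *
        SimplicialIteratedIntegral.iteratedIntegral (fun j : Fin q => ω (Fin.natAdd p j)) =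
      ∑ σ ∈ SimplicialIteratedIntegral.shuffles p q,
        ((SimplicialIteratedIntegral.koszulSign σ (fun i => (deg i : ℤ) - 1) *
            SimplicialIteratedIntegral.normSign (fun i : Fin p => (deg (Fin.castAdd q i) : ℤ) - 1) *
            SimplicialIteratedIntegral.normSign (fun j : Fin q => (deg (Fin.natAdd p j) : ℤ) - 1) *
            SimplicialIteratedIntegral.normSign (fun i => (deg (σ i) : ℤ) - 1) : ℤˣ) : ℤ) •
          SimplicialIteratedIntegral.iteratedIntegral (fun i => ω (σ i)) := by
  funext n x
  rw [Pi.mul_apply, Pi.mul_apply, Finset.sum_apply, Finset.sum_apply]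
  simp only [Pi.smul_apply, SimplicialIteratedIntegral.iteratedIntegral_eq_crossInt]
  exact SimplicialIteratedIntegral.crossInt_mul deg
    (fun i => SimplicialIteratedIntegral.prismForm (ω i) x) fun i κ => hω i (n + 1) _
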